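/- **Setting.** Let $p$ be a prime, $q=p^a$ with $a\ge 1$, let $n>1$ and $2\le m\le n-1$. Let $\mathbb{C}_p$ be the completion of $\overline{\mathbb{Q}}_p$, with $\mathrm{ord}_p(p)=1$ and $\mathrm{ord}_p(0)=\infty$; let $\mathbb{Q}_q\subset\mathbb{C}_p$ be the unramified extension of $\mathbb{Q}_p$ of degree $a$, and $\zeta_p\in\mathbb{C}_p$ a primitive $p$-th root of unity. Let $\gamma\in\mathbb{Q}_p(\zeta_p)$ be a zero of $\sum_{k\ge0}x^{p^k}/p^k$ with $\mathrm{ord}_p\gamma=\frac1{p-1}$, let $\tilde\gamma\in\mathbb{C}_p$ satisfy $\tilde\gamma^n=\gamma$, let $K=\mathbb{Q}_q(\zeta_p,\tilde\gamma)$, and let $\mathcal{O}=\mathbb{Z}_q[\tilde\gamma]$ be its ring of integers. Let $\sigma$ be the automorphism of $K$ over $\mathbb{Q}_p$ that extends the Frobenius generator of $\mathrm{Gal}(\mathbb{Q}_q/\mathbb{Q}_p)$ and fixes $\zeta_p$ and $\tilde\gamma$. Let $t\in\mathbb{F}_q^*$, with Teichmüller representative $\bar t\in\mathbb{Q}_q$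 (so $\bar t^{\,q}=\bar t\ne0$). Let $\Theta_\infty(x)=E(\gamma x)$ with $E(x)=\exp\big(\sum_{k\ge0}x^{p^k}/p^k\big)$, let $F_t(x,y)=\Theta_\infty(x^n)\,\Theta_\infty(y)\,\Theta_\infty\big(\tfrac{\bar t}{xy}\big)$, and for $(u,v)\in\mathbb{Z}^2$ let $\omega(u,v)=\frac un+v+\frac{2n+1}n\max\{0,-u,-v\}$. Let $$\mathcal{C}_0=\Big\{\sum_{(u,v)\in\mathbb{Z}^2}\xi(u,v)\,\tilde\gamma^{\,n\omega(u,v)}x^uy^v:\ \xi(u,v)\in\mathcal{O},\ \xi(u,v)\to0\text{ as }\omega(u,v)\to\infty\Big\}.$$ Let $\psi_p\big(\sum c(u,v)x^uy^v\big)=\sum c(pu,pv)x^uy^v$ and $\alpha_1=\sigma^{-1}\circ\psi_p\circ F_t$, where $F_t$ acts by multiplication and $\sigma^{-1}$ acts on coefficients. With $\gamma_i=\sum_{k=0}^i\gamma^{p^k}/p^k$, let $$D_x=x\tfrac{\partial}{\partial x}+\sum_{i\ge0}\gamma_ip^i\Big(nx^{np^i}-\frac{\sigma^i(\bar t)}{x^{p^i}y^{p^i}}\Big),\qquad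 D_y=y\tfrac{\partial}{\partial y}+\sum_{i\ge0}\gamma_ip^i\Big(y^{p^i}-\frac{\sigma^i(\bar t)}{x^{p^i}y^{p^i}}\Big),$$ and $H^2=\mathcal{C}_0/(D_x\mathcal{C}_0+D_y\mathcal{C}_0)$. Let $\tilde\varepsilon_i=\tilde\gamma^{\,i}x^i$ for $0\le i\le n$ and $\tilde\varepsilon_i=\tilde\gamma^{\,i}x^{i-n}y$ for $n+1\le i\le2n$. For integers $i,j$ put $\alpha_{i,j}=i-pj+n\lceil\frac{pj-i}n\rceil$. Let $S_m$ be the group of permutations of $\{0,\dots,m-1\}$ and $S_m^0\subseteq S_m$ the set of those $\delta$ for which $\sum_{i=0}^{m-1}\alpha_{i,\delta(i)}$ is minimal. Let $V(x_0,\dots,x_{m-1})$ be the $m\times m$ matrix with entries $V_{ij}=\prod_{k=0}^{j-1}(x_i-k)^2$, $0\le i,j\le m-1$. **Theorem 3.5.** Assume that $\det V(x_0,\dots,x_{m-1})\ne0$ for all distinct integers $x_0,\dots,x_{m-1}$ with $0\le x_i\le n-1$, and let $M_n(m)$ be the maximum of $|\det V(x_0,\dots,x_{m-1})|$ over all such $x_0,\dots,x_{m-1}$.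 Assume $p>\max\{M_n(m),\,2n^3-n^2-n+1\}$. Then $D_x$ and $D_y$ map $\mathcal{C}_0$ into itself, the classes of $\tilde\varepsilon_0,\dots,\tilde\varepsilon_{2n}$ form an $\mathcal{O}$-basis of $H^2$, and there is a unique matrix $A=(A_{ij})_{0\le i,j\le2n}$ over $\mathcal{O}$ with $\alpha_1(\tilde\varepsilon_i)=\sum_{j=0}^{2n}A_{ij}\tilde\varepsilon_j$ in $H^2$ for all $i$. If $\det(I-AT)=1+b_1T+\dots+b_{2n+1}T^{2n+1}$, then for every $\delta\in S_m^0$ $$\mathrm{ord}_p\,b_m=\frac{m(m-1)}{2n}+\frac{2n+1}{n(p-1)}\sum_{i=0}^{m-1}\alpha_{i,\delta(i)}.$$ -/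

import Mathlib

open Filter Topology

noncomputable section

namespace ToricNP

/-! ### The `p`-adic fields -/

section Fields

variable (p : ℕ) [Fact p.Prime]

/-- `ℚ_q` for `q = p ^ a`: the unramified extension of `ℚ_p` of degree `a` inside `ℂ_p`,
generated by the Teichmüller representatives of `𝔽_q`, i.e. by the solutions of `z ^ q = z`. -/
def Qq (a : ℕ) : IntermediateField ℚ_[p] ℂ_[p] :=
  IntermediateField.adjoin ℚ_[p] {z : ℂ_[p] | z ^ p ^ a = z}

/-- `Ω₁ = ℚ_p(ζ_p)`. -/
def Omega1 : IntermediateField ℚ_[p] ℂ_[p] :=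
  IntermediateField.adjoin ℚ_[p] {z : ℂ_[p] | z ^ p = 1}

/-- `Ω₀(γ̃)`, where `Ω₀ = ℚ_q(ζ_p)`. Its ring of integers `ℤ_q[γ̃]` is the set of elements of
norm at most `1`. -/
def Omega0 (a : ℕ) (γt : ℂ_[p]) : IntermediateField ℚ_[p] ℂ_[p] :=
  Qq p a ⊔ Omega1 p ⊔ IntermediateField.adjoin ℚ_[p] {γt}

/-- `γ̃` as an element of `Ω₀(γ̃)`. -/
def gen (a : ℕ) (γt : ℂ_[p]) : Omega0 p a γt :=
  ⟨γt, (le_sup_right : IntermediateField.adjoin ℚ_[p] {γt} ≤ Omega0 p a γt)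
    (IntermediateField.mem_adjoin_simple_self ℚ_[p] γt)⟩

/-- `σ` is the Frobenius generator of `Gal(ℚ_q/ℚ_p)` (`z ↦ z ^ p` on Teichmüller
representatives), extended to `Ω₀(γ̃)` by `σ(ζ_p) = ζ_p` and `σ(γ̃) = γ̃`. These conditions
determine `σ`. -/
def IsFrobenius (a : ℕ) (γt : ℂ_[p])
    (σ : Omega0 p a γt ≃ₐ[ℚ_[p]] Omega0 p a γt) : Prop :=
  (∀ z : Omega0 p a γt, z ^ p ^ a = z → σ z = z ^ p) ∧
  (∀ z : Omega0 p a γt, z ^ p = 1 → σ z = z) ∧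
  σ (gen p a γt) = gen p a γt

/-- The additive valuation `ord_p`, with values in `ℝ ∪ {∞}`; here `‖p‖ = 1 / p`, so that
`ord_p p = 1`. -/
def ordp {K : Type*} [NormedField K] (x : K) : WithTop ℝ :=
  open Classical in if x = 0 then ⊤ else ((-Real.logb p ‖x‖ : ℝ) : WithTop ℝ)

/-- `γ` is a zero of `∑_k x^{p^k}/p^k` in `Ω₁` with `ord_p γ = 1/(p-1)`. -/
def IsSplittingRoot (γ : ℂ_[p]) : Prop :=
  γ ∈ Omega1 p ∧
  HasSum (fun k : ℕ => γ ^ p ^ k / (p : ℂ_[p]) ^ k) 0 ∧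
  ordp p γ = ((1 / ((p : ℝ) - 1) : ℝ) : WithTop ℝ)

end Fields

/-! ### The splitting function and the Frobenius operator -/

/-- `∑_k x^{p^k}/p^k`. -/
def artinHasseLog (p : ℕ) : PowerSeries ℚ :=
  open Classical in PowerSeries.mk fun j => if ∃ k : ℕ, j = p ^ k then 1 / (j : ℚ) else 0

/-- The Artin–Hasse series `E(x) = exp(∑_k x^{p^k}/p^k)`. -/
def artinHasse (p : ℕ) : PowerSeries ℚ :=
  (PowerSeries.exp ℚ).subst (artinHasseLog p)

section Operators

variable {K : Type*} [NormedField K] [CharZero K]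

/-- The coefficient `a_k` of `x^k` in the splitting function `Θ_∞(x) = E(γ x)`. -/
def splitCoeff (p : ℕ) (γ : K) (k : ℕ) : K :=
  ((PowerSeries.coeff k (artinHasse p) : ℚ) : K) * γ ^ k

/-- The coefficient `B(w)` of `x^{w.1} y^{w.2}` in
`F_t(x,y) = Θ_∞(x^n) Θ_∞(y) Θ_∞(t̄/(xy))`: the sum of `t̄^k a_k a_l a_m` over the triples
`(k,l,m)` of natural numbers with `n l - k = w.1` and `m - k = w.2`. -/
def frobSeries (p n : ℕ) (γ tbar : K) (w : ℤ × ℤ) : K :=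
  ∑' s : {s : ℕ × ℕ × ℕ // (n : ℤ) * s.2.1 - s.1 = w.1 ∧ (s.2.2 : ℤ) - s.1 = w.2},
    tbar ^ s.1.1 *
      (splitCoeff p γ s.1.1 * splitCoeff p γ s.1.2.1 * splitCoeff p γ s.1.2.2)

/-- The product of two series `∑ F(w) x^{w.1} y^{w.2}` and `∑ c(w) x^{w.1} y^{w.2}`. -/
def mulSeries (F c : ℤ × ℤ → K) (w : ℤ × ℤ) : K :=
  ∑' u : ℤ × ℤ, F (w - u) * c u

/-- `ψ_p`: the coefficient at `(a,b)` of `ψ_p(c)` is the coefficient of `c` at `(pa,pb)`. -/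
def psi (p : ℕ) (c : ℤ × ℤ → K) (w : ℤ × ℤ) : K :=
  c ((p : ℤ) * w.1, (p : ℤ) * w.2)

/-- `α₁ = σ⁻¹ ∘ ψ_p ∘ F_t`. -/
def alpha1 (p n : ℕ) (σ : K ≃+* K) (γ tbar : K) (c : ℤ × ℤ → K) (w : ℤ × ℤ) : K :=
  σ.symm (psi p (mulSeries (frobSeries p n γ tbar) c) w)

/-- `γ_i = ∑_{k=0}^{i} γ^{p^k}/p^k`. -/
def gammaSum (p : ℕ) (γ : K) (i : ℕ) : K :=
  ∑ k ∈ Finset.range (i + 1), γ ^ p ^ k / (p : K) ^ k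

/-- `D_x = x ∂/∂x + ∑_i γ_i p^i (n x^{n p^i} - σ^i(t̄) / (x^{p^i} y^{p^i}))`. -/
def Dx (p n : ℕ) (σ : K ≃+* K) (γ tbar : K) (c : ℤ × ℤ → K) (w : ℤ × ℤ) : K :=
  (w.1 : K) * c w + ∑' i : ℕ, gammaSum p γ i * (p : K) ^ i *
    ((n : K) * c (w.1 - (n : ℤ) * (p : ℤ) ^ i, w.2)
      - (σ : K → K)^[i] tbar * c (w.1 + (p : ℤ) ^ i, w.2 + (p : ℤ) ^ i))

/-- `D_y = y ∂/∂y + ∑_i γ_i p^i (y^{p^i} - σ^i(t̄) / (x^{p^i} y^{p^i}))`. -/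
def Dy (p : ℕ) (σ : K ≃+* K) (γ tbar : K) (c : ℤ × ℤ → K) (w : ℤ × ℤ) : K :=
  (w.2 : K) * c w + ∑' i : ℕ, gammaSum p γ i * (p : K) ^ i *
    (c (w.1, w.2 - (p : ℤ) ^ i)
      - (σ : K → K)^[i] tbar * c (w.1 + (p : ℤ) ^ i, w.2 + (p : ℤ) ^ i))

end Operators

/-! ### The Banach module `𝒞₀` and its top cohomology -/

/-- `n ω(a,b) = a + n b + (2n+1) max{0,-a,-b}`, a non-negative integer, where `ω` is the weight
function of the triangle with vertices `(-1,-1)`, `(n,0)`, `(0,1)`. -/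
def nWeight (n : ℕ) (w : ℤ × ℤ) : ℤ :=
  w.1 + (n : ℤ) * w.2 + (2 * (n : ℤ) + 1) * max 0 (max (-w.1) (-w.2))

section Cohomology

variable {K : Type*} [NormedField K] [CharZero K]

/-- `𝒞₀`: the series `∑ ξ(a,b) γ̃^{n ω(a,b)} x^a y^b` with integral `ξ(a,b)` tending to `0`
as `ω(a,b) → ∞`. (Only finitely many lattice points have weight below a given bound, so this is
the limit along the cofinite filter.) A series is represented by its coefficients. -/
def C0 (n : ℕ) (γt : K) : Set (ℤ × ℤ → K) :=
  {c | ∃ ξ : ℤ × ℤ → K, (∀ w, ‖ξ w‖ ≤ 1) ∧ Tendsto ξ cofinite (𝓝 0) ∧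
    ∀ w, c w = ξ w * γt ^ nWeight n w}

/-- The exponent of `ε_i`: `x^i` for `0 ≤ i ≤ n` and `x^{i-n} y` for `n+1 ≤ i ≤ 2n`. -/
def epsExp (n i : ℕ) : ℤ × ℤ :=
  if i ≤ n then ((i : ℤ), 0) else ((i : ℤ) - n, 1)

/-- `ε̃_i = γ̃^{n ω(ε_i)} ε_i`. -/
def epsTilde (n : ℕ) (γt : K) (i : ℕ) : ℤ × ℤ → K :=
  Pi.single (epsExp n i) (γt ^ nWeight n (epsExp n i))

/-- `β = β'` in `H² = 𝒞₀ / (D_x 𝒞₀ + D_y 𝒞₀)`. Here `γ = γ̃ ^ n`. -/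
def Cohomologous (p n : ℕ) (σ : K ≃+* K) (γt tbar : K) (β β' : ℤ × ℤ → K) : Prop :=
  ∃ ζx ∈ C0 n γt, ∃ ζy ∈ C0 n γt,
    β = β' + Dx p n σ (γt ^ n) tbar ζx + Dy p σ (γt ^ n) tbar ζy

/-- The classes of `ε̃_0, …, ε̃_{2n}` form a basis of `H²` over the ring of integers, i.e.
`𝒞₀ = ⨁ ℤ_q[γ̃] ε̃_i ⊕ (D_x 𝒞₀ + D_y 𝒞₀)`. -/
def EpsIsBasis (p n : ℕ) (σ : K ≃+* K) (γt tbar : K) : Prop :=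
  (∀ ζ ∈ C0 n γt, Dx p n σ (γt ^ n) tbar ζ ∈ C0 n γt ∧ Dy p σ (γt ^ n) tbar ζ ∈ C0 n γt) ∧
  ∀ β ∈ C0 n γt, ∃! a : Fin (2 * n + 1) → K, (∀ j, ‖a j‖ ≤ 1) ∧
    Cohomologous p n σ γt tbar β (∑ j : Fin (2 * n + 1), a j • epsTilde n γt (j : ℕ))

/-- `A` is the matrix, with integral entries, of `α₁` on `H²`:
`α₁(ε̃_i) = ∑_j A_{ij} ε̃_j` in `H²`. -/
def IsFrobeniusMatrix (p n : ℕ) (σ : K ≃+* K) (γt tbar : K)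
    (A : Matrix (Fin (2 * n + 1)) (Fin (2 * n + 1)) K) : Prop :=
  (∀ i j, ‖A i j‖ ≤ 1) ∧
  ∀ i : Fin (2 * n + 1),
    Cohomologous p n σ γt tbar (alpha1 p n σ (γt ^ n) tbar (epsTilde n γt (i : ℕ)))
    (∑ j : Fin (2 * n + 1), A i j • epsTilde n γt (j : ℕ))

end Cohomology

/-! ### Combinatorial data -/

/-- `α_{i,j} = i - p j + n ⌈(p j - i)/n⌉`. -/
def alphaInt (p n : ℕ) (i j : ℤ) : ℤ :=
  i - p * j + n * ⌈((p : ℚ) * j - i) / n⌉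

/-- `∑_{i=0}^{m-1} α_{i,δ(i)}`. -/
def alphaSum (p n m : ℕ) (δ : Equiv.Perm (Fin m)) : ℤ :=
  ∑ i : Fin m, alphaInt p n (i : ℕ) (δ i : ℕ)

/-- The set `S_m^0` of the permutations `δ` that minimize `∑ α_{i,δ(i)}`. -/
def minPerms (p n m : ℕ) : Set (Equiv.Perm (Fin m)) :=
  {δ | ∀ δ', alphaSum p n m δ ≤ alphaSum p n m δ'}

/-- The matrix with rows `1, x_i², x_i²(x_i-1)², …, x_i²(x_i-1)²⋯(x_i-m+2)²`. -/
def vandermondeLike (m : ℕ) (x : Fin m → ℤ) : Matrix (Fin m) (Fin m) ℤ :=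
  Matrix.of fun i j => ∏ k ∈ Finset.range (j : ℕ), (x i - k) ^ 2

/-- `det V(x_0,…,x_{m-1}) ≠ 0` for all distinct integers `x_i` with `0 ≤ x_i ≤ n-1`. -/
def VandermondeAssumption (n m : ℕ) : Prop :=
  ∀ x : Fin m → ℤ, Function.Injective x → (∀ i, 0 ≤ x i ∧ x i ≤ (n : ℤ) - 1) →
    (vandermondeLike m x).det ≠ 0

/-- `M_n(m)`: the maximum of `|det V(x_0,…,x_{m-1})|` over distinct `0 ≤ x_i ≤ n-1`. -/
def maxDet (n m : ℕ) : ℕ :=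
  Finset.univ.sup fun x : Fin m ↪ Fin n =>
    (vandermondeLike m fun i => ((x i : ℕ) : ℤ)).det.natAbs

end ToricNP

end

/-!
Write `z = 1 / (x y)` and normalize coefficients by powers of `γ̃` according to the weight. Modulo
`γ̃`, multiplication of monomials becomes that of the graded ring `k[x, y, z] / (x y z)`, and the
parts of `D_x` and `D_y` that raise the weight become multiplication by `n x^n - t z` and `y - t z`.
In this ring the monomials `ε_i` span a complement of the ideal generated by these two forms, and
the only syzygies are the trivial ones. Since `D_x` and `D_y` commute, both facts lift to `𝒞₀` by
successive approximation.

The series `F_t` converges on a larger region than `𝒞₀` requires, so for `j < n` the entry `A_ij`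
is, up to a power of `γ̃`, close to a single coefficient of `F_t`. The leading term of that
coefficient is a power of `γ̃` times `t̄^k / (k!² l!)` with `k = α_ij`, because the coefficients of
the Artin–Hasse series are integral (Dwork's lemma) and equal `1 / k!` for `k < p`. In the expansion
of the coefficient `b_m`, the principal minor on `0, …, m - 1` dominates all others because `p` is
large, and in it only the permutations in `S_m^0` contribute to the leading term. Multiplying
through by factorials, the sum of their contributions is, up to a unit, the determinant of a matrix
`V`: a nonzero integer of absolute value at most `M_n(m) < p`, hence a unit at `p`.
-/


namespace ToricNP

section Weights

/-- The depth of the lattice point `(u, v)`: the exponent of `z` when `x^u y^v` is written as a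
monomial `x^a y^b z^c` in `x`, `y` and `z = 1 / (x y)` with `min a b c = 0`. -/
def depth (w : ℤ × ℤ) : ℤ := max 0 (max (-w.1) (-w.2))

/-- The exponents of the monomials `ε_0, …, ε_{2n}`. -/
def IsEps (n : ℕ) (w : ℤ × ℤ) : Prop :=
  (w.2 = 0 ∧ 0 ≤ w.1 ∧ w.1 ≤ n) ∨ (w.2 = 1 ∧ 1 ≤ w.1 ∧ w.1 ≤ n)

/-- The exponents of the monomials `x^a`, `z^c` and `x^a z`, where `z = 1 / (x y)`: they represent
a basis of the graded ring `k[x, y, z] / (x y z)` modulo `y - t z`. -/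
def IsNormal (w : ℤ × ℤ) : Prop := w.2 ≤ 0 ∧ w.2 ≤ w.1 ∧ (-1 ≤ w.2 ∨ w.1 = w.2)

theorem nWeight_eq (n : ℕ) (w : ℤ × ℤ) :
    nWeight n w = w.1 + n * w.2 + (2 * n + 1) * depth w := rfl

theorem depth_nonneg (w : ℤ × ℤ) : 0 ≤ depth w := le_max_left _ _

theorem depth_add_le (u v : ℤ × ℤ) : depth (u + v) ≤ depth u + depth v := by
  simp only [depth, Prod.fst_add, Prod.snd_add]; omega

theorem depth_zsmul {j : ℤ} (hj : 0 ≤ j) (u : ℤ × ℤ) : depth (j • u) = j * depth u := by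
  simp only [depth, Prod.smul_fst, Prod.smul_snd, smul_eq_mul, ← mul_neg]
  rw [mul_max_of_nonneg _ _ hj, mul_max_of_nonneg _ _ hj, mul_zero]

theorem nWeight_nonneg (n : ℕ) (w : ℤ × ℤ) : 0 ≤ nWeight n w := by
  have h₁ : 0 ≤ w.1 + depth w := by simp only [depth]; omega
  have h₂ : 0 ≤ n * (w.2 + depth w) := mul_nonneg n.cast_nonneg (by simp only [depth]; omega)
  have h₃ : 0 ≤ n * depth w := mul_nonneg n.cast_nonneg (depth_nonneg w)
  rw [nWeight_eq]
  linarith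

theorem nWeight_add (n : ℕ) (u v : ℤ × ℤ) :
    nWeight n (u + v) =
      nWeight n u + nWeight n v - (2 * n + 1) * (depth u + depth v - depth (u + v)) := by
  simp only [nWeight_eq, Prod.fst_add, Prod.snd_add]; ring

theorem nWeight_add_le (n : ℕ) (u v : ℤ × ℤ) : nWeight n (u + v) ≤ nWeight n u + nWeight n v := by
  rw [nWeight_add, sub_le_self_iff]
  exact mul_nonneg (by positivity) (sub_nonneg.2 (depth_add_le u v))

theorem nWeight_add_of_depth {n : ℕ} {u v : ℤ × ℤ} (h : depth (u + v) = depth u + depth v) :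
    nWeight n (u + v) = nWeight n u + nWeight n v := by
  rw [nWeight_add, h, sub_self, mul_zero, sub_zero]

theorem nWeight_zsmul (n : ℕ) {j : ℤ} (hj : 0 ≤ j) (u : ℤ × ℤ) :
    nWeight n (j • u) = j * nWeight n u := by
  simp only [nWeight_eq, depth_zsmul hj, Prod.smul_fst, Prod.smul_snd, smul_eq_mul]; ring

theorem depth_x (n : ℕ) : depth ((n : ℤ), 0) = 0 := by simp [depth]

theorem depth_y : depth (0, 1) = 0 := by simp [depth]

theorem depth_z : depth (-1, -1) = 1 := by simp [depth]

theorem nWeight_x (n : ℕ) : nWeight n ((n : ℤ), 0) = n := by simp [nWeight]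

theorem nWeight_y (n : ℕ) : nWeight n (0, 1) = n := by simp [nWeight]

theorem nWeight_z (n : ℕ) : nWeight n (-1, -1) = n := by simp [nWeight]; ring

theorem finite_nWeight_le {n : ℕ} (hn : 1 ≤ n) (D : ℤ) : {w | nWeight n w ≤ D}.Finite := by
  refine (Set.finite_Icc ((-D, -D) : ℤ × ℤ) (D, D)).subset fun w hw => ?_
  have hn' : (1 : ℤ) ≤ n := by exact_mod_cast hn
  have h₁ : 0 ≤ w.1 + depth w := by simp only [depth]; omega
  have h₂ : 0 ≤ w.2 + depth w := by simp only [depth]; omega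
  have h₃ : w.2 + depth w ≤ n * (w.2 + depth w) := le_mul_of_one_le_left h₂ hn'
  have h₄ : depth w ≤ n * depth w := le_mul_of_one_le_left (depth_nonneg w) hn'
  have h₅ := depth_nonneg w
  rw [Set.mem_ofPred_eq, nWeight_eq] at hw
  exact ⟨⟨by simp only; linarith, by simp only; linarith⟩,
    ⟨by simp only; linarith, by simp only; linarith⟩⟩

end Weights

section GradedShift

variable {k : Type*} [CommRing k]

/-- Multiplication by `x^s.1 y^s.2` on the graded ring of the weight filtration, in terms of
coefficients: the terms whose weight drops are lost. -/
def gradedShift (s : ℤ × ℤ) : (ℤ × ℤ → k) →ₗ[k] (ℤ × ℤ → k) where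
  toFun ζ w := if depth w = depth (w - s) + depth s then ζ (w - s) else 0
  map_add' ζ η := by
    funext w
    simp only [Pi.add_apply]
    split_ifs <;> simp
  map_smul' r ζ := by
    funext w
    simp [mul_ite]

theorem gradedShift_apply (s : ℤ × ℤ) (ζ : ℤ × ℤ → k) (w : ℤ × ℤ) :
    gradedShift s ζ w = if depth w = depth (w - s) + depth s then ζ (w - s) else 0 := rfl

theorem gradedShift_single (s u : ℤ × ℤ) :
    gradedShift s (Pi.single u 1 : ℤ × ℤ → k) =
      if depth (u + s) = depth u + depth s then Pi.single (u + s) 1 else 0 := by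
  funext w
  rw [gradedShift_apply]
  obtain rfl | hw := eq_or_ne w (u + s)
  · rw [add_sub_cancel_right, Pi.single_eq_same]
    split_ifs <;> simp
  · rw [Pi.single_eq_of_ne (fun h => hw (sub_eq_iff_eq_add.1 h)), ite_self]
    split_ifs <;> simp [hw]

/-- The homogeneous component of weight `d`. -/
def homogeneousPart (n : ℕ) (d : ℤ) (ζ : ℤ × ℤ → k) (w : ℤ × ℤ) : k :=
  if nWeight n w = d then ζ w else 0

theorem gradedShift_homogeneousPart {n : ℕ} (s : ℤ × ℤ) (d : ℤ) (ζ : ℤ × ℤ → k) :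
    gradedShift s (homogeneousPart n d ζ) =
      homogeneousPart n (d + nWeight n s) (gradedShift s ζ) := by
  funext w
  simp only [homogeneousPart, gradedShift_apply]
  by_cases h : depth w = depth (w - s) + depth s
  · have : nWeight n w = nWeight n (w - s) + nWeight n s := by
      rw [← nWeight_add_of_depth (by rwa [sub_add_cancel]), sub_add_cancel]
    simp [h, this]
  · simp [h]

/-- The reduction of the operator `λ + π^n (m x^s - t / (x y)) + ⋯` on series normalized by powers
of a uniformizer `π`: the diagonal operator `λ` keeps the weight, the other two terms raise it
by `nWeight n s = n`. -/
def symbol (lam : ℤ × ℤ → ℤ) (m t : k) (s : ℤ × ℤ) : (ℤ × ℤ → k) →ₗ[k] (ℤ × ℤ → k) :=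
  LinearMap.mulLeft k (fun w => (lam w : k)) + m • gradedShift s - t • gradedShift (-1, -1)

theorem symbol_apply (lam : ℤ × ℤ → ℤ) (m t : k) (s : ℤ × ℤ) (ζ : ℤ × ℤ → k) (w : ℤ × ℤ) :
    symbol lam m t s ζ w =
      lam w * ζ w + m * gradedShift s ζ w - t * gradedShift (-1, -1) ζ w := rfl

variable (n : ℕ) (t : k)

/-- The symbol of `D_x`. -/
def symbolX : (ℤ × ℤ → k) →ₗ[k] (ℤ × ℤ → k) := symbol Prod.fst (n : k) t ((n : ℤ), 0)

/-- The symbol of `D_y`. -/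
def symbolY : (ℤ × ℤ → k) →ₗ[k] (ℤ × ℤ → k) := symbol Prod.snd 1 t (0, 1)

end GradedShift

section Syzygies

variable {k : Type*} [CommRing k] {n : ℕ} {t : k} {e ζ η : ℤ × ℤ → k}

/-- A relation `e + (n x^n - t z) ζ + (y - t z) η = 0` in the graded ring `k[x, y, z] / (x y z)`,
where `e` is a combination of the `ε_i` and `ζ` one of the normal monomials. -/
structure IsSyzygy (n : ℕ) (t : k) (e ζ η : ℤ × ℤ → k) : Prop where
  one_le : 1 ≤ n
  eps_eq_zero : ∀ w, ¬ IsEps n w → e w = 0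
  normal_eq_zero : ∀ w, ¬ IsNormal w → ζ w = 0
  relation : e + ((n : k) • gradedShift ((n : ℤ), 0) ζ - t • gradedShift (-1, -1) ζ)
    + (gradedShift (0, 1) η - t • gradedShift (-1, -1) η) = 0

namespace IsSyzygy

theorem coeff (h : IsSyzygy n t e ζ η) (u v : ℤ) :
    e (u, v) + (if (n : ℤ) ≤ u ∨ n - u ≤ -v then n * ζ (u - n, v) else 0)
      - (if u < 0 ∨ v < 0 then t * (ζ (u + 1, v + 1) + η (u + 1, v + 1)) else 0)
      + (if 1 ≤ v ∨ 1 - v ≤ -u then η (u, v - 1) else 0) = 0 := by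
  have hn := h.one_le
  have hx : depth (u, v) = depth (u - n, v) ↔ ((n : ℤ) ≤ u ∨ n - u ≤ -v) := by
    simp only [depth]; omega
  have hy : depth (u, v) = depth (u, v - 1) ↔ (1 ≤ v ∨ 1 - v ≤ -u) := by
    simp only [depth]; omega
  have hz : depth (u, v) = depth (u + 1, v + 1) + 1 ↔ (u < 0 ∨ v < 0) := by
    simp only [depth]; omega
  have := congrFun h.relation (u, v)
  simp only [Pi.add_apply, Pi.sub_apply, Pi.smul_apply, smul_eq_mul, gradedShift_apply, depth_x,
    depth_y, depth_z, Prod.mk_sub_mk, sub_zero, add_zero, sub_neg_eq_add, hx, hy, hz,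
    Pi.zero_apply] at this
  split_ifs at this ⊢ <;> linear_combination this

theorem eta_xy (h : IsSyzygy n t e ζ η) {u v : ℤ} (hu : 1 ≤ u) (hv : 1 ≤ v) : η (u, v) = 0 := by
  have := h.coeff u (v + 1)
  rw [h.eps_eq_zero _ (by simp only [IsEps]; omega),
    h.normal_eq_zero (u - n, v + 1) (by simp only [IsNormal]; omega)] at this
  simpa [show ¬ (u < 0 ∨ v + 1 < 0) by omega, show 0 ≤ v by omega] using this

theorem eta_yz (h : IsSyzygy n t e ζ η) {u v : ℤ} (hu : u ≤ 0) (huv : u ≤ v) : η (u, v) = 0 := by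
  induction u, hu using Int.leInductionDown generalizing v with
  | base =>
    have := h.coeff 0 (v + 1)
    rw [h.eps_eq_zero _ (by simp only [IsEps]; omega),
      h.normal_eq_zero (0 - n, v + 1) (by simp only [IsNormal]; omega)] at this
    simpa [show ¬ v + 1 < 0 by omega, show 0 ≤ v by omega] using this
  | pred u hu ih =>
    have := h.coeff (u - 1) (v + 1)
    rw [h.eps_eq_zero _ (by simp only [IsEps]; omega),
      h.normal_eq_zero (u - 1 + 1, v + 1 + 1) (by simp only [IsNormal]; omega),
      sub_add_cancel, ih (by omega), if_neg (by omega : ¬ ((n : ℤ) ≤ _ ∨ _)),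
      if_pos (by omega : 1 ≤ v + 1 ∨ _)] at this
    simpa using this

theorem zeta_z (h : IsSyzygy n t e ζ η) (ht : IsUnit t) {u : ℤ} (hu : u ≤ 0) :
    ζ (u, u) = 0 := by
  have hn := h.one_le
  have := h.coeff (u - 1) (u - 1)
  rw [h.eps_eq_zero _ (by simp only [IsEps]; omega), sub_add_cancel, h.eta_yz hu le_rfl,
    if_neg (by omega : ¬ ((n : ℤ) ≤ _ ∨ _)), if_pos (by omega : _ < (0 : ℤ) ∨ _),
    if_neg (by omega : ¬ ((1 : ℤ) ≤ _ ∨ _))] at this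
  simpa [ht.mul_right_eq_zero] using this

theorem zeta_x (h : IsSyzygy n t e ζ η) (hnu : IsUnit (n : k)) {u : ℤ} (hu : 1 ≤ u) :
    ζ (u, 0) = 0 := by
  have := h.coeff (u + n) 0
  rw [h.eps_eq_zero _ (by simp only [IsEps]; omega), add_sub_cancel_right,
    if_pos (by omega : (n : ℤ) ≤ _ ∨ _), if_neg (by omega : ¬ (_ < (0 : ℤ) ∨ _)),
    if_neg (by omega : ¬ ((1 : ℤ) ≤ _ ∨ _))] at this
  simpa [hnu.mul_right_eq_zero] using this

theorem eta_x_of_lt (h : IsSyzygy n t e ζ η) {u : ℤ} (hu : n < u) : η (u, 0) = 0 := by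
  have := h.coeff u 1
  rw [h.eps_eq_zero _ (by simp only [IsEps]; omega),
    h.normal_eq_zero (u - n, 1) (by simp [IsNormal])] at this
  rw [if_neg (by omega : ¬ (_ < (0 : ℤ) ∨ _)), sub_self] at this
  simpa using this

theorem zeta_xz (h : IsSyzygy n t e ζ η) (hnu : IsUnit (n : k)) {u : ℤ} (hu : 0 ≤ u) :
    ζ (u, -1) = 0 := by
  have hn := h.one_le
  have := h.coeff (u + n) (-1)
  rw [h.eps_eq_zero _ (by simp [IsEps]), add_sub_cancel_right, neg_add_cancel,
    h.zeta_x hnu (by omega), h.eta_x_of_lt (by omega), if_pos (by omega : (n : ℤ) ≤ _ ∨ _),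
    if_neg (by omega : ¬ ((1 : ℤ) ≤ _ ∨ _))] at this
  simpa [hnu.mul_right_eq_zero] using this

theorem zeta_eq_zero (h : IsSyzygy n t e ζ η) (hnu : IsUnit (n : k))
    (ht : IsUnit t) : ζ = 0 := by
  funext ⟨u, v⟩
  by_cases hN : IsNormal (u, v)
  · simp only [IsNormal] at hN
    obtain rfl | hne := eq_or_ne u v
    · exact h.zeta_z ht hN.1
    obtain rfl | rfl : v = 0 ∨ v = -1 := by omega
    · exact h.zeta_x hnu (by omega)
    · exact h.zeta_xz hnu (by omega)
  · exact h.normal_eq_zero _ hN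

theorem eta_xz (h : IsSyzygy n t e ζ η) (hnu : IsUnit (n : k)) (ht : IsUnit t)
    {u v : ℤ} (hv : v ≤ 0) (hvu : v < u) : η (u, v) = 0 := by
  have := h.coeff (u - 1) (v - 1)
  rw [h.eps_eq_zero _ (by simp only [IsEps]; omega), h.zeta_eq_zero hnu ht, sub_add_cancel,
    sub_add_cancel, if_pos (by omega : _ < (0 : ℤ) ∨ _), if_neg (by omega : ¬ ((1 : ℤ) ≤ _ ∨ _))]
    at this
  simpa [ht.mul_right_eq_zero] using this

theorem eta_eq_zero (h : IsSyzygy n t e ζ η) (hnu : IsUnit (n : k))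
    (ht : IsUnit t) : η = 0 := by
  funext ⟨u, v⟩
  by_cases hu : u ≤ 0 ∧ u ≤ v
  · exact h.eta_yz hu.1 hu.2
  by_cases hv : v ≤ 0
  · exact h.eta_xz hnu ht hv (by omega)
  · exact h.eta_xy (by omega) (by omega)

end IsSyzygy

theorem isSyzygy_homogeneousPart (he : ∀ w, ¬ IsEps n w → e w = 0)
    (hζ : ∀ w, ¬ IsNormal w → ζ w = 0) (h : e + symbolX n t ζ + symbolY t η = 0) {d : ℤ}
    (hd : ∀ w, d < nWeight n w → ζ w = 0 ∧ η w = 0) (hn : 1 ≤ n) :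
    IsSyzygy n t (homogeneousPart n (d + n) e) (homogeneousPart n d ζ)
      (homogeneousPart n d η) where
  one_le := hn
  eps_eq_zero w hw := by rw [homogeneousPart, he w hw, ite_self]
  normal_eq_zero w hw := by rw [homogeneousPart, hζ w hw, ite_self]
  relation := by
    funext w
    simp only [gradedShift_homogeneousPart, nWeight_x, nWeight_y, nWeight_z, Pi.add_apply,
      Pi.sub_apply, Pi.smul_apply, smul_eq_mul, homogeneousPart, Pi.zero_apply]
    split_ifs with hw
    · obtain ⟨hζw, hηw⟩ := hd w (by omega)
      have := congrFun h w
      simp only [symbolX, symbolY, Pi.add_apply, symbol_apply, hζw, hηw, mul_zero, zero_add,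
        one_mul, Pi.zero_apply] at this
      exact this
    · simp

/- The components of largest weight form an `IsSyzygy`. -/
theorem symbol_injective (hn : 1 ≤ n) (hnu : IsUnit (n : k)) (ht : IsUnit t)
    (he : ∀ w, ¬ IsEps n w → e w = 0) (hζ : ∀ w, ¬ IsNormal w → ζ w = 0)
    (hfin : (ζ.support ∪ η.support).Finite) (h : e + symbolX n t ζ + symbolY t η = 0) :
    e = 0 ∧ ζ = 0 ∧ η = 0 := by
  suffices hempty : ζ.support ∪ η.support = ∅ by
    rw [Set.union_empty_iff, Function.support_eq_empty_iff, Function.support_eq_empty_iff] at hempty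
    obtain ⟨rfl, rfl⟩ := hempty
    simpa using h
  by_contra! hne
  obtain ⟨w, hw, hmax⟩ := Set.exists_max_image _ (nWeight n) hfin hne
  have hsyz := isSyzygy_homogeneousPart he hζ h (d := nWeight n w) (fun v hv => by
    by_contra! hcon
    refine hv.not_ge (hmax v ?_)
    rw [Set.mem_union, Function.mem_support, Function.mem_support]
    tauto) hn
  have hζw := congrFun (hsyz.zeta_eq_zero hnu ht) w
  have hηw := congrFun (hsyz.eta_eq_zero hnu ht) w
  rw [homogeneousPart, if_pos rfl] at hζw hηw
  exact hw.elim (fun h => h hζw) fun h => h hηw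

end Syzygies

section Reduction

variable {k : Type*} [CommRing k] {n : ℕ} {t : k} {d : ℤ} {S : Submodule k (ℤ × ℤ → k)}

theorem nWeight_add_x (n : ℕ) {u v : ℤ} (h : 0 ≤ u ∨ v ≤ u) :
    nWeight n (u + n, v) = nWeight n (u, v) + n := by
  rw [nWeight_eq, nWeight_eq, show depth (u + n, v) = depth (u, v) by simp only [depth]; omega]
  ring

theorem nWeight_add_y (n : ℕ) {u v : ℤ} (h : 0 ≤ v ∨ u ≤ v) :
    nWeight n (u, v + 1) = nWeight n (u, v) + n := by
  rw [nWeight_eq, nWeight_eq, show depth (u, v + 1) = depth (u, v) by simp only [depth]; omega]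
  ring

theorem nWeight_add_z (n : ℕ) {u v : ℤ} (h : u ≤ 0 ∨ v ≤ 0) :
    nWeight n (u - 1, v - 1) = nWeight n (u, v) + n := by
  rw [nWeight_eq, nWeight_eq,
    show depth (u - 1, v - 1) = depth (u, v) + 1 by simp only [depth]; omega]
  ring

/-- `S` contains the image of `symbolY` and the monomials of weight less than `d`. -/
structure IsReducing (n : ℕ) (t : k) (d : ℤ) (S : Submodule k (ℤ × ℤ → k)) : Prop where
  one_le : 1 ≤ n
  symbolY_mem : ∀ w, symbolY t (Pi.single w 1) ∈ S
  single_mem : ∀ w, nWeight n w < d → Pi.single w 1 ∈ S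

namespace IsReducing

theorem sub_mem_y (h : IsReducing n t d S) {u v : ℤ} (hd : nWeight n (u, v) < d) :
    (if 0 ≤ v ∨ u ≤ v then (Pi.single (u, v + 1) 1 : ℤ × ℤ → k) else 0)
      - t • (if u ≤ 0 ∨ v ≤ 0 then Pi.single (u - 1, v - 1) 1 else 0) ∈ S := by
  have hy : depth (u, v + 1) = depth (u, v) ↔ (0 ≤ v ∨ u ≤ v) := by simp only [depth]; omega
  have hz : depth (u - 1, v - 1) = depth (u, v) + 1 ↔ (u ≤ 0 ∨ v ≤ 0) := by
    simp only [depth]; omega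
  have hS := S.sub_mem (h.symbolY_mem (u, v)) (S.smul_mem (v : k) (h.single_mem _ hd))
  convert hS using 1
  rw [← if_congr hy rfl rfl, ← if_congr hz rfl rfl, symbolY, symbol]
  simp only [LinearMap.sub_apply, LinearMap.add_apply, LinearMap.smul_apply, gradedShift_single,
    depth_y, depth_z, Prod.mk_add_mk, add_zero, one_smul, LinearMap.mulLeft_apply,
    ← sub_eq_add_neg]
  rw [show (fun w : ℤ × ℤ => (w.2 : k)) * Pi.single (u, v) 1 = (v : k) • Pi.single (u, v) 1 by
    funext w; by_cases hw : w = (u, v) <;> simp [hw]]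
  abel

theorem sub_mem_x (h : IsReducing n t d S)
    (hX : ∀ w, IsNormal w → symbolX n t (Pi.single w 1) ∈ S) {u v : ℤ} (hN : IsNormal (u, v))
    (hd : nWeight n (u, v) < d) :
    (n : k) • (Pi.single (u + n, v) 1 : ℤ × ℤ → k) - t • Pi.single (u - 1, v - 1) 1 ∈ S := by
  obtain ⟨hv, hvu, -⟩ := id hN
  have hx : depth (u + n, v) = depth (u, v) := by simp only [depth] at *; omega
  have hz : depth (u - 1, v - 1) = depth (u, v) + 1 := by simp only [depth] at *; omega
  have hS := S.sub_mem (hX _ hN) (S.smul_mem (u : k) (h.single_mem _ hd))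
  convert hS using 1
  rw [symbolX, symbol]
  simp only [LinearMap.sub_apply, LinearMap.add_apply, LinearMap.smul_apply, gradedShift_single,
    depth_x, depth_z, Prod.mk_add_mk, add_zero, LinearMap.mulLeft_apply,
    ← sub_eq_add_neg, hx, hz, if_true]
  rw [show (fun w : ℤ × ℤ => (w.1 : k)) * Pi.single (u, v) 1 = (u : k) • Pi.single (u, v) 1 by
    funext w; by_cases hw : w = (u, v) <;> simp [hw]]
  abel

variable {u v : ℤ}

theorem single_xy (h : IsReducing n t d S) (hu : 1 ≤ u) (hv : 2 ≤ v)
    (hd : nWeight n (u, v) = d) : Pi.single (u, v) 1 ∈ S := by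
  have hn := h.one_le
  have hw := nWeight_add_y n (u := u) (v := v - 1) (by omega)
  rw [sub_add_cancel] at hw
  have := h.sub_mem_y (u := u) (v := v - 1) (by omega)
  rwa [if_pos (by omega), if_neg (by omega), smul_zero, sub_zero, sub_add_cancel] at this

theorem single_xz (h : IsReducing n t d S) (ht : IsUnit t) (hv : v ≤ -2) (hvu : v < u)
    (hd : nWeight n (u, v) = d) : Pi.single (u, v) 1 ∈ S := by
  have hn := h.one_le
  have hw := nWeight_add_z n (u := u + 1) (v := v + 1) (by omega)
  rw [add_sub_cancel_right, add_sub_cancel_right] at hw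
  have := h.sub_mem_y (u := u + 1) (v := v + 1) (by omega)
  rwa [if_neg (by omega), if_pos (by omega), zero_sub, neg_mem_iff,
    S.smul_mem_iff_of_isUnit ht, add_sub_cancel_right, add_sub_cancel_right] at this

theorem single_x_iff (h : IsReducing n t d S) (ht : IsUnit t)
    (hd : nWeight n (u, 0) + n = d) :
    Pi.single (u, 1) 1 ∈ S ↔ Pi.single (u - 1, -1) 1 ∈ S := by
  have hn := h.one_le
  have := h.sub_mem_y (u := u) (v := 0) (by omega)
  rw [if_pos (by omega), if_pos (by omega), zero_add, zero_sub] at this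
  rw [← S.smul_mem_iff_of_isUnit ht (x := Pi.single (u - 1, -1) 1)]
  exact ⟨fun h₁ => (S.sub_mem_iff_right h₁).1 this, fun h₂ => (S.sub_mem_iff_left h₂).1 this⟩

/-- `t z - y` exchanges `x^u y^v` and `x^(u-1) y^(v-2)`, which is closer to the diagonal. -/
theorem single_yz_of_diagonal (h : IsReducing n t d S)
    (hdiag : ∀ c : ℤ, c ≤ 0 → nWeight n (c - 1, c - 1) = d → Pi.single (c - 1, c - 1) 1 ∈ S)
    (hu : u ≤ 0) (huv : u < v) (hd : nWeight n (u, v) = d) : Pi.single (u, v) 1 ∈ S := by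
  have hn := h.one_le
  obtain ⟨j, rfl⟩ : ∃ j : ℕ, v = u + j + 1 := ⟨(v - u - 1).toNat, by omega⟩
  induction j generalizing u with
  | zero =>
    rw [Nat.cast_zero, add_zero] at hd ⊢
    have hy := nWeight_add_y n (u := u) (v := u) (by omega)
    have hz := nWeight_add_z n (u := u) (v := u) (by omega)
    have hmem := h.sub_mem_y (u := u) (v := u) (by omega)
    rw [if_pos (by omega), if_pos (by omega)] at hmem
    exact (S.sub_mem_iff_left (S.smul_mem t (hdiag u hu (by omega)))).1 hmem
  | succ j ih =>
    have hy := nWeight_add_y n (u := u) (v := u + (j + 1 : ℕ)) (by omega)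
    have hz := nWeight_add_z n (u := u) (v := u + (j + 1 : ℕ)) (by omega)
    have hmem := h.sub_mem_y (u := u) (v := u + (j + 1 : ℕ)) (by omega)
    rw [if_pos (by omega), if_pos (by omega)] at hmem
    have hv : u + (j + 1 : ℕ) - 1 = u - 1 + j + 1 := by omega
    rw [hv] at hz hmem
    exact (S.sub_mem_iff_left (S.smul_mem t (ih (by omega) (by omega) (by omega)))).1 hmem

theorem single_mem_of_normal (h : IsReducing n t d S) (ht : IsUnit t)
    (hN : ∀ w, IsNormal w → nWeight n w = d → Pi.single w 1 ∈ S) {w : ℤ × ℤ}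
    (hd : nWeight n w = d) : Pi.single w 1 ∈ S := by
  obtain ⟨u, v⟩ := w
  have hdiag (c : ℤ) (hc : c ≤ 0) :=
    hN (c - 1, c - 1) ⟨by dsimp only; omega, le_rfl, Or.inr rfl⟩
  by_cases hnorm : IsNormal (u, v)
  · exact hN _ hnorm hd
  simp only [IsNormal] at hnorm
  by_cases huv : u ≤ 0 ∧ u < v
  · exact h.single_yz_of_diagonal hdiag huv.1 huv.2 hd
  by_cases hv : v ≤ -2
  · exact h.single_xz ht hv (by omega) hd
  by_cases hv : 2 ≤ v
  · exact h.single_xy (by omega) hv hd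
  obtain rfl : v = 1 := by omega
  have hy := nWeight_add_y n (u := u) (v := 0) (by omega)
  have hz := nWeight_add_z n (u := u) (v := 0) (by omega)
  rw [zero_add] at hy
  rw [zero_sub] at hz
  exact (h.single_x_iff ht (by omega)).2
    (hN _ (by simp only [IsNormal]; omega) (by omega))

theorem single_xz_mem (h : IsReducing n t d S) (hnu : IsUnit (n : k)) (ht : IsUnit t)
    (hE : ∀ w, IsEps n w → Pi.single w 1 ∈ S)
    (hX : ∀ w, IsNormal w → symbolX n t (Pi.single w 1) ∈ S) (hu : 0 ≤ u)
    (hd : nWeight n (u, -1) = d) : Pi.single (u, -1) 1 ∈ S := by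
  have hn := h.one_le
  obtain hun | hun := lt_or_ge u n
  · have hz := nWeight_add_z n (u := u + 1) (v := 0) (by omega)
    rw [add_sub_cancel_right, zero_sub] at hz
    have := h.single_x_iff ht (u := u + 1) (by omega)
    rw [add_sub_cancel_right] at this
    exact this.1 (hE _ (Or.inr ⟨rfl, by dsimp only; omega, by dsimp only; omega⟩))
  · have hx := nWeight_add_x n (u := u - n) (v := -1) (by omega)
    have hz := nWeight_add_z n (u := u - n) (v := -1) (by omega)
    have hmem := h.sub_mem_x hX (u := u - n) (v := -1) (by simp only [IsNormal]; omega)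
    rw [sub_add_cancel] at hx hmem
    rw [S.sub_mem_iff_left (S.smul_mem t (h.single_xz ht (by omega) (by omega) (by omega))),
      S.smul_mem_iff_of_isUnit hnu] at hmem
    exact hmem (by omega)

theorem single_x_mem (h : IsReducing n t d S) (hnu : IsUnit (n : k)) (ht : IsUnit t)
    (hE : ∀ w, IsEps n w → Pi.single w 1 ∈ S)
    (hX : ∀ w, IsNormal w → symbolX n t (Pi.single w 1) ∈ S) (hu : 0 ≤ u)
    (hd : nWeight n (u, 0) = d) : Pi.single (u, 0) 1 ∈ S := by
  have hn := h.one_le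
  obtain hun | hun := le_or_gt u n
  · exact hE _ (Or.inl ⟨rfl, hu, hun⟩)
  have hx := nWeight_add_x n (u := u - n) (v := 0) (by omega)
  have hz := nWeight_add_z n (u := u - n) (v := 0) (by omega)
  rw [sub_add_cancel] at hx
  have hmem := h.sub_mem_x hX (u := u - n) (v := 0) (by simp only [IsNormal]; omega) (by omega)
  rw [zero_sub] at hz hmem
  rwa [sub_add_cancel, S.sub_mem_iff_left (S.smul_mem t
    (h.single_xz_mem hnu ht hE hX (by omega) (by omega))), S.smul_mem_iff_of_isUnit hnu] at hmem

theorem single_z_mem (h : IsReducing n t d S) (hnu : IsUnit (n : k)) (ht : IsUnit t)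
    (hE : ∀ w, IsEps n w → Pi.single w 1 ∈ S)
    (hX : ∀ w, IsNormal w → symbolX n t (Pi.single w 1) ∈ S) (hu : u ≤ 0)
    (hd : nWeight n (u, u) = d) : Pi.single (u, u) 1 ∈ S := by
  have hn := h.one_le
  obtain rfl | hu := hu.eq_or_lt
  · exact h.single_x_mem hnu ht hE hX le_rfl hd
  have hx := nWeight_add_x n (u := u + 1) (v := u + 1) (by omega)
  have hz := nWeight_add_z n (u := u + 1) (v := u + 1) (by omega)
  have hmem := h.sub_mem_x hX (u := u + 1) (v := u + 1) ⟨by dsimp only; omega, le_rfl, Or.inr rfl⟩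
  rw [add_sub_cancel_right] at hz hmem
  have hxmem : Pi.single (u + 1 + n, u + 1) 1 ∈ S := by
    obtain rfl | rfl | hu' : u = -1 ∨ u = -2 ∨ u + 1 ≤ -2 := by omega
    · exact h.single_x_mem hnu ht hE hX (by omega) (by simpa using hx.trans (by omega))
    · exact h.single_xz_mem hnu ht hE hX (by omega) (by simpa using hx.trans (by omega))
    · exact h.single_xz ht hu' (by omega) (by omega)
  rw [S.sub_mem_iff_right (S.smul_mem _ hxmem), S.smul_mem_iff_of_isUnit ht] at hmem
  exact hmem (by omega)

theorem single_normal_mem (h : IsReducing n t d S) (hnu : IsUnit (n : k)) (ht : IsUnit t)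
    (hE : ∀ w, IsEps n w → Pi.single w 1 ∈ S)
    (hX : ∀ w, IsNormal w → symbolX n t (Pi.single w 1) ∈ S) {w : ℤ × ℤ} (hN : IsNormal w)
    (hd : nWeight n w = d) : Pi.single w 1 ∈ S := by
  obtain ⟨u, v⟩ := w
  simp only [IsNormal] at hN
  obtain rfl | hne := eq_or_ne u v
  · exact h.single_z_mem hnu ht hE hX hN.1 hd
  obtain rfl | rfl : v = 0 ∨ v = -1 := by omega
  · exact h.single_x_mem hnu ht hE hX hN.2.1 hd
  · exact h.single_xz_mem hnu ht hE hX (by omega) hd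

end IsReducing

variable (k) in
/-- The finitely supported functions that vanish outside of `{w | P w}`. -/
def finSupported (P : ℤ × ℤ → Prop) : Submodule k (ℤ × ℤ → k) where
  carrier := {c | c.support.Finite ∧ ∀ w, ¬ P w → c w = 0}
  add_mem' {a b} ha hb := ⟨(ha.1.union hb.1).subset (Function.support_add a b),
    fun w hw => by rw [Pi.add_apply, ha.2 w hw, hb.2 w hw, add_zero]⟩
  zero_mem' := ⟨by simp, fun _ _ => rfl⟩
  smul_mem' c x hx := ⟨hx.1.subset (Function.support_const_smul_subset c x),
    fun w hw => by rw [Pi.smul_apply, hx.2 w hw, smul_zero]⟩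

theorem single_mem_finSupported {P : ℤ × ℤ → Prop} {w : ℤ × ℤ} (h : P w) :
    (Pi.single w 1 : ℤ × ℤ → k) ∈ finSupported k P := by
  refine ⟨(Set.finite_singleton w).subset Pi.support_single_subset, fun v hv => ?_⟩
  exact Pi.single_eq_of_ne (by rintro rfl; exact hv h) _

theorem mem_of_single_mem (hS : ∀ w, Pi.single w 1 ∈ S) {β : ℤ × ℤ → k}
    (hβ : β.support.Finite) : β ∈ S := by
  have hsum : β = ∑ w ∈ hβ.toFinset, β w • Pi.single w 1 := by
    funext v
    rw [Finset.sum_apply, Finset.sum_eq_single v]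
    · simp
    · intro w _ hwv
      rw [Pi.smul_apply, Pi.single_eq_of_ne hwv.symm, smul_zero]
    · intro hv
      rw [Set.Finite.mem_toFinset, Function.notMem_support] at hv
      rw [hv, zero_smul, Pi.zero_apply]
  rw [hsum]
  exact S.sum_mem fun w _ => S.smul_mem _ (hS w)

/-- The sum of the span of the monomials in `{w | P w}` and of the images of the two symbols, the
first one restricted to the span of the monomials in `{w | Q w}`. -/
def symbolRange (n : ℕ) (t : k) (P Q : ℤ × ℤ → Prop) : Submodule k (ℤ × ℤ → k) :=
  finSupported k P ⊔ (finSupported k Q).map (symbolX n t) ⊔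
    (finSupported k fun _ => True).map (symbolY t)

theorem single_mem_symbolRange {P Q : ℤ × ℤ → Prop} {w : ℤ × ℤ} (h : P w) :
    Pi.single w 1 ∈ symbolRange n t P Q :=
  Submodule.mem_sup_left (Submodule.mem_sup_left (single_mem_finSupported h))

theorem symbolX_single_mem_symbolRange {P Q : ℤ × ℤ → Prop} {w : ℤ × ℤ} (h : Q w) :
    symbolX n t (Pi.single w 1) ∈ symbolRange n t P Q :=
  Submodule.mem_sup_left
    (Submodule.mem_sup_right (Submodule.mem_map_of_mem (single_mem_finSupported h)))

theorem isReducing_symbolRange (hn : 1 ≤ n) {P Q : ℤ × ℤ → Prop}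
    (hlow : ∀ w, nWeight n w < d → Pi.single w 1 ∈ symbolRange n t P Q) :
    IsReducing n t d (symbolRange n t P Q) where
  one_le := hn
  symbolY_mem _ :=
    Submodule.mem_sup_right (Submodule.mem_map_of_mem (single_mem_finSupported trivial))
  single_mem := hlow

theorem forall_of_nWeight_lt (n : ℕ) {P : ℤ × ℤ → Prop}
    (h : ∀ w, (∀ v, nWeight n v < nWeight n w → P v) → P w) (w : ℤ × ℤ) : P w := by
  induction hd : (nWeight n w).toNat using Nat.strong_induction_on generalizing w with
  | _ d ih =>
  refine h w fun v hv => ih _ ?_ v rfl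
  have := nWeight_nonneg n v
  omega

theorem mem_symbolRange_normal (hn : 1 ≤ n) (ht : IsUnit t) {β : ℤ × ℤ → k}
    (hβ : β.support.Finite) : β ∈ symbolRange n t IsNormal (fun _ => False) :=
  mem_of_single_mem (forall_of_nWeight_lt n fun _ hlow =>
    (isReducing_symbolRange hn hlow).single_mem_of_normal ht
      (fun _ hN _ => single_mem_symbolRange hN) rfl) hβ

theorem mem_symbolRange_eps (hn : 1 ≤ n) (hnu : IsUnit (n : k)) (ht : IsUnit t) {β : ℤ × ℤ → k}
    (hβ : β.support.Finite) : β ∈ symbolRange n t (IsEps n) IsNormal := by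
  refine mem_of_single_mem (forall_of_nWeight_lt n fun w hlow => ?_) hβ
  have hred := isReducing_symbolRange hn hlow
  exact hred.single_mem_of_normal ht (fun v => hred.single_normal_mem hnu ht
    (fun _ => single_mem_symbolRange) fun _ => symbolX_single_mem_symbolRange) rfl

end Reduction

section BanachModule

variable {K : Type*} [NormedField K] {n : ℕ} {π : K} {c c' : ℤ × ℤ → K}

/-- The coefficients of a series relative to the basis `γ̃ ^ (n ω(w)) x ^ w`. -/
def normalized (n : ℕ) (π : K) (c : ℤ × ℤ → K) (w : ℤ × ℤ) : K := c w / π ^ nWeight n w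

theorem norm_normalized_le (h₀ : π ≠ 0) (c : ℤ × ℤ → K) (w : ℤ × ℤ) (ε : ℝ) :
    ‖normalized n π c w‖ ≤ ε ↔ ‖c w‖ ≤ ε * ‖π‖ ^ nWeight n w := by
  rw [normalized, norm_div, norm_zpow, div_le_iff₀ (zpow_pos (norm_pos_iff.2 h₀) _)]

theorem mem_C0_iff (h₀ : π ≠ 0) : c ∈ C0 n π ↔
    (∀ w, ‖c w‖ ≤ ‖π‖ ^ nWeight n w) ∧ Tendsto (normalized n π c) cofinite (𝓝 0) := by
  constructor
  · rintro ⟨ξ, h₁, h₂, h₃⟩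
    have hξ : normalized n π c = ξ := by
      funext w
      rw [normalized, h₃, mul_div_cancel_right₀ _ (zpow_ne_zero _ h₀)]
    refine ⟨fun w => ?_, by rwa [hξ]⟩
    rw [h₃, norm_mul, norm_zpow]
    exact mul_le_of_le_one_left (by positivity) (h₁ w)
  · rintro ⟨h₁, h₂⟩
    exact ⟨normalized n π c, fun w => (norm_normalized_le h₀ c w 1).2 (by simpa using h₁ w), h₂,
      fun w => (div_mul_cancel₀ _ (zpow_ne_zero _ h₀)).symm⟩

theorem norm_le_of_mem_C0 (h₀ : π ≠ 0) (hc : c ∈ C0 n π) (w : ℤ × ℤ) :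
    ‖c w‖ ≤ ‖π‖ ^ nWeight n w := ((mem_C0_iff h₀).1 hc).1 w

theorem norm_normalized_le_one (h₀ : π ≠ 0) (hc : c ∈ C0 n π) (w : ℤ × ℤ) :
    ‖normalized n π c w‖ ≤ 1 :=
  (norm_normalized_le h₀ c w 1).2 (by simpa using norm_le_of_mem_C0 h₀ hc w)

theorem eventually_norm_le (h₀ : π ≠ 0) (hc : c ∈ C0 n π) {ε : ℝ} (hε : 0 < ε) :
    ∀ᶠ w in cofinite, ‖c w‖ ≤ ε * ‖π‖ ^ nWeight n w := by
  have hlim := tendsto_zero_iff_norm_tendsto_zero.1 ((mem_C0_iff h₀).1 hc).2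
  filter_upwards [hlim.eventually_lt_const hε] with w hw
  exact (norm_normalized_le h₀ c w ε).1 hw.le

theorem mem_C0_of_eventually (h₀ : π ≠ 0) (h₁ : ∀ w, ‖c w‖ ≤ ‖π‖ ^ nWeight n w)
    (h₂ : ∀ ε : ℝ, 0 < ε → ∀ᶠ w in cofinite, ‖c w‖ ≤ ε * ‖π‖ ^ nWeight n w) : c ∈ C0 n π := by
  refine (mem_C0_iff h₀).2 ⟨h₁, Metric.tendsto_nhds.2 fun ε hε => ?_⟩
  filter_upwards [h₂ (ε / 2) (by positivity)] with w hw
  rw [dist_zero_right]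
  exact ((norm_normalized_le h₀ c w _).2 hw).trans_lt (by linarith)

theorem mem_C0_of_finite (h₀ : π ≠ 0) (h₁ : ∀ w, ‖c w‖ ≤ ‖π‖ ^ nWeight n w)
    (h₂ : c.support.Finite) : c ∈ C0 n π := by
  refine mem_C0_of_eventually h₀ h₁ fun ε hε => ?_
  filter_upwards [h₂.compl_mem_cofinite] with w hw
  rw [Function.notMem_support.1 hw, norm_zero]
  positivity

theorem mem_C0_of_norm_le (h₀ : π ≠ 0) (hc : c ∈ C0 n π) (h : ∀ w, ‖c' w‖ ≤ ‖c w‖) :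
    c' ∈ C0 n π :=
  mem_C0_of_eventually h₀ (fun w => (h w).trans (norm_le_of_mem_C0 h₀ hc w)) fun _ hε =>
    (eventually_norm_le h₀ hc hε).mono fun w => (h w).trans

theorem zero_mem_C0 : (0 : ℤ × ℤ → K) ∈ C0 n π :=
  ⟨0, by simp, tendsto_const_nhds, by simp⟩

theorem smul_mem_C0 {a : K} (ha : ‖a‖ ≤ 1) (hc : c ∈ C0 n π) : a • c ∈ C0 n π := by
  obtain ⟨ξ, h₁, h₂, h₃⟩ := hc
  refine ⟨a • ξ, fun w => ?_, by simpa [Pi.smul_def] using h₂.const_smul a,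
    fun w => by simp [h₃, mul_assoc]⟩
  rw [Pi.smul_apply, smul_eq_mul, norm_mul]
  exact mul_le_one₀ ha (norm_nonneg _) (h₁ w)

theorem mem_C0_of_smul_mem (h₀ : π ≠ 0) (hc : c ∈ C0 n π)
    (h : ∀ w, ‖c w‖ ≤ ‖π‖ * ‖π‖ ^ nWeight n w) : ∃ c' ∈ C0 n π, c = π • c' := by
  refine ⟨π⁻¹ • c, ?_, (smul_inv_smul₀ h₀ c).symm⟩
  have hpos : 0 < ‖π‖ := norm_pos_iff.2 h₀
  refine mem_C0_of_eventually h₀ (fun w => ?_) fun ε hε => ?_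
  · rw [Pi.smul_apply, smul_eq_mul, norm_mul, norm_inv, inv_mul_le_iff₀ hpos]
    exact h w
  · filter_upwards [eventually_norm_le h₀ hc (mul_pos hpos hε)] with w hw
    rw [Pi.smul_apply, smul_eq_mul, norm_mul, norm_inv, inv_mul_le_iff₀ hpos, ← mul_assoc]
    exact hw

theorem eq_zero_of_forall_pow_smul (h₀ : π ≠ 0) (h₁ : ‖π‖ < 1)
    (h : ∀ k : ℕ, ∃ c' ∈ C0 n π, c = π ^ k • c') : c = 0 := by
  funext w
  have hle (k : ℕ) : ‖c w‖ ≤ ‖π‖ ^ k * ‖π‖ ^ nWeight n w := by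
    obtain ⟨c', hc', rfl⟩ := h k
    rw [Pi.smul_apply, smul_eq_mul, norm_mul, norm_pow]
    gcongr
    exact norm_le_of_mem_C0 h₀ hc' w
  have hlim := (tendsto_pow_atTop_nhds_zero_of_lt_one (norm_nonneg π) h₁).mul_const
    (‖π‖ ^ nWeight n w)
  rw [zero_mul] at hlim
  exact norm_le_zero_iff.1 (ge_of_tendsto' hlim hle)

theorem norm_mul_le_one {x y : K} (hx : ‖x‖ ≤ 1) (hy : ‖y‖ ≤ 1) : ‖x * y‖ ≤ 1 := by
  rw [norm_mul]; exact mul_le_one₀ hx (norm_nonneg _) hy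

/-- The sum `∑_j π^j f_{k+j}`. -/
noncomputable def adicSum (π : K) (f : ℕ → ℤ × ℤ → K) (k : ℕ) (w : ℤ × ℤ) : K :=
  ∑' j, π ^ j * f (k + j) w

theorem adicSum_eq_zero {f : ℕ → ℤ × ℤ → K} {w : ℤ × ℤ} (h : ∀ k, f k w = 0) (k : ℕ) :
    adicSum π f k w = 0 := by
  simp [adicSum, h]

variable [IsUltrametricDist K] {f : ℕ → ℤ × ℤ → K}

theorem norm_add_le_of_norm_le {x y : K} {C : ℝ} (hx : ‖x‖ ≤ C) (hy : ‖y‖ ≤ C) : ‖x + y‖ ≤ C :=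
  (IsUltrametricDist.norm_add_le_max _ _).trans (max_le hx hy)

theorem norm_sub_le_of_norm_le {x y : K} {C : ℝ} (hx : ‖x‖ ≤ C) (hy : ‖y‖ ≤ C) : ‖x - y‖ ≤ C := by
  rw [sub_eq_add_neg]
  exact norm_add_le_of_norm_le hx (by rwa [norm_neg])

theorem add_mem_C0 (hc : c ∈ C0 n π) (hc' : c' ∈ C0 n π) : c + c' ∈ C0 n π := by
  obtain ⟨ξ, h₁, h₂, h₃⟩ := hc
  obtain ⟨ξ', h₁', h₂', h₃'⟩ := hc'
  exact ⟨ξ + ξ', fun w => norm_add_le_of_norm_le (h₁ w) (h₁' w),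
    by simpa [Pi.add_def] using h₂.add h₂', fun w => by simp [h₃, h₃', add_mul]⟩

theorem sub_mem_C0 (hc : c ∈ C0 n π) (hc' : c' ∈ C0 n π) : c - c' ∈ C0 n π := by
  rw [sub_eq_add_neg, ← neg_one_smul K c']
  exact add_mem_C0 hc (smul_mem_C0 (by simp) hc')

theorem tsum_mem_C0 (h₀ : π ≠ 0) (h₁ : ‖π‖ < 1) (hf : ∀ j, f j ∈ C0 n π)
    (hle : ∀ j w, ‖f j w‖ ≤ ‖π‖ ^ j * ‖π‖ ^ nWeight n w) : (fun w => ∑' j, f j w) ∈ C0 n π := by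
  refine mem_C0_of_eventually h₀ (fun w => ?_) fun ε hε => ?_
  · exact IsUltrametricDist.norm_tsum_le_of_forall_le_of_nonneg (by positivity)
      fun j => norm_le_of_mem_C0 h₀ (hf j) w
  · obtain ⟨J, hJ⟩ := exists_pow_lt_of_lt_one hε h₁
    have hsmall : ∀ᶠ w in cofinite, ∀ j ∈ Finset.range J, ‖f j w‖ ≤ ε * ‖π‖ ^ nWeight n w :=
      (eventually_all_finset _).2 fun j _ => eventually_norm_le h₀ (hf j) hε
    filter_upwards [hsmall] with w hw
    refine IsUltrametricDist.norm_tsum_le_of_forall_le_of_nonneg (by positivity) fun j => ?_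
    rcases lt_or_ge j J with hj | hj
    · exact hw j (Finset.mem_range.2 hj)
    · refine (hle j w).trans ?_
      gcongr
      exact (pow_le_pow_of_le_one (norm_nonneg _) h₁.le hj).trans hJ.le

theorem adicSum_mem_C0 (h₀ : π ≠ 0) (h₁ : ‖π‖ < 1) (hf : ∀ k, f k ∈ C0 n π) (k : ℕ) :
    adicSum π f k ∈ C0 n π := by
  refine tsum_mem_C0 h₀ h₁ (f := fun j w => π ^ j * f (k + j) w) (fun j => ?_) fun j w => ?_
  · exact smul_mem_C0 (by rw [norm_pow]; exact pow_le_one₀ (norm_nonneg _) h₁.le) (hf (k + j))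
  · rw [norm_mul, norm_pow]
    gcongr
    exact norm_le_of_mem_C0 h₀ (hf _) w

theorem adicSum_eq [CompleteSpace K] (h₀ : π ≠ 0) (h₁ : ‖π‖ < 1) (hf : ∀ k, f k ∈ C0 n π)
    (k : ℕ) : adicSum π f k = f k + π • adicSum π f (k + 1) := by
  funext w
  have hsum : Summable fun j => π ^ j * f (k + j) w := by
    refine Summable.of_norm_bounded (g := fun j => ‖π‖ ^ j * ‖π‖ ^ nWeight n w)
      ((summable_geometric_of_lt_one (norm_nonneg _) h₁).mul_right _) fun j => ?_
    rw [norm_mul, norm_pow]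
    gcongr
    exact norm_le_of_mem_C0 h₀ (hf _) w
  simp only [adicSum, Pi.add_apply, Pi.smul_apply, smul_eq_mul]
  rw [hsum.tsum_eq_zero_add, ← tsum_mul_left, pow_zero, one_mul, add_zero]
  congr 1
  exact tsum_congr fun j => by rw [add_right_comm, add_assoc, pow_succ']; ring

end BanachModule

section ShiftSum

variable {K : Type*} [NormedField K] {p n : ℕ} {π : K} {g g' : ℕ → K} {r r' : ℤ × ℤ}
  {c c' : ℤ × ℤ → K}

/-- Multiplication by `∑_i g_i x^{p^i r}`. -/
noncomputable def shiftSum (p : ℕ) (g : ℕ → K) (r : ℤ × ℤ) (c : ℤ × ℤ → K) (w : ℤ × ℤ) : K :=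
  ∑' i, g i * c (w - (p : ℤ) ^ i • r)

/-- Conditions on a monomial and on coefficients under which multiplication by
`∑_i g_i x^{p^i r}` preserves `𝒞₀`. -/
structure IsShift (p n : ℕ) (π : K) (g : ℕ → K) (r : ℤ × ℤ) : Prop where
  ne_zero : π ≠ 0
  norm_lt_one : ‖π‖ < 1
  norm_le : ∀ i, ‖g i‖ ≤ ‖π‖ ^ (n * p ^ i + i)
  nWeight_eq : nWeight n r = n

theorem shiftSum_smul (a : K) : shiftSum p g r (a • c) = a • shiftSum p g r c := by
  funext w
  simp only [shiftSum, Pi.smul_apply, smul_eq_mul, ← tsum_mul_left, mul_left_comm a]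

theorem IsShift.norm_term_le (h : IsShift p n π g r) {w : ℤ × ℤ} {i : ℕ} {ε : ℝ}
    (hc : ‖c (w - (p : ℤ) ^ i • r)‖ ≤ ε * ‖π‖ ^ nWeight n (w - (p : ℤ) ^ i • r)) :
    ‖g i * c (w - (p : ℤ) ^ i • r)‖ ≤ ε * ‖π‖ ^ i * ‖π‖ ^ nWeight n w := by
  have hpos : 0 < ‖π‖ := norm_pos_iff.2 h.ne_zero
  have hε : 0 ≤ ε := nonneg_of_mul_nonneg_left ((norm_nonneg _).trans hc) (zpow_pos hpos _)
  have hw : nWeight n w ≤ (n * p ^ i : ℕ) + nWeight n (w - (p : ℤ) ^ i • r) := by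
    have := nWeight_add_le n ((p : ℤ) ^ i • r) (w - (p : ℤ) ^ i • r)
    rw [add_sub_cancel, nWeight_zsmul n (by positivity), h.nWeight_eq, mul_comm] at this
    exact_mod_cast this
  calc ‖g i * c (w - (p : ℤ) ^ i • r)‖
      ≤ ‖π‖ ^ (n * p ^ i + i) * (ε * ‖π‖ ^ nWeight n (w - (p : ℤ) ^ i • r)) := by
        rw [norm_mul]; gcongr; exact h.norm_le i
    _ = ε * ‖π‖ ^ i * ‖π‖ ^ ((n * p ^ i : ℕ) + nWeight n (w - (p : ℤ) ^ i • r)) := by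
        rw [zpow_add₀ hpos.ne', zpow_natCast]; ring
    _ ≤ ε * ‖π‖ ^ i * ‖π‖ ^ nWeight n w := by
        gcongr ?_ * ?_
        exact zpow_le_zpow_right_of_le_one₀ hpos h.norm_lt_one.le hw

theorem IsShift.norm_term_le_of_mem (h : IsShift p n π g r) (hc : c ∈ C0 n π) (i : ℕ)
    (w : ℤ × ℤ) : ‖g i * c (w - (p : ℤ) ^ i • r)‖ ≤ ‖π‖ ^ i * ‖π‖ ^ nWeight n w := by
  simpa using h.norm_term_le (ε := 1) (by simpa using norm_le_of_mem_C0 h.ne_zero hc _)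

theorem IsShift.term_mem_C0 (h : IsShift p n π g r) (hc : c ∈ C0 n π) (i : ℕ) :
    (fun w => g i * c (w - (p : ℤ) ^ i • r)) ∈ C0 n π := by
  have hi : ‖π‖ ^ i ≤ 1 := pow_le_one₀ (norm_nonneg _) h.norm_lt_one.le
  refine mem_C0_of_eventually h.ne_zero (fun w => ?_) fun ε hε => ?_
  · exact (h.norm_term_le_of_mem hc i w).trans (mul_le_of_le_one_left (by positivity) hi)
  · filter_upwards [(sub_left_injective.tendsto_cofinite).eventually
      (eventually_norm_le h.ne_zero hc hε)] with w hw
    refine (h.norm_term_le hw).trans ?_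
    gcongr
    exact mul_le_of_le_one_right hε.le hi

theorem IsShift.norm_mul_le (h : IsShift p n π g r) {b : K} (hb : ‖b‖ ≤ 1) (hc : c ∈ C0 n π)
    {v : ℤ × ℤ} (hd : depth (v + r) < depth v + depth r) :
    ‖π ^ n * b * c v‖ ≤ ‖π‖ * ‖π‖ ^ nWeight n (v + r) := by
  have hpos : 0 < ‖π‖ := norm_pos_iff.2 h.ne_zero
  have hdrop : 1 ≤ (2 * n + 1) * (depth v + depth r - depth (v + r)) :=
    Order.one_le_iff_pos.2 (mul_pos (by positivity) (by omega))
  have hw := nWeight_add n v r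
  rw [h.nWeight_eq] at hw
  calc ‖π ^ n * b * c v‖ ≤ ‖π‖ ^ n * 1 * ‖π‖ ^ nWeight n v := by
        rw [norm_mul, norm_mul, norm_pow]
        gcongr
        exact norm_le_of_mem_C0 h.ne_zero hc v
    _ = ‖π‖ ^ (n + nWeight n v) := by rw [zpow_add₀ hpos.ne', zpow_natCast, mul_one]
    _ ≤ ‖π‖ ^ (1 + nWeight n (v + r)) :=
        zpow_le_zpow_right_of_le_one₀ hpos h.norm_lt_one.le (by omega)
    _ = ‖π‖ * ‖π‖ ^ nWeight n (v + r) := by rw [zpow_add₀ hpos.ne', zpow_one]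

theorem IsShift.mul (h : IsShift p n π g r) {b : ℕ → K} (hb : ∀ i, ‖b i‖ ≤ 1) :
    IsShift p n π (fun i => g i * b i) r where
  __ := h
  norm_le i := by
    rw [norm_mul]
    exact (mul_le_of_le_one_right (norm_nonneg _) (hb i)).trans (h.norm_le i)

theorem IsShift.summable [CompleteSpace K] (h : IsShift p n π g r) (hc : c ∈ C0 n π)
    (w : ℤ × ℤ) : Summable fun i => g i * c (w - (p : ℤ) ^ i • r) :=
  Summable.of_norm_bounded
    ((summable_geometric_of_lt_one (norm_nonneg _) h.norm_lt_one).mul_right _)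
    fun i => h.norm_term_le_of_mem hc i w

variable [IsUltrametricDist K]

theorem shiftSum_mem_C0 (h : IsShift p n π g r) (hc : c ∈ C0 n π) : shiftSum p g r c ∈ C0 n π :=
  tsum_mem_C0 h.ne_zero h.norm_lt_one (h.term_mem_C0 hc) (h.norm_term_le_of_mem hc)

variable [CompleteSpace K]

theorem shiftSum_add (h : IsShift p n π g r) (hc : c ∈ C0 n π) (hc' : c' ∈ C0 n π) :
    shiftSum p g r (c + c') = shiftSum p g r c + shiftSum p g r c' := by
  funext w
  simp only [shiftSum, Pi.add_apply, mul_add]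
  exact (h.summable hc w).tsum_add (h.summable hc' w)

theorem shiftSum_sub (h : IsShift p n π g r) (hc : c ∈ C0 n π) (hc' : c' ∈ C0 n π) :
    shiftSum p g r (c - c') = shiftSum p g r c - shiftSum p g r c' := by
  funext w
  simp only [shiftSum, Pi.sub_apply, mul_sub]
  exact (h.summable hc w).tsum_sub (h.summable hc' w)

theorem shiftSum_comm (h : IsShift p n π g r) (h' : IsShift p n π g' r') (hc : c ∈ C0 n π) :
    shiftSum p g r (shiftSum p g' r' c) = shiftSum p g' r' (shiftSum p g r c) := by
  funext w
  have hgeom := summable_geometric_of_lt_one (norm_nonneg π) h.norm_lt_one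
  have hsum : Summable (Function.uncurry fun i j =>
      g i * (g' j * c (w - (p : ℤ) ^ i • r - (p : ℤ) ^ j • r'))) := by
    refine Summable.of_norm_bounded ((hgeom.mul_of_nonneg hgeom (fun i => by positivity)
      (fun i => by positivity)).mul_right (‖π‖ ^ nWeight n w)) fun ⟨i, j⟩ => ?_
    refine (h.norm_term_le (c := fun v => g' j * c (v - (p : ℤ) ^ j • r'))
      (h'.norm_term_le_of_mem hc j _)).trans_eq (by ring)
  simp only [shiftSum, ← tsum_mul_left]
  rw [← hsum.tsum_comm]
  refine tsum_congr fun j => tsum_congr fun i => ?_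
  rw [sub_right_comm, mul_left_comm]

theorem shiftSum_mul (h : IsShift p n π g r) (l : ℤ × ℤ →+ ℤ) (hc : c ∈ C0 n π) :
    shiftSum p g r (fun w => l w * c w) = (fun w => l w * shiftSum p g r c w)
      - (l r : K) • shiftSum p (fun i => g i * (p : K) ^ i) r c := by
  funext w
  have hp (i : ℕ) : ‖(p : K) ^ i‖ ≤ 1 := by
    rw [norm_pow]
    exact pow_le_one₀ (norm_nonneg _) (IsUltrametricDist.norm_natCast_le_one K p)
  simp only [shiftSum, Pi.sub_apply, Pi.smul_apply, smul_eq_mul, ← tsum_mul_left]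
  rw [← ((h.summable hc w).mul_left _).tsum_sub (((h.mul hp).summable hc w).mul_left _)]
  refine tsum_congr fun i => ?_
  rw [map_sub, map_zsmul, smul_eq_mul]
  push_cast
  ring

theorem norm_shiftSum_sub_le (h : IsShift p n π g r) (hc : c ∈ C0 n π) (w : ℤ × ℤ) :
    ‖shiftSum p g r c w - g 0 * c (w - r)‖ ≤ ‖π‖ * ‖π‖ ^ nWeight n w := by
  rw [shiftSum, (h.summable hc w).tsum_eq_zero_add, pow_zero, one_smul, add_sub_cancel_left]
  refine IsUltrametricDist.norm_tsum_le_of_forall_le_of_nonneg (by positivity) fun i => ?_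
  refine (h.norm_term_le_of_mem hc (i + 1) w).trans ?_
  gcongr
  exact pow_le_of_le_one (norm_nonneg _) h.norm_lt_one.le (by omega)

end ShiftSum

section Twist

variable {K : Type*} [NormedField K] {p n : ℕ} {π m : K} {g τ : ℕ → K} {s : ℤ × ℤ}
  {lam : ℤ × ℤ →+ ℤ} {c c' : ℤ × ℤ → K}

/-- The operator `lam + ∑_i g_i (m x^{p^i s} - τ_i / (x y)^{p^i})`: it is `D_x` for `lam = x ∂/∂x`,
`m = n`, `s = (n, 0)` and `D_y` for `lam = y ∂/∂y`, `m = 1`, `s = (0, 1)`. -/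
noncomputable def twistOp (p : ℕ) (g τ : ℕ → K) (lam : ℤ × ℤ →+ ℤ) (m : K) (s : ℤ × ℤ)
    (c : ℤ × ℤ → K) : ℤ × ℤ → K :=
  (fun w => lam w * c w) + m • shiftSum p g s c - shiftSum p (fun i => g i * τ i) (-1, -1) c

/-- The conditions on the coefficients of `D_x` and `D_y` that are used to compute `H²`. -/
structure IsTwist (p n : ℕ) (π : K) (g τ : ℕ → K) : Prop where
  one_le_n : 1 ≤ n
  ne_zero : π ≠ 0
  norm_lt_one : ‖π‖ < 1
  g_zero : g 0 = π ^ n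
  norm_g : ∀ i, ‖g i‖ ≤ ‖π‖ ^ (n * p ^ i + i)
  norm_tau : ∀ i, ‖τ i‖ = 1

theorem IsTwist.isShift (h : IsTwist p n π g τ) (hs : nWeight n s = n) : IsShift p n π g s :=
  ⟨h.ne_zero, h.norm_lt_one, h.norm_g, hs⟩

theorem IsTwist.isShift_mul (h : IsTwist p n π g τ) :
    IsShift p n π (fun i => g i * τ i) (-1, -1) :=
  (h.isShift (nWeight_z n)).mul fun i => (h.norm_tau i).le

theorem twistOp_smul (a : K) : twistOp p g τ lam m s (a • c) = a • twistOp p g τ lam m s c := by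
  funext w
  simp only [twistOp, shiftSum_smul, Pi.add_apply, Pi.sub_apply, Pi.smul_apply, smul_eq_mul]
  ring

theorem twistOp_zero : twistOp p g τ lam m s 0 = 0 := by
  simpa using twistOp_smul (p := p) (g := g) (τ := τ) (lam := lam) (m := m) (s := s) (c := 0) 0

variable [IsUltrametricDist K]

theorem intCast_mul_mem_C0 (h₀ : π ≠ 0) (l : ℤ × ℤ → ℤ) (hc : c ∈ C0 n π) :
    (fun w => l w * c w) ∈ C0 n π := by
  refine mem_C0_of_norm_le h₀ hc fun w => ?_
  rw [norm_mul]
  exact mul_le_of_le_one_left (norm_nonneg _) (IsUltrametricDist.norm_intCast_le_one K _)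

theorem twistOp_mem_C0 (h : IsTwist p n π g τ) (hs : nWeight n s = n) (hm : ‖m‖ ≤ 1)
    (hc : c ∈ C0 n π) : twistOp p g τ lam m s c ∈ C0 n π :=
  sub_mem_C0 (add_mem_C0 (intCast_mul_mem_C0 h.ne_zero lam hc)
    (smul_mem_C0 hm (shiftSum_mem_C0 (h.isShift hs) hc))) (shiftSum_mem_C0 h.isShift_mul hc)

variable [CompleteSpace K]

theorem twistOp_add (h : IsTwist p n π g τ) (hs : nWeight n s = n) (hc : c ∈ C0 n π)
    (hc' : c' ∈ C0 n π) :
    twistOp p g τ lam m s (c + c') = twistOp p g τ lam m s c + twistOp p g τ lam m s c' := by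
  rw [twistOp, shiftSum_add (h.isShift hs) hc hc', shiftSum_add h.isShift_mul hc hc']
  funext w
  simp only [twistOp, Pi.add_apply, Pi.sub_apply, Pi.smul_apply, smul_eq_mul]
  ring

theorem twistOp_sub (h : IsTwist p n π g τ) (hs : nWeight n s = n) (hc : c ∈ C0 n π)
    (hc' : c' ∈ C0 n π) :
    twistOp p g τ lam m s (c - c') = twistOp p g τ lam m s c - twistOp p g τ lam m s c' := by
  rw [sub_eq_add_neg, ← neg_one_smul K c', twistOp_add h hs hc (smul_mem_C0 (by simp) hc'),
    twistOp_smul, neg_one_smul, sub_eq_add_neg]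

theorem twistOp_twistOp {m' : K} {s' : ℤ × ℤ} {l : ℤ × ℤ →+ ℤ} (h : IsTwist p n π g τ)
    (hs : nWeight n s = n) (hs' : nWeight n s' = n) (hm' : ‖m'‖ ≤ 1) (hls : l s = 0)
    (hc : c ∈ C0 n π) :
    twistOp p g τ lam m s (twistOp p g τ l m' s' c) =
      (fun w => lam w * twistOp p g τ l m' s' c w)
      + m • ((fun w => l w * shiftSum p g s c w) + m' • shiftSum p g s (shiftSum p g s' c)
        - shiftSum p g s (shiftSum p (fun i => g i * τ i) (-1, -1) c))
      - ((fun w => l w * shiftSum p (fun i => g i * τ i) (-1, -1) c w)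
        - (l (-1, -1) : K) • shiftSum p (fun i => g i * τ i * (p : K) ^ i) (-1, -1) c
        + m' • shiftSum p (fun i => g i * τ i) (-1, -1) (shiftSum p g s' c)
        - shiftSum p (fun i => g i * τ i) (-1, -1)
          (shiftSum p (fun i => g i * τ i) (-1, -1) c)) := by
  have hl := intCast_mul_mem_C0 h.ne_zero l hc
  have hX := smul_mem_C0 hm' (shiftSum_mem_C0 (h.isShift hs') hc)
  have hZ := shiftSum_mem_C0 h.isShift_mul hc
  unfold twistOp
  rw [shiftSum_sub (h.isShift hs) (add_mem_C0 hl hX) hZ, shiftSum_add (h.isShift hs) hl hX,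
    shiftSum_sub h.isShift_mul (add_mem_C0 hl hX) hZ, shiftSum_add h.isShift_mul hl hX,
    shiftSum_smul, shiftSum_smul, shiftSum_mul (h.isShift hs) l hc,
    shiftSum_mul h.isShift_mul l hc, hls, Int.cast_zero, zero_smul, sub_zero]

theorem twistOp_comm {m' : K} {s' : ℤ × ℤ} {l : ℤ × ℤ →+ ℤ} (h : IsTwist p n π g τ)
    (hs : nWeight n s = n) (hs' : nWeight n s' = n) (hm : ‖m‖ ≤ 1) (hm' : ‖m'‖ ≤ 1)
    (hls' : lam s' = 0) (hls : l s = 0) (hz : lam (-1, -1) = l (-1, -1)) (hc : c ∈ C0 n π) :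
    twistOp p g τ lam m s (twistOp p g τ l m' s' c) =
      twistOp p g τ l m' s' (twistOp p g τ lam m s c) := by
  rw [twistOp_twistOp h hs hs' hm' hls hc, twistOp_twistOp h hs' hs hm hls' hc,
    shiftSum_comm (h.isShift hs) (h.isShift hs') hc, shiftSum_comm (h.isShift hs) h.isShift_mul hc,
    shiftSum_comm (h.isShift hs') h.isShift_mul hc, hz]
  funext w
  simp only [twistOp, Pi.add_apply, Pi.sub_apply, Pi.smul_apply, smul_eq_mul]
  ring

theorem Dx_eq_twistOp {σ : K ≃+* K} {γ t : K}
    (h : IsTwist p n π (fun i => gammaSum p γ i * (p : K) ^ i) fun i => (σ : K → K)^[i] t)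
    (hc : c ∈ C0 n π) :
    Dx p n σ γ t c = twistOp p (fun i => gammaSum p γ i * (p : K) ^ i)
      (fun i => (σ : K → K)^[i] t) (AddMonoidHom.fst ℤ ℤ) n ((n : ℤ), 0) c := by
  funext w
  simp only [twistOp, shiftSum, Pi.add_apply, Pi.sub_apply, Pi.smul_apply, smul_eq_mul,
    ← tsum_mul_left]
  rw [Dx, add_sub_assoc, ← (((h.isShift (nWeight_x n)).summable hc w).mul_left _).tsum_sub
    (h.isShift_mul.summable hc w)]
  congr 1
  refine tsum_congr fun i => ?_
  simp only [Prod.sub_def, Prod.smul_mk, Int.zsmul_eq_mul, mul_comm (n : ℤ), mul_sub, mul_zero,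
    mul_neg, mul_one, sub_zero, sub_neg_eq_add]
  ring

theorem Dy_eq_twistOp {σ : K ≃+* K} {γ t : K}
    (h : IsTwist p n π (fun i => gammaSum p γ i * (p : K) ^ i) fun i => (σ : K → K)^[i] t)
    (hc : c ∈ C0 n π) :
    Dy p σ γ t c = twistOp p (fun i => gammaSum p γ i * (p : K) ^ i)
      (fun i => (σ : K → K)^[i] t) (AddMonoidHom.snd ℤ ℤ) 1 (0, 1) c := by
  funext w
  simp only [twistOp, shiftSum, Pi.add_apply, Pi.sub_apply, Pi.smul_apply, smul_eq_mul, one_mul]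
  rw [Dy, add_sub_assoc, ← ((h.isShift (nWeight_y n)).summable hc w).tsum_sub
    (h.isShift_mul.summable hc w)]
  congr 1
  refine tsum_congr fun i => ?_
  simp [Prod.sub_def, mul_sub, mul_assoc]

end Twist

section Reduction

variable {K : Type*} [NormedField K] [IsUltrametricDist K] {p n : ℕ} {π : K}

/-- The ring of integers of an ultrametric field modulo the elements of norm at most `‖π‖`. -/
abbrev ResidueRing (π : K) : Type _ :=
  (NormedField.valuation (K := K)).integer ⧸ Valuation.leIdeal (NormedField.valuation (K := K)) ‖π‖₊

/-- Reduction modulo `π`. Elements of norm greater than `1` reduce to the junk value `0`. -/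
noncomputable def red (π x : K) : ResidueRing π :=
  open Classical in if h : ‖x‖ ≤ 1 then Ideal.Quotient.mk _ ⟨x, h⟩ else 0

theorem red_of_norm_le_one {x : K} (h : ‖x‖ ≤ 1) :
    red π x = Ideal.Quotient.mk _ (⟨x, h⟩ : (NormedField.valuation (K := K)).integer) :=
  dif_pos h

theorem red_add {x y : K} (hx : ‖x‖ ≤ 1) (hy : ‖y‖ ≤ 1) : red π (x + y) = red π x + red π y := by
  rw [red_of_norm_le_one hx, red_of_norm_le_one hy,
    red_of_norm_le_one (norm_add_le_of_norm_le hx hy)]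
  rfl

theorem red_sub {x y : K} (hx : ‖x‖ ≤ 1) (hy : ‖y‖ ≤ 1) : red π (x - y) = red π x - red π y := by
  rw [red_of_norm_le_one hx, red_of_norm_le_one hy,
    red_of_norm_le_one (norm_sub_le_of_norm_le hx hy)]
  rfl

theorem red_mul {x y : K} (hx : ‖x‖ ≤ 1) (hy : ‖y‖ ≤ 1) : red π (x * y) = red π x * red π y := by
  rw [red_of_norm_le_one hx, red_of_norm_le_one hy, red_of_norm_le_one (norm_mul_le_one hx hy)]
  rfl

theorem red_eq_zero {x : K} (hx : ‖x‖ ≤ 1) : red π x = 0 ↔ ‖x‖ ≤ ‖π‖ := by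
  rw [red_of_norm_le_one hx, Ideal.Quotient.eq_zero_iff_mem]; rfl

theorem red_zero : red π (0 : K) = 0 := (red_eq_zero (by simp)).2 (by simp)

theorem red_intCast (z : ℤ) : red π (z : K) = z := by
  rw [red_of_norm_le_one (IsUltrametricDist.norm_intCast_le_one K z),
    ← map_intCast (Ideal.Quotient.mk (Valuation.leIdeal (NormedField.valuation (K := K)) ‖π‖₊))]
  congr 1

theorem red_natCast (z : ℕ) : red π (z : K) = z := by
  exact_mod_cast red_intCast (π := π) (z : ℤ)

theorem red_one : red π (1 : K) = 1 := by exact_mod_cast red_natCast (π := π) 1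

theorem isUnit_red {x : K} (hx : ‖x‖ = 1) : IsUnit (red π x) := by
  have h₀ : x ≠ 0 := norm_ne_zero_iff.1 (hx ▸ one_ne_zero)
  refine IsUnit.of_mul_eq_one (red π x⁻¹) ?_
  rw [← red_mul hx.le (by rw [norm_inv, hx, inv_one]), mul_inv_cancel₀ h₀, red_one]

theorem exists_red_eq (y : ResidueRing π) : ∃ x : K, ‖x‖ ≤ 1 ∧ red π x = y ∧ (y = 0 → x = 0) := by
  by_cases hy : y = 0
  · exact ⟨0, by simp, by rw [hy, red_zero], fun _ => rfl⟩
  · obtain ⟨⟨x, hx⟩, rfl⟩ := Ideal.Quotient.mk_surjective y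
    exact ⟨x, hx, red_of_norm_le_one hx, fun h => absurd h hy⟩

/-- The reduction of a series of `𝒞₀` modulo `π`. -/
noncomputable def redSeries (n : ℕ) (π : K) (c : ℤ × ℤ → K) (w : ℤ × ℤ) : ResidueRing π :=
  red π (normalized n π c w)

variable {c c' : ℤ × ℤ → K}

theorem redSeries_apply_eq_zero_iff (h₀ : π ≠ 0) (hc : c ∈ C0 n π) {w : ℤ × ℤ} :
    redSeries n π c w = 0 ↔ ‖c w‖ ≤ ‖π‖ * ‖π‖ ^ nWeight n w := by
  rw [redSeries, red_eq_zero (norm_normalized_le_one h₀ hc w), norm_normalized_le h₀]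

theorem redSeries_apply_of_eq_zero {w : ℤ × ℤ} (h : c w = 0) : redSeries n π c w = 0 := by
  rw [redSeries, normalized, h, zero_div, red_zero]

theorem redSeries_add (h₀ : π ≠ 0) (hc : c ∈ C0 n π) (hc' : c' ∈ C0 n π) :
    redSeries n π (c + c') = redSeries n π c + redSeries n π c' := by
  funext w
  rw [Pi.add_apply, redSeries, redSeries, redSeries, ← red_add (norm_normalized_le_one h₀ hc w)
    (norm_normalized_le_one h₀ hc' w), normalized, Pi.add_apply, add_div]
  rfl

theorem redSeries_sub (h₀ : π ≠ 0) (hc : c ∈ C0 n π) (hc' : c' ∈ C0 n π) :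
    redSeries n π (c - c') = redSeries n π c - redSeries n π c' := by
  funext w
  rw [Pi.sub_apply, redSeries, redSeries, redSeries, ← red_sub (norm_normalized_le_one h₀ hc w)
    (norm_normalized_le_one h₀ hc' w), normalized, Pi.sub_apply, sub_div]
  rfl

theorem redSeries_smul (h₀ : π ≠ 0) {a : K} (ha : ‖a‖ ≤ 1) (hc : c ∈ C0 n π) :
    redSeries n π (a • c) = red π a • redSeries n π c := by
  funext w
  rw [Pi.smul_apply, smul_eq_mul, redSeries, redSeries,
    ← red_mul ha (norm_normalized_le_one h₀ hc w), normalized, Pi.smul_apply, smul_eq_mul,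
    mul_div_assoc]
  rfl

theorem redSeries_intCast_mul (h₀ : π ≠ 0) (l : ℤ × ℤ → ℤ) (hc : c ∈ C0 n π) :
    redSeries n π (fun w => l w * c w) = fun w => (l w : ResidueRing π) * redSeries n π c w := by
  funext w
  rw [redSeries, redSeries, ← red_intCast,
    ← red_mul (IsUltrametricDist.norm_intCast_le_one K _) (norm_normalized_le_one h₀ hc w),
    normalized, mul_div_assoc]
  rfl

theorem redSeries_eq_zero_iff (h₀ : π ≠ 0) (hc : c ∈ C0 n π) :
    redSeries n π c = 0 ↔ ∃ c' ∈ C0 n π, c = π • c' := by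
  constructor
  · intro h
    exact mem_C0_of_smul_mem h₀ hc fun w => (redSeries_apply_eq_zero_iff h₀ hc).1 (congrFun h w)
  · rintro ⟨c', hc', rfl⟩
    funext w
    refine (redSeries_apply_eq_zero_iff h₀ hc).2 ?_
    rw [Pi.smul_apply, smul_eq_mul, norm_mul]
    gcongr
    exact norm_le_of_mem_C0 h₀ hc' w

theorem support_redSeries_finite (h₀ : π ≠ 0) (hc : c ∈ C0 n π) :
    (redSeries n π c).support.Finite := by
  have := eventually_cofinite.1 (eventually_norm_le h₀ hc (norm_pos_iff.2 h₀))
  exact this.subset fun w hw hle => hw ((redSeries_apply_eq_zero_iff h₀ hc).2 hle)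

theorem exists_redSeries_eq (h₀ : π ≠ 0) {b : ℤ × ℤ → ResidueRing π} (hb : b.support.Finite) :
    ∃ c ∈ C0 n π, redSeries n π c = b ∧ ∀ w, b w = 0 → c w = 0 := by
  choose lift norm_lift red_lift lift_zero using exists_red_eq (π := π)
  refine ⟨fun w => lift (b w) * π ^ nWeight n w, ?_, ?_, fun w hw => by simp [lift_zero _ hw]⟩
  · refine mem_C0_of_finite h₀ (fun w => ?_) (hb.subset fun w hw h => hw ?_)
    · rw [norm_mul, norm_zpow]
      exact mul_le_of_le_one_left (by positivity) (norm_lift _)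
    · simp [lift_zero _ h]
  · funext w
    rw [redSeries, normalized, mul_div_cancel_right₀ _ (zpow_ne_zero _ h₀), red_lift]

variable [CompleteSpace K] {g τ : ℕ → K} {r : ℤ × ℤ}

/-- Modulo `π`, only the first term of `∑_i g_i x^{p^i r}` survives, and it acts on a monomial as
in the graded ring: if the weight drops, a positive power of `π` splits off. -/
theorem redSeries_shiftSum (h : IsShift p n π g r) {b : K} (hb : ‖b‖ ≤ 1) (hg : g 0 = π ^ n * b)
    (hc : c ∈ C0 n π) :
    redSeries n π (shiftSum p g r c) = red π b • gradedShift r (redSeries n π c) := by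
  have h₀ := h.ne_zero
  have hmem := shiftSum_mem_C0 h hc
  funext w
  obtain ⟨v, rfl⟩ : ∃ v, w = v + r := ⟨w - r, (sub_add_cancel w r).symm⟩
  have hdiff := norm_shiftSum_sub_le h hc (v + r)
  rw [add_sub_cancel_right, hg] at hdiff
  rw [Pi.smul_apply, smul_eq_mul, gradedShift_apply, add_sub_cancel_right]
  split_ifs with hd
  · have hw : nWeight n (v + r) = nWeight n v + n := by
      rw [nWeight_add, h.nWeight_eq, hd, sub_self, mul_zero, sub_zero]
    have hnorm : normalized n π (shiftSum p g r c) (v + r) - b * normalized n π c v =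
        (shiftSum p g r c (v + r) - π ^ n * b * c v) / π ^ nWeight n (v + r) := by
      rw [normalized, normalized, hw, zpow_add₀ h₀, zpow_natCast]
      field_simp
    have key : ‖normalized n π (shiftSum p g r c) (v + r) - b * normalized n π c v‖ ≤ ‖π‖ := by
      rw [hnorm, norm_div, norm_zpow, div_le_iff₀ (zpow_pos (norm_pos_iff.2 h₀) _)]
      exact hdiff
    have h₁ := norm_normalized_le_one h₀ hmem (v + r)
    have h₂ := norm_normalized_le_one h₀ hc v
    rwa [redSeries, redSeries, ← sub_eq_zero, ← red_mul hb h₂,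
      ← red_sub h₁ (norm_mul_le_one hb h₂), red_eq_zero (key.trans h.norm_lt_one.le)]
  · rw [mul_zero, redSeries_apply_eq_zero_iff h₀ hmem]
    have hlt := lt_of_le_of_ne (depth_add_le v r) hd
    simpa using norm_add_le_of_norm_le hdiff (h.norm_mul_le hb hc hlt)

theorem redSeries_twistOp {lam : ℤ × ℤ →+ ℤ} {m : K} {s : ℤ × ℤ} (h : IsTwist p n π g τ)
    (hs : nWeight n s = n) (hm : ‖m‖ ≤ 1) (hc : c ∈ C0 n π) :
    redSeries n π (twistOp p g τ lam m s c) =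
      symbol lam (red π m) (red π (τ 0)) s (redSeries n π c) := by
  have h₀ := h.ne_zero
  have hl := intCast_mul_mem_C0 h₀ lam hc
  have hS := shiftSum_mem_C0 (h.isShift hs) hc
  have hZ := shiftSum_mem_C0 h.isShift_mul hc
  rw [twistOp, redSeries_sub h₀ (add_mem_C0 hl (smul_mem_C0 hm hS)) hZ,
    redSeries_add h₀ hl (smul_mem_C0 hm hS), redSeries_intCast_mul h₀ lam hc,
    redSeries_smul h₀ hm hS, redSeries_shiftSum (h.isShift hs) (b := 1) (by simp)
      (by rw [h.g_zero, mul_one]) hc, redSeries_shiftSum h.isShift_mul (h.norm_tau 0).le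
      (by rw [h.g_zero]) hc, red_one, one_smul]
  rfl

end Reduction

section Eps

variable {K : Type*} [NormedField K] {n : ℕ} {π : K}

theorem epsExp_isEps (j : Fin (2 * n + 1)) : IsEps n (epsExp n j) := by
  have := j.2
  rw [epsExp]
  split_ifs with hj
  · exact Or.inl ⟨rfl, by simp, by simpa using hj⟩
  · refine Or.inr ⟨rfl, ?_, ?_⟩ <;> dsimp only <;> omega

theorem nWeight_epsExp (i : ℕ) : nWeight n (epsExp n i) = i := by
  rw [epsExp, nWeight]
  split_ifs with hi
  · simp
  · dsimp only
    rw [max_eq_left (by omega)]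
    ring

theorem epsExp_injective : Function.Injective (epsExp n) := fun i j h => by
  simpa [nWeight_epsExp] using congrArg (nWeight n) h

theorem exists_epsExp_eq {w : ℤ × ℤ} (h : IsEps n w) : ∃ j : Fin (2 * n + 1), epsExp n j = w := by
  obtain ⟨u, v⟩ := w
  rcases h with ⟨rfl, h₁, h₂⟩ | ⟨rfl, h₁, h₂⟩ <;> dsimp only at h₁ h₂
  · refine ⟨⟨u.toNat, by omega⟩, ?_⟩
    rw [epsExp, if_pos (by dsimp only; omega), Int.toNat_of_nonneg h₁]
  · refine ⟨⟨u.toNat + n, by omega⟩, ?_⟩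
    rw [epsExp, if_neg (by dsimp only; omega)]
    exact Prod.ext (by dsimp only; omega) rfl

theorem sum_epsTilde_apply (a : Fin (2 * n + 1) → K) (i : Fin (2 * n + 1)) :
    (∑ j : Fin (2 * n + 1), a j • epsTilde n π (j : ℕ)) (epsExp n i) = a i * π ^ (i : ℕ) := by
  rw [Finset.sum_apply, Finset.sum_eq_single i]
  · simp [epsTilde, nWeight_epsExp]
  · intro j _ hj
    rw [Pi.smul_apply, epsTilde, Pi.single_eq_of_ne, smul_zero]
    exact fun h => hj (Fin.ext (epsExp_injective h).symm)
  · simp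

theorem sum_epsTilde_apply_of_not_isEps (a : Fin (2 * n + 1) → K) {w : ℤ × ℤ} (hw : ¬ IsEps n w) :
    (∑ j : Fin (2 * n + 1), a j • epsTilde n π (j : ℕ)) w = 0 := by
  rw [Finset.sum_apply]
  refine Finset.sum_eq_zero fun j _ => ?_
  rw [Pi.smul_apply, epsTilde, Pi.single_eq_of_ne, smul_zero]
  rintro rfl
  exact hw (epsExp_isEps j)

theorem sum_normalized_smul_epsTilde (h₀ : π ≠ 0) {e : ℤ × ℤ → K}
    (he : ∀ w, ¬ IsEps n w → e w = 0) :
    ∑ j : Fin (2 * n + 1), normalized n π e (epsExp n j) • epsTilde n π (j : ℕ) = e := by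
  funext w
  by_cases hw : IsEps n w
  · obtain ⟨j, rfl⟩ := exists_epsExp_eq hw
    rw [sum_epsTilde_apply, normalized, nWeight_epsExp, zpow_natCast,
      div_mul_cancel₀ _ (pow_ne_zero _ h₀)]
  · rw [sum_epsTilde_apply_of_not_isEps _ hw, he w hw]

theorem epsTilde_mem_C0 (h₀ : π ≠ 0) (i : ℕ) : epsTilde n π i ∈ C0 n π := by
  refine mem_C0_of_finite h₀ (fun w => ?_) ((Set.finite_singleton _).subset
    Pi.support_single_subset)
  by_cases hw : w = epsExp n i
  · simp [hw, epsTilde]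
  · rw [epsTilde, Pi.single_eq_of_ne hw, norm_zero]
    positivity

theorem sum_epsTilde_mem_C0 [IsUltrametricDist K] (h₀ : π ≠ 0) {a : Fin (2 * n + 1) → K}
    (ha : ∀ j, ‖a j‖ ≤ 1) : ∑ j : Fin (2 * n + 1), a j • epsTilde n π (j : ℕ) ∈ C0 n π :=
  Finset.sum_induction _ (· ∈ C0 n π) (fun _ _ => add_mem_C0) zero_mem_C0
    fun j _ => smul_mem_C0 (ha j) (epsTilde_mem_C0 h₀ j)

end Eps

section Decomposition

variable {K : Type*} [NormedField K] {p n : ℕ} {π : K} {g τ : ℕ → K} {c c' : ℤ × ℤ → K}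

/-- The operator `D_x` with general coefficients `g_i` and `τ_i` in place of `γ_i p^i` and
`σ^i(t̄)`. -/
noncomputable def opX (p n : ℕ) (g τ : ℕ → K) : (ℤ × ℤ → K) → ℤ × ℤ → K :=
  twistOp p g τ (AddMonoidHom.fst ℤ ℤ) n ((n : ℤ), 0)

/-- The operator `D_y` with general coefficients `g_i` and `τ_i` in place of `γ_i p^i` and
`σ^i(t̄)`. -/
noncomputable def opY (p : ℕ) (g τ : ℕ → K) : (ℤ × ℤ → K) → ℤ × ℤ → K :=
  twistOp p g τ (AddMonoidHom.snd ℤ ℤ) 1 (0, 1)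

theorem opX_smul (a : K) : opX p n g τ (a • c) = a • opX p n g τ c := twistOp_smul a

theorem opY_smul (a : K) : opY p g τ (a • c) = a • opY p g τ c := twistOp_smul a

variable {P Q : ℤ × ℤ → Prop} {β e ζ η : ℤ × ℤ → K}

/-- A representation `β = e + D_x ζ + D_y η` in `𝒞₀` for which the monomials of `e` satisfy `P` and
those of `ζ` satisfy `Q`. -/
structure IsDecomposition (p n : ℕ) (π : K) (g τ : ℕ → K) (P Q : ℤ × ℤ → Prop)
    (β e ζ η : ℤ × ℤ → K) : Prop where
  e_mem : e ∈ C0 n π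
  zeta_mem : ζ ∈ C0 n π
  eta_mem : η ∈ C0 n π
  e_eq_zero : ∀ w, ¬ P w → e w = 0
  zeta_eq_zero : ∀ w, ¬ Q w → ζ w = 0
  eq : β = e + opX p n g τ ζ + opY p g τ η

variable [IsUltrametricDist K]

theorem opX_mem_C0 (h : IsTwist p n π g τ) (hc : c ∈ C0 n π) : opX p n g τ c ∈ C0 n π :=
  twistOp_mem_C0 h (nWeight_x n) (IsUltrametricDist.norm_natCast_le_one K n) hc

theorem opY_mem_C0 (h : IsTwist p n π g τ) (hc : c ∈ C0 n π) : opY p g τ c ∈ C0 n π :=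
  twistOp_mem_C0 h (nWeight_y n) norm_one.le hc

theorem IsDecomposition.mem_C0 (h : IsTwist p n π g τ)
    (hd : IsDecomposition p n π g τ P Q β e ζ η) : β ∈ C0 n π :=
  hd.eq ▸ add_mem_C0 (add_mem_C0 hd.e_mem (opX_mem_C0 h hd.zeta_mem)) (opY_mem_C0 h hd.eta_mem)

variable [CompleteSpace K]

theorem opX_add (h : IsTwist p n π g τ) (hc : c ∈ C0 n π) (hc' : c' ∈ C0 n π) :
    opX p n g τ (c + c') = opX p n g τ c + opX p n g τ c' :=
  twistOp_add h (nWeight_x n) hc hc'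

theorem opY_add (h : IsTwist p n π g τ) (hc : c ∈ C0 n π) (hc' : c' ∈ C0 n π) :
    opY p g τ (c + c') = opY p g τ c + opY p g τ c' :=
  twistOp_add h (nWeight_y n) hc hc'

theorem opX_opY_comm (h : IsTwist p n π g τ) (hc : c ∈ C0 n π) :
    opX p n g τ (opY p g τ c) = opY p g τ (opX p n g τ c) :=
  twistOp_comm h (nWeight_x n) (nWeight_y n) (IsUltrametricDist.norm_natCast_le_one K n)
    norm_one.le rfl rfl rfl hc

theorem redSeries_opX (h : IsTwist p n π g τ) (hc : c ∈ C0 n π) :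
    redSeries n π (opX p n g τ c) = symbolX n (red π (τ 0)) (redSeries n π c) := by
  rw [opX, redSeries_twistOp h (nWeight_x n) (IsUltrametricDist.norm_natCast_le_one K n) hc,
    red_natCast]
  rfl

theorem redSeries_opY (h : IsTwist p n π g τ) (hc : c ∈ C0 n π) :
    redSeries n π (opY p g τ c) = symbolY (red π (τ 0)) (redSeries n π c) := by
  rw [opY, redSeries_twistOp h (nWeight_y n) norm_one.le hc, red_one]
  rfl

theorem IsDecomposition.redSeries_eq (h : IsTwist p n π g τ)
    (hd : IsDecomposition p n π g τ P Q β e ζ η) :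
    redSeries n π β = redSeries n π e + symbolX n (red π (τ 0)) (redSeries n π ζ)
      + symbolY (red π (τ 0)) (redSeries n π η) := by
  have hX := opX_mem_C0 h hd.zeta_mem
  rw [hd.eq, redSeries_add h.ne_zero (add_mem_C0 hd.e_mem hX) (opY_mem_C0 h hd.eta_mem),
    redSeries_add h.ne_zero hd.e_mem hX, redSeries_opX h hd.zeta_mem, redSeries_opY h hd.eta_mem]

theorem exists_decomposition_mod (h : IsTwist p n π g τ)
    (hβ : redSeries n π β ∈ symbolRange n (red π (τ 0)) P Q) (hβ' : β ∈ C0 n π) :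
    ∃ e ζ η, ∃ β' ∈ C0 n π, IsDecomposition p n π g τ P Q (β - π • β') e ζ η := by
  have h₀ := h.ne_zero
  obtain ⟨_, hx, _, ⟨η', hη', rfl⟩, hsum⟩ := Submodule.mem_sup.1 hβ
  obtain ⟨e', he', _, ⟨ζ', hζ', rfl⟩, rfl⟩ := Submodule.mem_sup.1 hx
  obtain ⟨e, he, rfl, he₀⟩ := exists_redSeries_eq (n := n) h₀ he'.1
  obtain ⟨ζ, hζ, rfl, hζ₀⟩ := exists_redSeries_eq (n := n) h₀ hζ'.1
  obtain ⟨η, hη, rfl, -⟩ := exists_redSeries_eq (n := n) h₀ hη'.1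
  have hd : IsDecomposition p n π g τ P Q (e + opX p n g τ ζ + opY p g τ η) e ζ η :=
    ⟨he, hζ, hη, fun w hw => he₀ w (he'.2 w hw), fun w hw => hζ₀ w (hζ'.2 w hw), rfl⟩
  have hred : redSeries n π (β - (e + opX p n g τ ζ + opY p g τ η)) = 0 := by
    rw [redSeries_sub h₀ hβ' (hd.mem_C0 h), hd.redSeries_eq h, hsum, sub_self]
  obtain ⟨β', hmem, hdiff⟩ := (redSeries_eq_zero_iff h₀ (sub_mem_C0 hβ' (hd.mem_C0 h))).1 hred
  exact ⟨e, ζ, η, β', hmem, by rwa [← hdiff, sub_sub_cancel]⟩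

theorem isDecomposition_adicSum (h : IsTwist p n π g τ) {b e ζ η : ℕ → ℤ × ℤ → K}
    (hb : ∀ k, b k ∈ C0 n π)
    (hd : ∀ k, IsDecomposition p n π g τ P Q (b k - π • b (k + 1)) (e k) (ζ k) (η k)) :
    IsDecomposition p n π g τ P Q (b 0) (adicSum π e 0) (adicSum π ζ 0) (adicSum π η 0) := by
  have h₀ := h.ne_zero
  have h₁ := h.norm_lt_one
  have hE := adicSum_mem_C0 h₀ h₁ fun k => (hd k).e_mem
  have hZ := adicSum_mem_C0 h₀ h₁ fun k => (hd k).zeta_mem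
  have hH := adicSum_mem_C0 h₀ h₁ fun k => (hd k).eta_mem
  set r : ℕ → ℤ × ℤ → K := fun k =>
    b k - (adicSum π e k + opX p n g τ (adicSum π ζ k) + opY p g τ (adicSum π η k)) with hr
  have hmem (k : ℕ) : r k ∈ C0 n π :=
    sub_mem_C0 (hb k) (add_mem_C0 (add_mem_C0 (hE k) (opX_mem_C0 h (hZ k))) (opY_mem_C0 h (hH k)))
  have step (k : ℕ) : r k = π • r (k + 1) := by
    have hbk := (hd k).eq
    rw [sub_eq_iff_eq_add] at hbk
    simp only [hr]
    rw [hbk, adicSum_eq h₀ h₁ (fun k => (hd k).e_mem) k,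
      adicSum_eq h₀ h₁ (fun k => (hd k).zeta_mem) k, adicSum_eq h₀ h₁ (fun k => (hd k).eta_mem) k,
      opX_add h (hd k).zeta_mem (smul_mem_C0 h₁.le (hZ _)),
      opY_add h (hd k).eta_mem (smul_mem_C0 h₁.le (hH _)), opX_smul, opY_smul]
    module
  have hr₀ : r 0 = 0 := by
    refine eq_zero_of_forall_pow_smul h₀ h₁ fun k => ⟨r k, hmem k, ?_⟩
    induction k with
    | zero => simp
    | succ k ih => rw [ih, step k, smul_smul, pow_succ]
  exact ⟨hE 0, hZ 0, hH 0, fun w hw => adicSum_eq_zero (fun k => (hd k).e_eq_zero w hw) 0,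
    fun w hw => adicSum_eq_zero (fun k => (hd k).zeta_eq_zero w hw) 0, sub_eq_zero.1 hr₀⟩

theorem exists_decomposition (h : IsTwist p n π g τ)
    (hPQ : ∀ b : ℤ × ℤ → ResidueRing π, b.support.Finite → b ∈ symbolRange n (red π (τ 0)) P Q)
    (hβ : β ∈ C0 n π) : ∃ e ζ η, IsDecomposition p n π g τ P Q β e ζ η := by
  choose! e ζ η next next_mem hd using fun β (hβ : β ∈ C0 n π) =>
    exists_decomposition_mod h (hPQ _ (support_redSeries_finite h.ne_zero hβ)) hβ
  have hb (k : ℕ) : next^[k] β ∈ C0 n π := by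
    induction k with
    | zero => exact hβ
    | succ k ih => exact Function.iterate_succ_apply' next k β ▸ next_mem _ ih
  refine ⟨_, _, _, isDecomposition_adicSum h (b := fun k => next^[k] β)
    (e := fun k => e (next^[k] β)) (ζ := fun k => ζ (next^[k] β)) (η := fun k => η (next^[k] β))
    hb fun k => ?_⟩
  rw [Function.iterate_succ_apply']
  exact hd _ (hb k)

theorem exists_normal_decomposition (h : IsTwist p n π g τ) (hζ : ζ ∈ C0 n π) :
    ∃ ν ∈ C0 n π, ∃ θ ∈ C0 n π, (∀ w, ¬ IsNormal w → ν w = 0) ∧ ζ = ν + opY p g τ θ := by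
  obtain ⟨ν, z, θ, hd⟩ := exists_decomposition h
    (fun _ => mem_symbolRange_normal h.one_le_n (isUnit_red (h.norm_tau 0))) hζ
  have hz : z = 0 := funext fun w => hd.zeta_eq_zero w not_false
  refine ⟨ν, hd.e_mem, θ, hd.eta_mem, hd.e_eq_zero, ?_⟩
  have hsum := hd.eq
  rwa [hz, opX, twistOp_zero, add_zero] at hsum

theorem exists_eps_decomposition (h : IsTwist p n π g τ) (hn : ‖(n : K)‖ = 1) (hβ : β ∈ C0 n π) :
    ∃ e ζ η, IsDecomposition p n π g τ (IsEps n) IsNormal β e ζ η :=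
  exists_decomposition h (fun _ => mem_symbolRange_eps h.one_le_n
    (red_natCast (π := π) n ▸ isUnit_red hn) (isUnit_red (h.norm_tau 0))) hβ

theorem IsDecomposition.exists_smul (h : IsTwist p n π g τ) (hn : ‖(n : K)‖ = 1)
    (hd : IsDecomposition p n π g τ (IsEps n) IsNormal 0 e ζ η) :
    ∃ e' ζ' η', e = π • e' ∧ IsDecomposition p n π g τ (IsEps n) IsNormal 0 e' ζ' η' := by
  have h₀ := h.ne_zero
  have hred := hd.redSeries_eq h
  rw [(redSeries_eq_zero_iff h₀ zero_mem_C0).2 ⟨0, zero_mem_C0, (smul_zero π).symm⟩] at hred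
  obtain ⟨hre, hrζ, hrη⟩ := symbol_injective h.one_le_n
    (red_natCast (π := π) n ▸ isUnit_red hn) (isUnit_red (h.norm_tau 0))
    (fun w hw => redSeries_apply_of_eq_zero (hd.e_eq_zero w hw))
    (fun w hw => redSeries_apply_of_eq_zero (hd.zeta_eq_zero w hw))
    ((support_redSeries_finite h₀ hd.zeta_mem).union (support_redSeries_finite h₀ hd.eta_mem))
    hred.symm
  obtain ⟨e', he', rfl⟩ := (redSeries_eq_zero_iff h₀ hd.e_mem).1 hre
  obtain ⟨ζ', hζ', rfl⟩ := (redSeries_eq_zero_iff h₀ hd.zeta_mem).1 hrζ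
  obtain ⟨η', hη', rfl⟩ := (redSeries_eq_zero_iff h₀ hd.eta_mem).1 hrη
  have hsum := hd.eq
  rw [opX_smul, opY_smul, ← smul_add, ← smul_add, eq_comm, smul_eq_zero_iff_right h₀] at hsum
  exact ⟨e', ζ', η', rfl, he', hζ', hη',
    fun w hw => (mul_eq_zero.1 (hd.e_eq_zero w hw)).resolve_left h₀,
    fun w hw => (mul_eq_zero.1 (hd.zeta_eq_zero w hw)).resolve_left h₀, hsum.symm⟩

theorem IsDecomposition.eq_zero (h : IsTwist p n π g τ) (hn : ‖(n : K)‖ = 1)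
    (hd : IsDecomposition p n π g τ (IsEps n) IsNormal 0 e ζ η) : e = 0 := by
  have key (k : ℕ) : ∃ e' ζ' η', e = π ^ k • e' ∧
      IsDecomposition p n π g τ (IsEps n) IsNormal 0 e' ζ' η' := by
    induction k with
    | zero => exact ⟨e, ζ, η, by simp, hd⟩
    | succ k ih =>
      obtain ⟨_, _, _, hk, hd⟩ := ih
      obtain ⟨e', ζ', η', he', hd'⟩ := hd.exists_smul h hn
      exact ⟨e', ζ', η', by rw [hk, he', smul_smul, pow_succ], hd'⟩
  refine eq_zero_of_forall_pow_smul (n := n) h.ne_zero h.norm_lt_one fun k => ?_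
  obtain ⟨e', _, _, hk, hd'⟩ := key k
  exact ⟨e', hd'.e_mem, hk⟩

/-- A relation can be normalized: replace `ζ` by a normal form modulo the image of `D_y`, at the
expense of `η`, since `D_x` and `D_y` commute. -/
theorem eq_zero_of_eps_relation (h : IsTwist p n π g τ) (hn : ‖(n : K)‖ = 1) (he : e ∈ C0 n π)
    (hζ : ζ ∈ C0 n π) (hη : η ∈ C0 n π) (hE : ∀ w, ¬ IsEps n w → e w = 0)
    (hsum : e + opX p n g τ ζ + opY p g τ η = 0) : e = 0 := by
  obtain ⟨ν, hν, θ, hθ, hνN, rfl⟩ := exists_normal_decomposition h hζ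
  have hθX := opX_mem_C0 h hθ
  rw [opX_add h hν (opY_mem_C0 h hθ), opX_opY_comm h hθ, add_assoc, add_assoc,
    ← opY_add h hθX hη, ← add_assoc] at hsum
  exact IsDecomposition.eq_zero h hn ⟨he, hν, add_mem_C0 hθX hη, hE, hνN, hsum.symm⟩

end Decomposition

section Basis

variable {K : Type*} [NormedField K] [IsUltrametricDist K] [CompleteSpace K] {p n : ℕ} {π t : K}
  {σ : K ≃+* K} {β c c' : ℤ × ℤ → K}

/-- The coefficients `γ_i p^i` and `σ^i(t̄)` of the operators `D_x` and `D_y` satisfy the estimates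
of `IsTwist`. -/
def IsTwistFor (p n : ℕ) (σ : K ≃+* K) (π t : K) : Prop :=
  IsTwist p n π (fun i => gammaSum p (π ^ n) i * (p : K) ^ i) fun i => (σ : K → K)^[i] t

theorem Dx_sub (h : IsTwistFor p n σ π t) (hc : c ∈ C0 n π) (hc' : c' ∈ C0 n π) :
    Dx p n σ (π ^ n) t (c - c') = Dx p n σ (π ^ n) t c - Dx p n σ (π ^ n) t c' := by
  rw [Dx_eq_twistOp h (sub_mem_C0 hc hc'), Dx_eq_twistOp h hc, Dx_eq_twistOp h hc']
  exact twistOp_sub h (nWeight_x n) hc hc'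

theorem Dy_sub (h : IsTwistFor p n σ π t) (hc : c ∈ C0 n π) (hc' : c' ∈ C0 n π) :
    Dy p σ (π ^ n) t (c - c') = Dy p σ (π ^ n) t c - Dy p σ (π ^ n) t c' := by
  rw [Dy_eq_twistOp h (sub_mem_C0 hc hc'), Dy_eq_twistOp h hc, Dy_eq_twistOp h hc']
  exact twistOp_sub h (nWeight_y n) hc hc'

theorem coeff_eq_zero_of_eps_relation (h : IsTwistFor p n σ π t) (hn : ‖(n : K)‖ = 1)
    {a : Fin (2 * n + 1) → K} (ha : ∀ j, ‖a j‖ ≤ 1) (hc : c ∈ C0 n π) (hc' : c' ∈ C0 n π)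
    (hsum : (∑ j : Fin (2 * n + 1), a j • epsTilde n π (j : ℕ)) + Dx p n σ (π ^ n) t c
      + Dy p σ (π ^ n) t c' = 0) : a = 0 := by
  rw [Dx_eq_twistOp h hc, Dy_eq_twistOp h hc'] at hsum
  have hzero := eq_zero_of_eps_relation h hn (sum_epsTilde_mem_C0 h.ne_zero ha) hc hc'
    (fun w => sum_epsTilde_apply_of_not_isEps a) hsum
  funext i
  have hi := congrFun hzero (epsExp n i)
  rw [sum_epsTilde_apply] at hi
  exact (mul_eq_zero.1 hi).resolve_right (pow_ne_zero _ h.ne_zero)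

theorem coeff_eq_of_cohomologous (h : IsTwistFor p n σ π t) (hn : ‖(n : K)‖ = 1)
    {a a' : Fin (2 * n + 1) → K} (ha : ∀ j, ‖a j‖ ≤ 1) (ha' : ∀ j, ‖a' j‖ ≤ 1)
    (hβ : Cohomologous p n σ π t β (∑ j : Fin (2 * n + 1), a j • epsTilde n π (j : ℕ)))
    (hβ' : Cohomologous p n σ π t β (∑ j : Fin (2 * n + 1), a' j • epsTilde n π (j : ℕ))) :
    a = a' := by
  obtain ⟨ζ, hζ, η, hη, rfl⟩ := hβ
  obtain ⟨ζ', hζ', η', hη', heq⟩ := hβ'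
  rw [← sub_eq_zero] at heq ⊢
  refine coeff_eq_zero_of_eps_relation h hn (fun j => norm_sub_le_of_norm_le (ha j) (ha' j))
    (sub_mem_C0 hζ hζ') (sub_mem_C0 hη hη') ?_
  simp only [Pi.sub_apply, sub_smul, Finset.sum_sub_distrib]
  rw [Dx_sub h hζ hζ', Dy_sub h hη hη', ← heq]
  abel

theorem exists_cohomologous (h : IsTwistFor p n σ π t) (hn : ‖(n : K)‖ = 1) (hβ : β ∈ C0 n π) :
    ∃ a : Fin (2 * n + 1) → K, (∀ j, ‖a j‖ ≤ 1) ∧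
      Cohomologous p n σ π t β (∑ j : Fin (2 * n + 1), a j • epsTilde n π (j : ℕ)) := by
  obtain ⟨e, ζ, η, hd⟩ := exists_eps_decomposition h hn hβ
  refine ⟨fun j => normalized n π e (epsExp n j),
    fun j => norm_normalized_le_one h.ne_zero hd.e_mem _, ζ, hd.zeta_mem, η, hd.eta_mem, ?_⟩
  rw [sum_normalized_smul_epsTilde h.ne_zero hd.e_eq_zero, Dx_eq_twistOp h hd.zeta_mem,
    Dy_eq_twistOp h hd.eta_mem]
  exact hd.eq

theorem epsIsBasis (h : IsTwistFor p n σ π t) (hn : ‖(n : K)‖ = 1) : EpsIsBasis p n σ π t := by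
  refine ⟨fun ζ hζ => ?_, fun β hβ => ?_⟩
  · rw [Dx_eq_twistOp h hζ, Dy_eq_twistOp h hζ]
    exact ⟨opX_mem_C0 h hζ, opY_mem_C0 h hζ⟩
  · obtain ⟨a, ha, hc⟩ := exists_cohomologous h hn hβ
    exact ⟨a, ⟨ha, hc⟩, fun a' ha' => coeff_eq_of_cohomologous h hn ha'.1 ha ha'.2 hc⟩

end Basis

section ArtinHasse

open PowerSeries

theorem eq_of_derivative_eq_mul {R : Type*} [CommRing R] [IsAddTorsionFree R]
    {F G H : PowerSeries R} (hF : d⁄dX R F = H * F) (hG : d⁄dX R G = H * G)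
    (h₀ : coeff 0 F = coeff 0 G) : F = G := by
  ext k
  induction k using Nat.strong_induction_on with
  | _ k ih =>
    obtain - | k := k
    · exact h₀
    have hk : coeff k (d⁄dX R F) = coeff k (d⁄dX R G) := by
      rw [hF, hG, coeff_mul, coeff_mul]
      refine Finset.sum_congr rfl fun x hx => ?_
      rw [ih x.2 (Nat.lt_succ_of_le (Finset.HasAntidiagonal.antidiagonal.snd_le hx))]
    rw [coeff_derivative, coeff_derivative, ← Nat.cast_succ, mul_comm, mul_comm (coeff _ G),
      ← nsmul_eq_mul, ← nsmul_eq_mul] at hk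
    exact nsmul_right_injective k.succ_ne_zero hk

theorem X_mul_derivative_expand {R : Type*} [CommRing R] {p : ℕ} (hp : p ≠ 0) (f : PowerSeries R) :
    X * d⁄dX R (expand p hp f) = (p : PowerSeries R) * expand p hp (X * d⁄dX R f) := by
  have hs : HasSubst (X ^ p : PowerSeries R) := HasSubst.X_pow hp
  rw [map_mul, expand_X, expand_apply, expand_apply, derivative_subst hs, derivative_pow,
    derivative_X]
  obtain ⟨k, rfl⟩ := Nat.exists_eq_succ_of_ne_zero hp
  rw [Nat.succ_sub_one, pow_succ']
  ring

variable {p : ℕ}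

theorem constantCoeff_artinHasseLog : constantCoeff (artinHasseLog p) = 0 := by
  rw [← coeff_zero_eq_constantCoeff_apply, artinHasseLog, coeff_mk]
  split_ifs <;> simp

theorem hasSubst_artinHasseLog : HasSubst (artinHasseLog p) :=
  HasSubst.of_constantCoeff_zero' constantCoeff_artinHasseLog

theorem coeff_zero_artinHasse : coeff 0 (artinHasse p) = 1 := by
  rw [artinHasse, coeff_subst' hasSubst_artinHasseLog, finsum_eq_single _ 0]
  · simp
  · intro k hk
    simp [constantCoeff_artinHasseLog, hk]

theorem derivative_artinHasse :
    d⁄dX ℚ (artinHasse p) = d⁄dX ℚ (artinHasseLog p) * artinHasse p := by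
  rw [artinHasse, derivative_subst hasSubst_artinHasseLog, derivative_exp, mul_comm]

theorem exists_eq_pow_iff (hp : p.Prime) {j : ℕ} :
    (∃ k, j = p ^ k) ↔ j = 1 ∨ p ∣ j ∧ ∃ k, j / p = p ^ k := by
  constructor
  · rintro ⟨_ | k, rfl⟩
    · exact Or.inl (pow_zero p)
    · exact Or.inr ⟨dvd_pow_self p k.succ_ne_zero, k, by
        rw [pow_succ, Nat.mul_div_cancel _ hp.pos]⟩
  · rintro (rfl | ⟨hdvd, k, hk⟩)
    · exact ⟨0, (pow_zero p).symm⟩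
    · exact ⟨k + 1, by rw [pow_succ, ← hk, Nat.div_mul_cancel hdvd]⟩

theorem coeff_X_mul_derivative_artinHasseLog (hp : p ≠ 0) (j : ℕ) [Decidable (∃ k, j = p ^ k)] :
    coeff j (X * d⁄dX ℚ (artinHasseLog p)) = if ∃ k, j = p ^ k then 1 else 0 := by
  obtain - | j := j
  · rw [coeff_zero_X_mul, if_neg]
    rintro ⟨k, hk⟩
    exact pow_ne_zero k hp hk.symm
  · rw [coeff_succ_X_mul, coeff_derivative, artinHasseLog, coeff_mk]
    split_ifs
    · push_cast
      field_simp
    · rw [zero_mul]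

theorem X_mul_derivative_artinHasseLog (hp : p.Prime) : X * d⁄dX ℚ (artinHasseLog p) =
    X + expand p hp.ne_zero (X * d⁄dX ℚ (artinHasseLog p)) := by
  classical
  ext j
  rw [map_add, coeff_X, coeff_expand, coeff_X_mul_derivative_artinHasseLog hp.ne_zero,
    coeff_X_mul_derivative_artinHasseLog hp.ne_zero, if_congr (exists_eq_pow_iff hp) rfl rfl]
  by_cases hj : j = 1
  · simp [hj, hp.ne_one]
  · simp [hj, ite_and]

theorem derivative_rescale_exp (m : ℕ) :
    d⁄dX ℚ (rescale (m : ℚ) (exp ℚ)) = m * rescale (m : ℚ) (exp ℚ) := by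
  ext k
  rw [coeff_derivative, ← nsmul_eq_mul, map_nsmul, coeff_rescale, coeff_rescale, coeff_exp,
    coeff_exp, Nat.factorial_succ, nsmul_eq_mul]
  simp only [eq_ratCast, Rat.cast_id, Nat.cast_mul, Nat.cast_succ]
  field_simp
  ring

/-- Both sides solve `f' = p L' f`, where `L` is the Artin–Hasse logarithm. -/
theorem artinHasse_pow (hp : p.Prime) : artinHasse p ^ p =
    expand p hp.ne_zero (artinHasse p) * rescale (p : ℚ) (exp ℚ) := by
  refine eq_of_derivative_eq_mul (H := p * d⁄dX ℚ (artinHasseLog p)) ?_ ?_ ?_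
  · rw [derivative_pow, derivative_artinHasse, ← mul_pow_sub_one hp.ne_zero (artinHasse p)]
    ring
  · refine mul_left_cancel₀ (X_ne_zero (R := ℚ)) ?_
    have hE := X_mul_derivative_expand hp.ne_zero (artinHasse p)
    rw [derivative_artinHasse, ← mul_assoc, map_mul] at hE
    rw [Derivation.leibniz, derivative_rescale_exp, smul_eq_mul, smul_eq_mul]
    linear_combination (rescale (p : ℚ) (exp ℚ)) * hE - p * expand p hp.ne_zero (artinHasse p) *
      rescale (p : ℚ) (exp ℚ) * X_mul_derivative_artinHasseLog hp
  · have h₀ := coeff_zero_artinHasse (p := p)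
    rw [coeff_zero_eq_constantCoeff] at h₀ ⊢
    rw [map_pow, map_mul, constantCoeff_expand, h₀, one_pow, one_mul,
      ← coeff_zero_eq_constantCoeff_apply, coeff_rescale, coeff_exp]
    simp

theorem coeff_derivative_artinHasseLog_of_lt {j : ℕ} (hj : j + 1 < p) :
    coeff j (d⁄dX ℚ (artinHasseLog p)) = if j = 0 then 1 else 0 := by
  classical
  rw [← coeff_succ_X_mul, coeff_X_mul_derivative_artinHasseLog (by omega)]
  refine if_congr ⟨?_, fun h => ⟨0, by rw [h, zero_add, pow_zero]⟩⟩ rfl rfl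
  rintro ⟨_ | k, hk⟩
  · simpa using hk
  · have hle : p ≤ p ^ (k + 1) := Nat.le_self_pow k.succ_ne_zero p
    omega

theorem coeff_artinHasse_of_lt {k : ℕ} (hk : k < p) :
    coeff k (artinHasse p) = 1 / (k.factorial : ℚ) := by
  induction k with
  | zero => simpa using coeff_zero_artinHasse
  | succ k ih =>
    have hd : coeff k (d⁄dX ℚ (artinHasse p)) = coeff k (artinHasse p) := by
      rw [derivative_artinHasse, coeff_mul, Finset.sum_eq_single (0, k)]
      · rw [coeff_derivative_artinHasseLog_of_lt (by dsimp only; omega), if_pos rfl, one_mul]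
      · intro x hx hne
        have hx' := Finset.HasAntidiagonal.mem_antidiagonal.1 hx
        rw [coeff_derivative_artinHasseLog_of_lt (by omega), if_neg, zero_mul]
        exact fun h₁ => hne (Prod.ext h₁ (by dsimp only; omega))
      · simp
    rw [coeff_derivative, ih (by omega)] at hd
    rw [Nat.factorial_succ, Nat.cast_mul, Nat.cast_succ, ← div_div, div_right_comm, ← hd,
      mul_div_cancel_right₀ _ k.cast_add_one_ne_zero]

theorem coeff_add_X_pow_mul_pow {R : Type*} [CommRing R] (F G : PowerSeries R) (m : ℕ) {k : ℕ}
    (hk : k ≠ 0) : coeff k ((F + X ^ k * G) ^ m) =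
      coeff k (F ^ m) + m * (coeff 0 F ^ (m - 1) * coeff 0 G) := by
  obtain ⟨R, hR⟩ := Polynomial.powAddExpansion F (X ^ k * G) m
  have hlin : (m : PowerSeries _) * F ^ (m - 1) * (X ^ k * G) =
      X ^ k * (m • (F ^ (m - 1) * G)) := by
    rw [nsmul_eq_mul]
    ring
  have hquad : R * (X ^ k * G) ^ 2 = X ^ (k + k) * (R * G ^ 2) := by ring
  rw [hR, hlin, hquad, map_add, map_add, coeff_X_pow_mul', coeff_X_pow_mul', if_pos le_rfl,
    if_neg (by omega), Nat.sub_self, add_zero, map_nsmul, nsmul_eq_mul]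
  simp

theorem coeff_pow_eq_coeff_trunc_pow_add {R : Type*} [CommRing R] {E : PowerSeries R}
    (hE : coeff 0 E = 1) (m : ℕ) {k : ℕ} (hk : k ≠ 0) :
    coeff k (E ^ m) = (trunc k E ^ m).coeff k + m * coeff k E := by
  conv_lhs => rw [eq_X_pow_mul_shift_add_trunc k E, add_comm]
  rw [coeff_add_X_pow_mul_pow _ _ m hk, ← Polynomial.coe_pow, Polynomial.coeff_coe,
    Polynomial.coeff_coe, coeff_trunc, if_pos (by omega), hE, one_pow, one_mul, coeff_mk, zero_add]

variable (p) [Fact p.Prime]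

theorem norm_coeff_pow_sub_expand {f : Polynomial ℚ_[p]} (hf : ∀ j, ‖f.coeff j‖ ≤ 1) (k : ℕ) :
    ‖(f ^ p - Polynomial.expand ℚ_[p] p f).coeff k‖ ≤ ‖(p : ℚ_[p])‖ := by
  obtain ⟨f, rfl⟩ : ∃ g : Polynomial ℤ_[p], g.map (algebraMap ℤ_[p] ℚ_[p]) = f :=
    (Polynomial.mem_lifts f).1 ((Polynomial.lifts_iff_coeff_lifts f).2 fun j => ⟨⟨_, hf j⟩, rfl⟩)
  have hmod : (f ^ p - Polynomial.expand ℤ_[p] p f).map PadicInt.toZMod = 0 := by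
    rw [Polynomial.map_sub, Polynomial.map_pow, Polynomial.map_expand, ZMod.expand_card, sub_self]
  have hdvd : (p : ℤ_[p]) ∣ (f ^ p - Polynomial.expand ℤ_[p] p f).coeff k := by
    rw [← Ideal.mem_span_singleton, ← PadicInt.maximalIdeal_eq_span_p, ← PadicInt.ker_toZMod,
      RingHom.mem_ker, ← Polynomial.coeff_map, hmod, Polynomial.coeff_zero]
  obtain ⟨c, hc⟩ := hdvd
  rw [← Polynomial.map_pow, ← Polynomial.map_expand, ← Polynomial.map_sub, Polynomial.coeff_map, hc,
    map_mul, norm_mul, map_natCast]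
  exact mul_le_of_le_one_right (norm_nonneg _) c.2

theorem norm_coeff_mul_sub_le {A U : PowerSeries ℚ_[p]} {r : ℝ} {k : ℕ}
    (hA : ∀ j < k, ‖coeff j A‖ ≤ 1) (hU₀ : coeff 0 U = 1) (hU : ∀ b ≠ 0, ‖coeff b U‖ ≤ r)
    (hr : 0 ≤ r) : ‖coeff k (A * U) - coeff k A‖ ≤ r := by
  have hmem : (k, 0) ∈ Finset.HasAntidiagonal.antidiagonal k := by simp
  rw [coeff_mul, ← Finset.sum_erase_add _ _ hmem, hU₀, mul_one, add_sub_cancel_right]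
  refine IsUltrametricDist.norm_sum_le_of_forall_le_of_nonneg hr fun x hx => ?_
  obtain ⟨hne, hx⟩ := Finset.mem_erase.1 hx
  rw [Finset.HasAntidiagonal.mem_antidiagonal] at hx
  have hx₂ : x.2 ≠ 0 := fun h => hne (Prod.ext (by dsimp only; omega) h)
  rw [norm_mul, ← one_mul r]
  exact mul_le_mul (hA _ (by omega)) (hU _ hx₂) (norm_nonneg _) zero_le_one

/-- Dwork's lemma. In degree `k`, the equation determines `p` times the coefficient of `E` in terms
of the truncation `f` of `E`, and this is divisible by `p` because `f(x)^p ≡ f(x^p)` modulo `p`. -/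
theorem norm_coeff_le_one_of_pow_eq_expand_mul (hp : p ≠ 0) {E U : PowerSeries ℚ_[p]}
    (hE : coeff 0 E = 1) (hU₀ : coeff 0 U = 1) (hU : ∀ b ≠ 0, ‖coeff b U‖ ≤ ‖(p : ℚ_[p])‖)
    (h : E ^ p = expand p hp E * U) (k : ℕ) : ‖coeff k E‖ ≤ 1 := by
  have hp₁ : 1 < p := (Fact.out : p.Prime).one_lt
  induction k using Nat.strong_induction_on with
  | _ k ih =>
    rcases eq_or_ne k 0 with rfl | hk
    · rw [hE, norm_one]
    set f := trunc k E with hf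
    have hfE (j : ℕ) (hj : j < k) : f.coeff j = coeff j E := by rw [hf, coeff_trunc, if_pos hj]
    have hf₁ (j : ℕ) : ‖f.coeff j‖ ≤ 1 := by
      rw [hf, coeff_trunc]
      split_ifs with hj
      · exact ih j hj
      · rw [norm_zero]
        exact zero_le_one
    have hexpand : coeff k (expand p hp E) = (Polynomial.expand ℚ_[p] p f).coeff k := by
      rw [coeff_expand, Polynomial.coeff_expand (by omega),
        hfE _ (Nat.div_lt_self (Nat.pos_of_ne_zero hk) hp₁)]
    have hlow (j : ℕ) (hj : j < k) : ‖coeff j (expand p hp E)‖ ≤ 1 := by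
      rw [coeff_expand]
      split_ifs
      · exact ih _ ((Nat.div_le_self j p).trans_lt hj)
      · rw [norm_zero]
        exact zero_le_one
    have hkey : p * coeff k E = (coeff k (expand p hp E * U) - coeff k (expand p hp E)) -
        (f ^ p - Polynomial.expand ℚ_[p] p f).coeff k := by
      rw [← h, coeff_pow_eq_coeff_trunc_pow_add hE p hk, Polynomial.coeff_sub, hexpand]
      ring
    have hnorm : ‖p * coeff k E‖ ≤ ‖(p : ℚ_[p])‖ := hkey ▸ norm_sub_le_of_norm_le
      (norm_coeff_mul_sub_le p hlow hU₀ hU (norm_nonneg _)) (norm_coeff_pow_sub_expand p hf₁ k)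
    rw [norm_mul] at hnorm
    exact le_of_mul_le_mul_left (hnorm.trans_eq (mul_one _).symm)
      (norm_pos_iff.2 (Nat.cast_ne_zero.2 hp))

theorem norm_pow_div_factorial_le {b : ℕ} (hb : b ≠ 0) :
    ‖((p : ℚ_[p]) ^ b / (b.factorial : ℚ_[p]))‖ ≤ ‖(p : ℚ_[p])‖ := by
  have hp₁ : (1 : ℝ) ≤ p := by exact_mod_cast (Fact.out : p.Prime).one_le
  have hv := padicValNat_factorial_lt_of_ne_zero p hb
  rw [norm_div, norm_pow, Padic.norm_p,
    Padic.norm_eq_zpow_neg_valuation (Nat.cast_ne_zero.2 b.factorial_ne_zero),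
    Padic.valuation_natCast, div_le_iff₀ (by positivity), ← zpow_natCast, inv_zpow', ← zpow_neg_one,
    ← zpow_add₀ (by positivity)]
  exact zpow_le_zpow_right₀ hp₁ (by omega)

theorem norm_coeff_artinHasse_le (k : ℕ) :
    ‖((coeff k (artinHasse p) : ℚ) : ℚ_[p])‖ ≤ 1 := by
  have hp : p.Prime := Fact.out
  have hfun := congrArg (PowerSeries.map (algebraMap ℚ ℚ_[p])) (artinHasse_pow hp)
  rw [map_pow, map_mul, map_expand] at hfun
  have hU (b : ℕ) : coeff b (PowerSeries.map (algebraMap ℚ ℚ_[p]) (rescale (p : ℚ) (exp ℚ))) =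
      (p : ℚ_[p]) ^ b / (b.factorial : ℚ_[p]) := by
    simp [coeff_exp, div_eq_mul_inv]
  have hle := norm_coeff_le_one_of_pow_eq_expand_mul p hp.ne_zero
    (by rw [coeff_map, coeff_zero_artinHasse, map_one]) (by simp [hU])
    (fun b hb => hU b ▸ norm_pow_div_factorial_le p hb) hfun k
  rwa [coeff_map, eq_ratCast] at hle

end ArtinHasse

section FrobeniusMatrix

theorem alphaInt_eq_emod (p n : ℕ) (i j : ℤ) : alphaInt p n i j = (i - p * j) % n := by
  have hceil : ⌈((p : ℚ) * j - i) / n⌉ = -((i - p * j) / n) := by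
    have hneg : ((p : ℚ) * j - i) / n = -(((i - p * j : ℤ) : ℚ) / n) := by push_cast; ring
    rw [hneg, Int.ceil_neg, Rat.floor_intCast_div_natCast]
  rw [alphaInt, hceil, Int.emod_def]
  ring

variable {K : Type*} [NormedField K] {p n : ℕ} {σ : K ≃+* K} {π t : K}

/-- The properties of `γ̃` (here `π`), `t̄` and `σ` from which the Frobenius matrix and its leading
terms are computed. -/
structure IsFrobeniusDatum (p n : ℕ) (σ : K ≃+* K) (π t : K) : Prop where
  isTwistFor : IsTwistFor p n σ π t
  two_le_p : 2 ≤ p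
  norm_n : ‖(n : K)‖ = 1
  norm_artinHasse (k : ℕ) : ‖((PowerSeries.coeff k (artinHasse p) : ℚ) : K)‖ ≤ 1
  norm_map (x : K) : ‖σ x‖ = ‖x‖
  map_pi : σ π = π

namespace IsFrobeniusDatum

theorem ne_zero (h : IsFrobeniusDatum p n σ π t) : π ≠ 0 := h.isTwistFor.ne_zero

theorem norm_pos (h : IsFrobeniusDatum p n σ π t) : 0 < ‖π‖ := norm_pos_iff.2 h.ne_zero

theorem norm_lt_one (h : IsFrobeniusDatum p n σ π t) : ‖π‖ < 1 := h.isTwistFor.norm_lt_one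

theorem norm_t (h : IsFrobeniusDatum p n σ π t) : ‖t‖ = 1 := h.isTwistFor.norm_tau 0

theorem norm_symm (h : IsFrobeniusDatum p n σ π t) (x : K) : ‖σ.symm x‖ = ‖x‖ := by
  rw [← h.norm_map, σ.apply_symm_apply]

theorem symm_pi (h : IsFrobeniusDatum p n σ π t) : σ.symm π = π := by
  rw [σ.symm_apply_eq, h.map_pi]

end IsFrobeniusDatum

section FrobeniusSeries

/-- The contribution `t̄^k a_k a_l a_m` of a triple `(k, l, m)` to a coefficient of `F_t`. -/
noncomputable def frobTerm (p n : ℕ) (π t : K) (k l m : ℕ) : K :=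
  t ^ k * (splitCoeff p (π ^ n) k * splitCoeff p (π ^ n) l * splitCoeff p (π ^ n) m)

/-- The triples `(k, l, m)` that contribute to the coefficient of `x ^ w.1 y ^ w.2` in `F_t`. -/
abbrev FrobIndex (n : ℕ) (w : ℤ × ℤ) : Type :=
  {s : ℕ × ℕ × ℕ // (n : ℤ) * s.2.1 - s.1 = w.1 ∧ (s.2.2 : ℤ) - s.1 = w.2}

theorem frobSeries_eq_tsum (p n : ℕ) (π t : K) (w : ℤ × ℤ) :
    frobSeries p n (π ^ n) t w =
      ∑' s : FrobIndex n w, frobTerm p n π t s.1.1 s.1.2.1 s.1.2.2 := rfl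

theorem frobIndex_injective (hn : 1 ≤ n) (w : ℤ × ℤ) :
    Function.Injective fun s : FrobIndex n w => s.1.1 := by
  rintro ⟨⟨k, l, m⟩, hl, hm⟩ ⟨⟨k', l', m'⟩, hl', hm'⟩ (rfl : k = k')
  dsimp only at hl hm hl' hm'
  have hll : (l : ℤ) = l' := mul_left_cancel₀ (by omega : (n : ℤ) ≠ 0) (by linarith)
  obtain rfl : l = l' := by exact_mod_cast hll
  obtain rfl : m = m' := by omega
  rfl

theorem nWeight_le_of_frobIndex {w : ℤ × ℤ} (s : FrobIndex n w) :
    nWeight n w ≤ n * (s.1.1 + s.1.2.1 + s.1.2.2) := by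
  obtain ⟨⟨k, l, m⟩, hl, hm⟩ := s
  dsimp only at hl hm ⊢
  have hw : w = (k : ℤ) • (-1, -1) + ((l : ℤ) • ((n : ℤ), 0) + (m : ℤ) • (0, 1)) := by
    ext <;> simp only [← hl, ← hm, Prod.smul_mk, Prod.mk_add_mk, smul_eq_mul] <;> ring
  calc nWeight n w ≤ nWeight n ((k : ℤ) • (-1, -1)) +
        (nWeight n ((l : ℤ) • ((n : ℤ), 0)) + nWeight n ((m : ℤ) • (0, 1))) := by
        rw [hw]
        exact (nWeight_add_le n _ _).trans (add_le_add_right (nWeight_add_le n _ _) _)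
    _ = n * (k + l + m) := by
        rw [nWeight_zsmul n k.cast_nonneg, nWeight_zsmul n l.cast_nonneg,
          nWeight_zsmul n m.cast_nonneg, nWeight_x, nWeight_y, nWeight_z]
        ring

theorem alpha1_epsTilde (i : ℕ) (w : ℤ × ℤ) :
    alpha1 p n σ (π ^ n) t (epsTilde n π i) w =
      σ.symm (frobSeries p n (π ^ n) t ((p : ℤ) • w - epsExp n i) * π ^ i) := by
  rw [alpha1, psi, mulSeries, tsum_eq_single (epsExp n i)]
  · rw [epsTilde, Pi.single_eq_same, nWeight_epsExp, zpow_natCast]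
    rfl
  · intro u hu
    rw [epsTilde, Pi.single_eq_of_ne hu, mul_zero]

theorem norm_splitCoeff_le (h : IsFrobeniusDatum p n σ π t) (k : ℕ) :
    ‖splitCoeff p (π ^ n) k‖ ≤ ‖π‖ ^ (n * k) := by
  rw [splitCoeff, norm_mul, norm_pow, norm_pow, ← pow_mul]
  exact mul_le_of_le_one_left (by positivity) (h.norm_artinHasse k)

theorem norm_frobTerm_le (h : IsFrobeniusDatum p n σ π t) (k l m : ℕ) :
    ‖frobTerm p n π t k l m‖ ≤ ‖π‖ ^ (n * (k + l + m)) := by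
  rw [frobTerm, norm_mul, norm_mul, norm_mul, norm_pow, h.norm_t, one_pow, one_mul, mul_add,
    mul_add, pow_add, pow_add]
  gcongr <;> exact norm_splitCoeff_le h _

theorem summable_frobTerm [CompleteSpace K] (h : IsFrobeniusDatum p n σ π t) (w : ℤ × ℤ) :
    Summable fun s : FrobIndex n w => frobTerm p n π t s.1.1 s.1.2.1 s.1.2.2 := by
  have hn := h.isTwistFor.one_le_n
  refine Summable.of_norm_bounded ((summable_geometric_of_lt_one (norm_nonneg π)
    h.norm_lt_one).comp_injective (frobIndex_injective hn w)) fun s => ?_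
  refine (norm_frobTerm_le h _ _ _).trans
    (pow_le_pow_of_le_one (norm_nonneg _) h.norm_lt_one.le ?_)
  calc s.1.1 ≤ s.1.1 + s.1.2.1 + s.1.2.2 := by omega
    _ ≤ n * (s.1.1 + s.1.2.1 + s.1.2.2) := Nat.le_mul_of_pos_left _ hn

variable [IsUltrametricDist K]

theorem norm_frobSeries_le (h : IsFrobeniusDatum p n σ π t) (w : ℤ × ℤ) :
    ‖frobSeries p n (π ^ n) t w‖ ≤ ‖π‖ ^ nWeight n w := by
  rw [frobSeries_eq_tsum]
  refine IsUltrametricDist.norm_tsum_le_of_forall_le_of_nonneg (by positivity) fun s => ?_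
  refine (norm_frobTerm_le h _ _ _).trans ?_
  rw [← zpow_natCast]
  exact zpow_le_zpow_right_of_le_one₀ h.norm_pos h.norm_lt_one.le
    (by exact_mod_cast nWeight_le_of_frobIndex s)

theorem norm_alpha1_le (h : IsFrobeniusDatum p n σ π t) (i : ℕ) (w : ℤ × ℤ) :
    ‖alpha1 p n σ (π ^ n) t (epsTilde n π i) w‖ ≤ ‖π‖ ^ (p * nWeight n w) := by
  rw [alpha1_epsTilde, h.norm_symm, norm_mul, norm_pow, ← zpow_natCast ‖π‖ i]
  calc _ ≤ ‖π‖ ^ nWeight n ((p : ℤ) • w - epsExp n i) * ‖π‖ ^ (i : ℤ) := by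
        gcongr; exact norm_frobSeries_le h _
    _ = ‖π‖ ^ (nWeight n ((p : ℤ) • w - epsExp n i) + i) := (zpow_add₀ h.norm_pos.ne' _ _).symm
    _ ≤ _ := by
        refine zpow_le_zpow_right_of_le_one₀ h.norm_pos h.norm_lt_one.le ?_
        have hadd := nWeight_add_le n ((p : ℤ) • w - epsExp n i) (epsExp n i)
        rwa [sub_add_cancel, nWeight_zsmul n p.cast_nonneg, nWeight_epsExp] at hadd

end FrobeniusSeries

section Overconvergence

theorem isEps_of_nWeight_lt {w : ℤ × ℤ} (hw : nWeight n w < n) : IsEps n w := by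
  have hd := depth_nonneg w
  have hu : 0 ≤ w.1 + depth w := by simp only [depth]; omega
  have hv : 0 ≤ w.2 + depth w := by simp only [depth]; omega
  have hsum : nWeight n w = (w.1 + depth w) + n * (w.2 + depth w + depth w) := by
    rw [nWeight_eq]; ring
  have hzero : w.2 + depth w + depth w < 1 :=
    lt_of_mul_lt_mul_left (by linarith : (n : ℤ) * (w.2 + depth w + depth w) < n * 1) n.cast_nonneg
  have hd₀ : depth w = 0 := by omega
  have hv₀ : w.2 = 0 := by omega
  rw [hd₀, hv₀] at hsum
  exact Or.inl ⟨hv₀, by omega, by omega⟩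

/-- The terms of weight less than `D`. -/
noncomputable def lowPart (n D : ℕ) (c : ℤ × ℤ → K) (w : ℤ × ℤ) : K :=
  if nWeight n w < D then c w else 0

theorem normalized_lowPart_epsExp (D : ℕ) (c : ℤ × ℤ → K) (j : ℕ) :
    normalized n π (lowPart n D c) (epsExp n j) =
      if j < D then normalized n π c (epsExp n j) else 0 := by
  simp only [normalized, lowPart, nWeight_epsExp, Nat.cast_lt, ite_div, zero_div]

variable {c : ℤ × ℤ → K} {D : ℕ}

theorem norm_inv_pow_smul_le (hp : 2 ≤ p) (h₀ : π ≠ 0) (h₁ : ‖π‖ < 1)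
    (hc : ∀ w, ‖c w‖ ≤ ‖π‖ ^ (p * nWeight n w)) {w : ℤ × ℤ} {J : ℕ} (hw : D + J ≤ nWeight n w) :
    ‖((π ^ ((p - 1) * D))⁻¹ • c) w‖ ≤ ‖π‖ ^ J * ‖π‖ ^ nWeight n w := by
  have hr : 0 < ‖π‖ := norm_pos_iff.2 h₀
  rw [Pi.smul_apply, smul_eq_mul, norm_mul, norm_inv, norm_pow, inv_mul_le_iff₀ (by positivity)]
  refine (hc w).trans ?_
  rw [← zpow_natCast, ← zpow_natCast, ← zpow_add₀ hr.ne', ← zpow_add₀ hr.ne']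
  refine zpow_le_zpow_right_of_le_one₀ hr h₁.le ?_
  have hmul : ((p : ℤ) - 1) * D + J ≤ (p - 1) * nWeight n w := by
    calc ((p : ℤ) - 1) * D + J ≤ (p - 1) * D + (p - 1) * J := by
          gcongr; exact le_mul_of_one_le_left J.cast_nonneg (by omega)
      _ = (p - 1) * (D + J) := by ring
      _ ≤ _ := by gcongr; omega
  push_cast [Nat.cast_sub (by omega : 1 ≤ p)]
  linarith

theorem exists_eq_pow_smul (hp : 2 ≤ p) (hn : 1 ≤ n) (h₀ : π ≠ 0) (h₁ : ‖π‖ < 1)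
    (hc : ∀ w, ‖c w‖ ≤ ‖π‖ ^ (p * nWeight n w)) (hD : ∀ w, nWeight n w < D → c w = 0) :
    ∃ c' ∈ C0 n π, c = π ^ ((p - 1) * D) • c' := by
  refine ⟨(π ^ ((p - 1) * D))⁻¹ • c, mem_C0_of_eventually h₀ (fun w => ?_) fun ε hε => ?_, ?_⟩
  · rcases lt_or_ge (nWeight n w) D with hw | hw
    · rw [Pi.smul_apply, hD w hw, smul_zero, norm_zero]
      positivity
    · simpa only [pow_zero, one_mul] using
        norm_inv_pow_smul_le (J := 0) hp h₀ h₁ hc (by simpa using hw)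
  · obtain ⟨J, hJ⟩ := exists_pow_lt_of_lt_one hε h₁
    filter_upwards [(finite_nWeight_le hn (D + J)).compl_mem_cofinite] with w hw
    rw [Set.mem_compl_iff, Set.mem_ofPred_eq, not_le] at hw
    refine (norm_inv_pow_smul_le hp h₀ h₁ hc hw.le).trans ?_
    gcongr
  · rw [smul_smul, mul_inv_cancel₀ (pow_ne_zero _ h₀), one_smul]

theorem mem_C0_of_overconvergent (h : IsFrobeniusDatum p n σ π t)
    (hc : ∀ w, ‖c w‖ ≤ ‖π‖ ^ (p * nWeight n w)) : c ∈ C0 n π := by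
  obtain ⟨c', hc', rfl⟩ := exists_eq_pow_smul (D := 0) h.two_le_p h.isTwistFor.one_le_n h.ne_zero
    h.norm_lt_one hc fun w hw => absurd (nWeight_nonneg n w) (by simpa using hw)
  rwa [mul_zero, pow_zero, one_smul]

variable [IsUltrametricDist K] [CompleteSpace K]

theorem Cohomologous.add_smul (h : IsTwistFor p n σ π t) {m : K} (hm : ‖m‖ ≤ 1)
    {β β' : ℤ × ℤ → K} (hβ : Cohomologous p n σ π t β β') (e : ℤ × ℤ → K) :
    Cohomologous p n σ π t (e + m • β) (e + m • β') := by
  obtain ⟨ζ, hζ, η, hη, rfl⟩ := hβ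
  refine ⟨m • ζ, smul_mem_C0 hm hζ, m • η, smul_mem_C0 hm hη, ?_⟩
  rw [Dx_eq_twistOp h (smul_mem_C0 hm hζ), Dy_eq_twistOp h (smul_mem_C0 hm hη), twistOp_smul,
    twistOp_smul, Dx_eq_twistOp h hζ, Dy_eq_twistOp h hη, smul_add, smul_add, add_assoc, add_assoc,
    add_assoc]

/-- The terms of weight at least `D` of a series that converges on a larger region are divisible by
`π ^ ((p - 1) D)`, and the terms of weight less than `D ≤ n` are already combinations of the
basis. -/
theorem norm_coeff_sub_normalized_le (h : IsFrobeniusDatum p n σ π t)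
    (hc : ∀ w, ‖c w‖ ≤ ‖π‖ ^ (p * nWeight n w)) {a : Fin (2 * n + 1) → K} (ha : ∀ j, ‖a j‖ ≤ 1)
    (hca : Cohomologous p n σ π t c (∑ j : Fin (2 * n + 1), a j • epsTilde n π (j : ℕ)))
    (hD : D ≤ n) (j : Fin (2 * n + 1)) :
    ‖a j - normalized n π (lowPart n D c) (epsExp n j)‖ ≤ ‖π‖ ^ ((p - 1) * D) := by
  have hn := h.isTwistFor.one_le_n
  have hm : ‖π ^ ((p - 1) * D)‖ ≤ 1 := by
    rw [norm_pow]; exact pow_le_one₀ (norm_nonneg _) h.norm_lt_one.le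
  have hlow (w : ℤ × ℤ) : ‖lowPart n D c w‖ ≤ ‖c w‖ := by
    rw [lowPart]; split_ifs <;> simp
  have hhigh (w : ℤ × ℤ) : ‖(c - lowPart n D c) w‖ ≤ ‖c w‖ := by
    rw [Pi.sub_apply, lowPart]; split_ifs <;> simp
  have hcC : c ∈ C0 n π := mem_C0_of_overconvergent h hc
  obtain ⟨c', hc', hcc'⟩ := exists_eq_pow_smul (D := D) h.two_le_p hn h.ne_zero h.norm_lt_one
    (fun w => (hhigh w).trans (hc w)) fun w hw => by rw [Pi.sub_apply, lowPart, if_pos hw, sub_self]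
  obtain ⟨a', ha', hca'⟩ := exists_cohomologous h.isTwistFor h.norm_n hc'
  let b (j : Fin (2 * n + 1)) : K := normalized n π (lowPart n D c) (epsExp n j)
  have hb : ∑ j : Fin (2 * n + 1), b j • epsTilde n π (j : ℕ) = lowPart n D c :=
    sum_normalized_smul_epsTilde h.ne_zero fun w hw =>
      if_neg fun hlt => hw (isEps_of_nWeight_lt (hlt.trans_le (by exact_mod_cast hD)))
  have hab : b + π ^ ((p - 1) * D) • a' = a := by
    refine coeff_eq_of_cohomologous h.isTwistFor h.norm_n (fun j => norm_add_le_of_norm_le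
      (norm_normalized_le_one h.ne_zero (mem_C0_of_norm_le h.ne_zero hcC hlow) _)
      (norm_mul_le_one hm (ha' j))) ha ?_ hca
    have hsum := hca'.add_smul h.isTwistFor hm (lowPart n D c)
    rw [← hcc', add_sub_cancel, ← hb, Finset.smul_sum, ← Finset.sum_add_distrib] at hsum
    simpa only [Pi.add_apply, Pi.smul_apply, _root_.add_smul, smul_assoc] using hsum
  rw [← hab, Pi.add_apply, add_sub_cancel_left, Pi.smul_apply, smul_eq_mul, norm_mul, norm_pow]
  exact mul_le_of_le_one_right (by positivity) (ha' j)

end Overconvergence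

section Entries

variable {k l : ℕ}

theorem two_mul_add_lt_of_ne {a b : ℕ} (hk : k < n) (hab : (n : ℤ) * b - a = n * l - k)
    (hne : (a, b) ≠ (k, l)) : 2 * k + l < 2 * a + b := by
  have hdiff : (n : ℤ) * (b - l) = a - k := by linarith
  rcases lt_trichotomy b l with hbl | rfl | hbl
  · have : (n : ℤ) * (b - l) ≤ n * (-1) := by gcongr; omega
    omega
  · rw [sub_self, mul_zero] at hdiff
    exact absurd (by rw [show a = k by omega]) hne
  · have : (n : ℤ) * 0 ≤ n * (b - l) := by gcongr; omega
    omega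

theorem map_symm_frobTerm [CharZero K] (h : IsFrobeniusDatum p n σ π t) (hk : k < p) (hl : l < p) :
    σ.symm (frobTerm p n π t k l k) =
      π ^ (n * (2 * k + l)) * (σ.symm t ^ k / ((k.factorial : K) ^ 2 * l.factorial)) := by
  have hk₀ : (k.factorial : K) ≠ 0 := mod_cast k.factorial_ne_zero
  have hl₀ : (l.factorial : K) ≠ 0 := mod_cast l.factorial_ne_zero
  simp only [frobTerm, splitCoeff, coeff_artinHasse_of_lt hk, coeff_artinHasse_of_lt hl, map_mul,
    map_pow, map_ratCast, h.symm_pi]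
  push_cast
  field_simp
  ring

variable [IsUltrametricDist K] [CompleteSpace K]

theorem norm_frobSeries_sub_frobTerm_le (h : IsFrobeniusDatum p n σ π t) (hk : k < n) :
    ‖frobSeries p n (π ^ n) t ((n : ℤ) * l - k, 0) - frobTerm p n π t k l k‖ ≤
      ‖π‖ ^ (n * (2 * k + l) + 1) := by
  let s₀ : FrobIndex n ((n : ℤ) * l - k, 0) := ⟨(k, l, k), rfl, sub_self _⟩
  rw [frobSeries_eq_tsum, (summable_frobTerm h _).tsum_eq_add_tsum_ite s₀, add_sub_cancel_left]
  refine IsUltrametricDist.norm_tsum_le_of_forall_le_of_nonneg (by positivity) ?_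
  rintro ⟨⟨a, b, c⟩, hb, hc⟩
  split_ifs with heq
  · rw [norm_zero]; positivity
  · refine (norm_frobTerm_le h _ _ _).trans
      (pow_le_pow_of_le_one (norm_nonneg _) h.norm_lt_one.le ?_)
    dsimp only at hb hc ⊢
    obtain rfl : c = a := by omega
    have hlt : 2 * k + l < 2 * c + b := two_mul_add_lt_of_ne hk hb fun hcb => heq <| by
      obtain ⟨rfl, rfl⟩ := Prod.mk.inj hcb; rfl
    calc n * (2 * k + l) + 1 ≤ n * (2 * k + l) + n := by omega
      _ = n * (2 * k + l + 1) := by ring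
      _ ≤ n * (c + b + c) := Nat.mul_le_mul_left n (by omega)

variable [CharZero K] {i j : ℕ}

theorem norm_normalized_alpha1_sub_le (h : IsFrobeniusDatum p n σ π t) (hp : n ≤ p) (hi : i < n)
    (hj : j < n) (hk : k < n) (hl : (n : ℤ) * l = p * j - i + k) :
    ‖normalized n π (alpha1 p n σ (π ^ n) t (epsTilde n π i)) (epsExp n j) -
      π ^ ((p - 1) * j + (2 * n + 1) * k) *
        (σ.symm t ^ k / ((k.factorial : K) ^ 2 * l.factorial))‖ ≤
      ‖π‖ ^ ((p - 1) * j + (2 * n + 1) * k + 1) := by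
  have hlp : l < p := by
    have hjn : (p : ℤ) * (j + 1) ≤ p * n := by gcongr; omega
    have hlt : (n : ℤ) * l < n * p := by linarith
    exact_mod_cast lt_of_mul_lt_mul_left hlt n.cast_nonneg
  have hexp : (p - 1) * j + (2 * n + 1) * k + j = n * (2 * k + l) + i := by
    zify [show 1 ≤ p by omega]
    linear_combination -hl
  have hpoint : (p : ℤ) • epsExp n j - epsExp n i = ((n : ℤ) * l - k, 0) := by
    rw [epsExp, epsExp, if_pos hj.le, if_pos hi.le]
    ext
    · simp only [Prod.smul_mk, smul_eq_mul, Prod.mk_sub_mk]; linarith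
    · simp
  have hpow : π ^ ((p - 1) * j + (2 * n + 1) * k) = π ^ (n * (2 * k + l)) * π ^ i / π ^ j := by
    rw [← pow_add, ← hexp, pow_add _ _ j, mul_div_cancel_right₀ _ (pow_ne_zero _ h.ne_zero)]
  have hdiff : σ.symm (frobSeries p n (π ^ n) t ((n : ℤ) * l - k, 0) * π ^ i) / π ^ j -
      π ^ ((p - 1) * j + (2 * n + 1) * k) *
        (σ.symm t ^ k / ((k.factorial : K) ^ 2 * l.factorial)) =
      σ.symm ((frobSeries p n (π ^ n) t ((n : ℤ) * l - k, 0) - frobTerm p n π t k l k) * π ^ i)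
        / π ^ j := by
    rw [sub_mul, map_sub, sub_div, map_mul σ.symm (frobTerm p n π t k l k),
      map_symm_frobTerm h (by omega) hlp, map_pow, h.symm_pi, hpow]
    ring
  rw [normalized, nWeight_epsExp, zpow_natCast, alpha1_epsTilde, hpoint, hdiff, norm_div,
    h.norm_symm, norm_mul, norm_pow, norm_pow, div_le_iff₀ (pow_pos h.norm_pos _)]
  calc _ ≤ ‖π‖ ^ (n * (2 * k + l) + 1) * ‖π‖ ^ i := by
        gcongr; exact norm_frobSeries_sub_frobTerm_le h hk
    _ = ‖π‖ ^ ((p - 1) * j + (2 * n + 1) * k + 1) * ‖π‖ ^ j := by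
        rw [← pow_add, ← pow_add]
        congr 1
        omega

end Entries

section Matrix

variable [IsUltrametricDist K] [CompleteSpace K]
  {A : Matrix (Fin (2 * n + 1)) (Fin (2 * n + 1)) K}

theorem norm_frobenius_entry_sub_le [CharZero K] (h : IsFrobeniusDatum p n σ π t)
    (hp : (2 * n + 1) * (n - 1) + 1 < p) (hA : IsFrobeniusMatrix p n σ π t A)
    {i j : Fin (2 * n + 1)} (hi : (i : ℕ) < n) (hj : (j : ℕ) < n) {k l : ℕ} (hk : k < n)
    (hl : (n : ℤ) * l = p * j - i + k) :
    ‖A i j - π ^ ((p - 1) * (j : ℕ) + (2 * n + 1) * k) *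
      (σ.symm t ^ k / ((k.factorial : K) ^ 2 * l.factorial))‖ ≤
      ‖π‖ ^ ((p - 1) * (j : ℕ) + (2 * n + 1) * k + 1) := by
  have hkn : (2 * n + 1) * k ≤ (2 * n + 1) * (n - 1) := by gcongr; omega
  have hnp : n ≤ p := by
    have : 1 * (n - 1) ≤ (2 * n + 1) * (n - 1) := by gcongr; omega
    omega
  have hlow := norm_coeff_sub_normalized_le h (norm_alpha1_le h i) (hA.1 i) (hA.2 i)
    (D := j + 1) hj j
  rw [normalized_lowPart_epsExp, if_pos (Nat.lt_succ_self _)] at hlow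
  rw [← sub_add_sub_cancel]
  refine norm_add_le_of_norm_le (hlow.trans ?_) (norm_normalized_alpha1_sub_le h hnp hi hj hk hl)
  refine pow_le_pow_of_le_one h.norm_pos.le h.norm_lt_one.le ?_
  rw [mul_add]
  omega

theorem norm_frobenius_entry_le (h : IsFrobeniusDatum p n σ π t)
    (hA : IsFrobeniusMatrix p n σ π t A) (i j : Fin (2 * n + 1)) :
    ‖A i j‖ ≤ ‖π‖ ^ ((p - 1) * min (j : ℕ) n) := by
  have hlow := norm_coeff_sub_normalized_le h (norm_alpha1_le h i) (hA.1 i) (hA.2 i)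
    (min_le_right (j : ℕ) n) j
  rwa [normalized_lowPart_epsExp, if_neg (by omega), sub_zero] at hlow

theorem existsUnique_frobeniusMatrix (h : IsFrobeniusDatum p n σ π t) :
    ∃! A : Matrix (Fin (2 * n + 1)) (Fin (2 * n + 1)) K, IsFrobeniusMatrix p n σ π t A := by
  have hmem (i : Fin (2 * n + 1)) : alpha1 p n σ (π ^ n) t (epsTilde n π (i : ℕ)) ∈ C0 n π :=
    mem_C0_of_overconvergent h (norm_alpha1_le h i)
  choose a ha hca using fun i => exists_cohomologous h.isTwistFor h.norm_n (hmem i)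
  refine ⟨Matrix.of a, ⟨ha, hca⟩, fun B hB => ?_⟩
  funext i
  exact coeff_eq_of_cohomologous h.isTwistFor h.norm_n (hB.1 i) (ha i) (hB.2 i) (hca i)

end Matrix

end FrobeniusMatrix

section Carries

open Finset

variable {m : ℕ}

theorem vandermondeLike_natCast (x : Fin m → ℕ) (i j : Fin m) :
    vandermondeLike m (fun i => (x i : ℤ)) i j = ((x i).descFactorial j : ℤ) ^ 2 := by
  rw [vandermondeLike, Matrix.of_apply, Finset.prod_pow]
  congr 1
  induction (j : ℕ) with
  | zero => simp
  | succ k ih =>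
    rw [Finset.prod_range_succ, ih, Nat.descFactorial_succ, mul_comm]
    rcases le_or_gt k (x i) with h | h
    · push_cast [Nat.cast_sub h]; ring
    · rw [Nat.descFactorial_of_lt h]; simp

/-- The permutations `δ` for which every sum `r (δ i) + i` has the largest quotient by `n` that
`r (δ i) + i'` with `i' < m` can have. These are the ones that minimize `∑ (r (δ i) + i) % n`. -/
def CarriesMaximally (n : ℕ) (r : Fin m → ℕ) (δ : Equiv.Perm (Fin m)) : Prop :=
  ∀ i, (r (δ i) + i) / n = (r (δ i) + (m - 1)) / n

theorem sum_mod_add_mul_sum_div (n : ℕ) (r : Fin m → ℕ) (δ : Equiv.Perm (Fin m)) :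
    ∑ i, (r (δ i) + i) % n + n * ∑ i, (r (δ i) + i) / n = ∑ j, r j + ∑ i : Fin m, (i : ℕ) := by
  rw [← Equiv.sum_comp δ r, Finset.mul_sum, ← Finset.sum_add_distrib, ← Finset.sum_add_distrib]
  exact Finset.sum_congr rfl fun i _ => Nat.mod_add_div _ _

theorem div_le_div_last (n : ℕ) (r : Fin m → ℕ) (δ : Equiv.Perm (Fin m)) (i : Fin m) :
    (r (δ i) + i) / n ≤ (r (δ i) + (m - 1)) / n :=
  Nat.div_le_div_right (by omega)

theorem sum_div_le (n : ℕ) (r : Fin m → ℕ) (δ : Equiv.Perm (Fin m)) :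
    ∑ i, (r (δ i) + i) / n ≤ ∑ j, (r j + (m - 1)) / n := by
  rw [← Equiv.sum_comp δ fun j => (r j + (m - 1)) / n]
  exact Finset.sum_le_sum fun i _ => div_le_div_last n r δ i

theorem carriesMaximally_iff_sum_div_eq {n : ℕ} {r : Fin m → ℕ} {δ : Equiv.Perm (Fin m)} :
    CarriesMaximally n r δ ↔ ∑ i, (r (δ i) + i) / n = ∑ j, (r j + (m - 1)) / n := by
  rw [← Equiv.sum_comp δ fun j => (r j + (m - 1)) / n,
    Finset.sum_eq_sum_iff_of_le fun i _ => div_le_div_last n r δ i]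
  simp only [CarriesMaximally, Finset.mem_univ, true_imp_iff]

theorem sum_mod_minimal_iff {n : ℕ} (hn : 0 < n) {r : Fin m → ℕ}
    (hex : ∃ δ, CarriesMaximally n r δ) (δ : Equiv.Perm (Fin m)) :
    (∀ δ' : Equiv.Perm (Fin m), ∑ i, (r (δ i) + i) % n ≤ ∑ i, (r (δ' i) + i) % n) ↔
      CarriesMaximally n r δ := by
  obtain ⟨δ₀, h₀⟩ := hex
  rw [carriesMaximally_iff_sum_div_eq] at h₀ ⊢
  have hδ := sum_mod_add_mul_sum_div n r δ
  constructor
  · intro hmin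
    refine (sum_div_le n r δ).antisymm (Nat.le_of_mul_le_mul_left ?_ hn)
    have hδ₀ := sum_mod_add_mul_sum_div n r δ₀
    rw [h₀] at hδ₀
    have := hmin δ₀
    omega
  · intro hmax δ'
    have hδ' := sum_mod_add_mul_sum_div n r δ'
    have hle := Nat.mul_le_mul_left n (sum_div_le n r δ')
    rw [hmax] at hδ
    omega

/-- The coefficient `1 / (k!² l!)` of the leading term of a Frobenius matrix entry, where
`k = (r + i) % n` and `l = L - (r + i) / n`. -/
def leadCoeff (n r L i : ℕ) : ℚ :=
  1 / ((((r + i) % n).factorial : ℚ) ^ 2 * ((L - (r + i) / n).factorial : ℚ))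

theorem leadCoeff_eq_descFactorial_mul {n r i M : ℕ} (L : ℕ) (hi : i ≤ M)
    (h : (r + i) / n = (r + M) / n) :
    leadCoeff n r L i = (((r + M) % n).descFactorial (M - i) : ℚ) ^ 2 * leadCoeff n r L M := by
  have hmod : (r + M) % n - (M - i) = (r + i) % n ∧ M - i ≤ (r + M) % n := by
    have hi' := Nat.mod_add_div (r + i) n
    have hM' := Nat.mod_add_div (r + M) n
    rw [h] at hi'
    omega
  have hfac := Nat.factorial_mul_descFactorial hmod.2
  rw [hmod.1] at hfac
  have hne : (((r + M) % n).descFactorial (M - i) : ℚ) ≠ 0 := by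
    exact_mod_cast (Nat.descFactorial_pos.2 hmod.2).ne'
  rw [leadCoeff, leadCoeff, h, ← hfac]
  push_cast
  field_simp

theorem descFactorial_mod_eq_zero {n r i M : ℕ} (hn : 0 < n)
    (h : (r + i) / n < (r + M) / n) : ((r + M) % n).descFactorial (M - i) = 0 := by
  refine Nat.descFactorial_of_lt ?_
  have hi := Nat.lt_mul_of_div_lt h hn
  have hM := Nat.mod_add_div (r + M) n
  rw [mul_comm] at hM
  omega

theorem mod_add_injective {n : ℕ} {r : Fin m → ℕ} (hr : Function.Injective fun j => r j % n)
    (M : ℕ) : Function.Injective fun j => (r j + M) % n := fun _ _ hab =>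
  hr (Nat.ModEq.add_right_cancel' M hab)

/-- The matrix whose determinant collects the leading terms of the permutations that carry
maximally. -/
def leadVandermonde (n : ℕ) (r : Fin m → ℕ) : Matrix (Fin m) (Fin m) ℤ :=
  vandermondeLike m fun j => ((r j + (m - 1)) % n : ℕ)

open Classical in
theorem prod_leadVandermonde_rev_mul {n : ℕ} (hn : 0 < n) (r L : Fin m → ℕ)
    (δ : Equiv.Perm (Fin m)) :
    (∏ i, (leadVandermonde n r (δ i) i.rev : ℚ)) * ∏ j, leadCoeff n (r j) (L j) (m - 1) =
      if CarriesMaximally n r δ then ∏ i : Fin m, leadCoeff n (r (δ i)) (L (δ i)) i else 0 := by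
  have hentry (i : Fin m) : (leadVandermonde n r (δ i) i.rev : ℚ) =
      (((r (δ i) + (m - 1)) % n).descFactorial (m - 1 - i) : ℚ) ^ 2 := by
    rw [leadVandermonde, vandermondeLike_natCast, Fin.val_rev, Nat.sub_add_eq, Nat.sub_right_comm]
    push_cast
    rfl
  rw [← Equiv.prod_comp δ fun j => leadCoeff n (r j) (L j) (m - 1), ← Finset.prod_mul_distrib]
  split_ifs with hδ
  · refine Finset.prod_congr rfl fun i _ => ?_
    rw [hentry, leadCoeff_eq_descFactorial_mul (L (δ i)) (by omega) (hδ i)]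
  · obtain ⟨i, hi⟩ := not_forall.1 hδ
    refine Finset.prod_eq_zero (Finset.mem_univ i) ?_
    rw [hentry, descFactorial_mod_eq_zero hn ((div_le_div_last n r δ i).lt_of_ne hi)]
    simp

open Classical in
theorem sum_sign_mul_prod_leadCoeff {n : ℕ} (hn : 0 < n) (r L : Fin m → ℕ) :
    ∑ δ with CarriesMaximally n r δ,
        (Equiv.Perm.sign δ : ℚ) * ∏ i : Fin m, leadCoeff n (r (δ i)) (L (δ i)) i =
      (Equiv.Perm.sign (Fin.revPerm : Equiv.Perm (Fin m)) : ℚ) * (leadVandermonde n r).det *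
        ∏ j, leadCoeff n (r j) (L j) (m - 1) := by
  have hdet : (Equiv.Perm.sign (Fin.revPerm : Equiv.Perm (Fin m)) : ℚ) * (leadVandermonde n r).det =
      ((((leadVandermonde n r).submatrix id Fin.revPerm).det : ℤ) : ℚ) := by
    rw [Matrix.det_permute']
    push_cast
    rfl
  rw [hdet, Matrix.det_apply', Int.cast_sum, Finset.sum_mul, Finset.sum_filter]
  refine Finset.sum_congr rfl fun δ _ => ?_
  push_cast
  rw [mul_assoc]
  simp only [Matrix.submatrix_apply, id, Fin.revPerm_apply, prod_leadVandermonde_rev_mul hn]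
  rw [mul_ite, mul_zero]

theorem sum_min_lt {N n m : ℕ} (hmn : m ≤ n) (S S₀ : Finset (Fin N)) (hS : #S = #S₀)
    (h₀ : ∀ j, j ∈ S₀ ↔ (j : ℕ) < m) (hne : S ≠ S₀) :
    ∑ j ∈ S₀, (j : ℕ) < ∑ j ∈ S, min (j : ℕ) n := by
  have hcard : #(S \ S₀) = #(S₀ \ S) := Finset.card_sdiff_comm hS
  have hpos : 0 < #(S \ S₀) := by
    rw [Finset.card_pos, Finset.sdiff_nonempty]
    exact fun h => hne (Finset.eq_of_subset_of_card_le h hS.ge)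
  have hinter : ∑ j ∈ S ∩ S₀, min (j : ℕ) n = ∑ j ∈ S₀ ∩ S, (j : ℕ) := by
    rw [Finset.inter_comm]
    refine Finset.sum_congr rfl fun j hj => ?_
    have := (h₀ j).1 (Finset.mem_inter.1 hj).1
    omega
  have hnew : #(S \ S₀) * m ≤ ∑ j ∈ S \ S₀, min (j : ℕ) n := by
    rw [← smul_eq_mul]
    refine Finset.card_nsmul_le_sum _ _ _ fun j hj => ?_
    have := mt (h₀ j).2 (Finset.mem_sdiff.1 hj).2
    omega
  have hold : ∑ j ∈ S₀ \ S, (j : ℕ) < #(S₀ \ S) * m := by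
    rw [← smul_eq_mul, ← Finset.sum_const]
    refine Finset.sum_lt_sum_of_nonempty ?_ fun j hj => (h₀ j).1 (Finset.mem_sdiff.1 hj).1
    exact Finset.card_pos.1 (hcard ▸ hpos)
  have hsum := Finset.sum_inter_add_sum_sdiff S S₀ fun j : Fin N => min (j : ℕ) n
  have hsum₀ := Finset.sum_inter_add_sum_sdiff S₀ S fun j : Fin N => (j : ℕ)
  rw [hcard] at hnew
  omega

end Carries

section UltrametricDeterminant

variable {K : Type*} [NormedField K]

theorem norm_units_intCast (u : ℤˣ) : ‖((u : ℤ) : K)‖ = 1 := by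
  rcases Int.units_eq_one_or u with rfl | rfl <;> simp

theorem norm_prod_le_pow_sum {ι : Type*} (s : Finset ι) {f : ι → K} {r : ℝ} {e : ι → ℕ}
    (h : ∀ i ∈ s, ‖f i‖ ≤ r ^ e i) : ‖∏ i ∈ s, f i‖ ≤ r ^ ∑ i ∈ s, e i := by
  rw [norm_prod, ← Finset.prod_pow_eq_pow_sum]
  exact Finset.prod_le_prod (fun _ _ => norm_nonneg _) h

variable [IsUltrametricDist K]

theorem norm_eq_of_norm_sub_lt {x y : K} (h : ‖x - y‖ < ‖y‖) : ‖x‖ = ‖y‖ := by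
  have := IsUltrametricDist.norm_eq_of_add_norm_lt_max (x := x) (y := -y)
    (by rw [← sub_eq_add_neg, norm_neg]; exact lt_max_of_lt_right h)
  rwa [norm_neg] at this

theorem norm_le_pow_of_norm_sub_le {x π u : K} {e : ℕ} (hπ : ‖π‖ ≤ 1) (hu : ‖u‖ ≤ 1)
    (h : ‖x - π ^ e * u‖ ≤ ‖π‖ ^ (e + 1)) : ‖x‖ ≤ ‖π‖ ^ e := by
  rw [← sub_add_cancel x (π ^ e * u)]
  refine norm_add_le_of_norm_le (h.trans (pow_le_pow_of_le_one (norm_nonneg _) hπ e.le_succ)) ?_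
  rw [norm_mul, norm_pow]
  exact mul_le_of_le_one_right (by positivity) hu

theorem norm_prod_sub_le {ι : Type*} (s : Finset ι) {f u : ι → K} {π : K} {e : ι → ℕ}
    (hπ : ‖π‖ ≤ 1) (hu : ∀ i, ‖u i‖ ≤ 1) (h : ∀ i, ‖f i - π ^ e i * u i‖ ≤ ‖π‖ ^ (e i + 1)) :
    ‖∏ i ∈ s, f i - π ^ (∑ i ∈ s, e i) * ∏ i ∈ s, u i‖ ≤ ‖π‖ ^ (∑ i ∈ s, e i + 1) := by
  classical
  induction s using Finset.induction_on with
  | empty => simp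
  | insert a s ha ih =>
    rw [Finset.prod_insert ha, Finset.prod_insert ha, Finset.sum_insert ha,
      show f a * ∏ i ∈ s, f i - π ^ (e a + ∑ i ∈ s, e i) * (u a * ∏ i ∈ s, u i) =
        f a * (∏ i ∈ s, f i - π ^ (∑ i ∈ s, e i) * ∏ i ∈ s, u i) +
          (f a - π ^ e a * u a) * (π ^ (∑ i ∈ s, e i) * ∏ i ∈ s, u i) by ring]
    refine norm_add_le_of_norm_le ?_ ?_
    · rw [norm_mul, add_assoc, pow_add]
      gcongr
      exact norm_le_pow_of_norm_sub_le hπ (hu a) (h a)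
    · rw [norm_mul, norm_mul, norm_pow, add_right_comm, pow_add]
      gcongr
      · exact h a
      · rw [norm_prod]
        exact mul_le_of_le_one_right (by positivity)
          (Finset.prod_le_one (fun _ _ => norm_nonneg _) fun i _ => hu i)

theorem norm_det_le_of_columns {ι : Type*} [Fintype ι] [DecidableEq ι] (M : Matrix ι ι K) {r : ℝ}
    (hr : 0 ≤ r) (e : ι → ℕ) (h : ∀ i j, ‖M i j‖ ≤ r ^ e j) : ‖M.det‖ ≤ r ^ ∑ j, e j := by
  rw [Matrix.det_apply']
  refine IsUltrametricDist.norm_sum_le_of_forall_le_of_nonneg (by positivity) fun δ _ => ?_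
  rw [norm_mul, norm_units_intCast, one_mul]
  exact norm_prod_le_pow_sum _ fun i _ => h _ _

theorem norm_det_eq_of_leading_terms {ι : Type*} [Fintype ι] [DecidableEq ι] {M U : Matrix ι ι K}
    {π : K} (h0 : π ≠ 0) (h1 : ‖π‖ < 1) {e : ι → ι → ℕ} {T : ℕ} (hU : ∀ i j, ‖U i j‖ ≤ 1)
    (hM : ∀ i j, ‖M i j - π ^ e i j * U i j‖ ≤ ‖π‖ ^ (e i j + 1))
    (hT : ∀ δ : Equiv.Perm ι, T ≤ ∑ i, e i (δ i))
    (hlead : ‖∑ δ : Equiv.Perm ι with ∑ i, e i (δ i) = T,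
      (Equiv.Perm.sign δ : K) * ∏ i, U i (δ i)‖ = 1) :
    ‖M.det‖ = ‖π‖ ^ T := by
  have hpos : 0 < ‖π‖ := norm_pos_iff.2 h0
  set S := ∑ δ : Equiv.Perm ι with ∑ i, e i (δ i) = T, (Equiv.Perm.sign δ : K) * ∏ i, U i (δ i)
    with hS
  have hS_norm : ‖π ^ T * S‖ = ‖π‖ ^ T := by rw [norm_mul, norm_pow, hlead, mul_one]
  have hsub : ‖M.det - π ^ T * S‖ ≤ ‖π‖ ^ (T + 1) := by
    rw [← Matrix.det_transpose, Matrix.det_apply', hS, Finset.sum_filter, Finset.mul_sum,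
      ← Finset.sum_sub_distrib]
    refine IsUltrametricDist.norm_sum_le_of_forall_le_of_nonneg (by positivity) fun δ _ => ?_
    simp only [Matrix.transpose_apply]
    split_ifs with hδ
    · rw [mul_left_comm, ← mul_sub, norm_mul, norm_units_intCast, one_mul, ← hδ]
      exact norm_prod_sub_le _ h1.le (fun i => hU _ _) fun i => hM _ _
    · rw [mul_zero, sub_zero, norm_mul, norm_units_intCast, one_mul]
      refine (norm_prod_le_pow_sum _ fun i _ =>
        norm_le_pow_of_norm_sub_le h1.le (hU i (δ i)) (hM i (δ i))).trans ?_
      exact pow_le_pow_of_le_one hpos.le h1.le ((hT δ).lt_of_ne' hδ)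
  rw [← hS_norm]
  refine norm_eq_of_norm_sub_lt (hsub.trans_lt ?_)
  rw [hS_norm]
  exact pow_lt_pow_right_of_lt_one₀ hpos h1 T.lt_succ_self

open Polynomial in
theorem norm_coeff_det_eq_of_dominant_minor {ι : Type*} [Fintype ι] [DecidableEq ι]
    (M : Matrix ι ι K) {S₀ : Finset ι} {T : ℝ}
    (h₀ : ‖(M.submatrix (Subtype.val : S₀ → ι) Subtype.val).det‖ = T) {ρ : ℝ} (hρ : 0 ≤ ρ)
    (hρT : ρ < T) (h : ∀ S : Finset ι, S.card = S₀.card → S ≠ S₀ →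
      ‖(M.submatrix (Subtype.val : S → ι) Subtype.val).det‖ ≤ ρ) :
    ‖(1 - (X : K[X]) • M.map C).det.coeff S₀.card‖ = T := by
  have hneg : 1 - (X : K[X]) • M.map C = 1 + (X : K[X]) • (-M).map C := by
    rw [Matrix.map_neg _ (map_neg C), smul_neg, sub_eq_add_neg]
  have hminor (S : Finset ι) : ‖((-M).submatrix (Subtype.val : S → ι) Subtype.val).det‖ =
      ‖(M.submatrix (Subtype.val : S → ι) Subtype.val).det‖ := by
    rw [Matrix.submatrix_neg, Pi.neg_apply, Pi.neg_apply, Matrix.det_neg, norm_mul, norm_pow,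
      norm_neg, norm_one, one_pow, one_mul]
  rw [hneg, Matrix.coeff_det_one_add_X_smul_eq_sum_minors, ← Finset.add_sum_erase _ _
    (Finset.mem_powersetCard.2 ⟨Finset.subset_univ S₀, rfl⟩), ← h₀, ← hminor S₀]
  refine norm_eq_of_norm_sub_lt ?_
  rw [add_sub_cancel_left, hminor, h₀]
  refine (IsUltrametricDist.norm_sum_le_of_forall_le_of_nonneg hρ fun S hS => ?_).trans_lt hρT
  rw [hminor]
  exact h S (Finset.mem_powersetCard.1 (Finset.mem_of_mem_erase hS)).2 (Finset.ne_of_mem_erase hS)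

end UltrametricDeterminant

section LeadingMinor

variable {p n m : ℕ}

/-- A natural number congruent to `-p j` modulo `n`. -/
def negMul (p n j : ℕ) : ℕ := (n - 1) * (p * j)

theorem negMul_add (hn : 1 ≤ n) (j : ℕ) : negMul p n j + p * j = n * (p * j) := by
  obtain ⟨k, rfl⟩ := Nat.exists_eq_add_of_le' hn
  rw [negMul, Nat.add_sub_cancel]
  ring

theorem alphaInt_natCast (hn : 1 ≤ n) (i j : ℕ) :
    alphaInt p n i j = ((negMul p n j + i) % n : ℕ) := by
  have h : (negMul p n j : ℤ) + p * j = n * (p * j) := by exact_mod_cast negMul_add hn j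
  rw [alphaInt_eq_emod, Int.natCast_mod, Nat.cast_add,
    show (negMul p n j : ℤ) + i = i - p * j + n * (p * j) by linarith, Int.add_mul_emod_self_left]

theorem alphaSum_eq_natCast (hn : 1 ≤ n) (δ : Equiv.Perm (Fin m)) :
    alphaSum p n m δ = (∑ i : Fin m, (negMul p n (δ i) + i) % n : ℕ) := by
  rw [alphaSum, Nat.cast_sum]
  exact Finset.sum_congr rfl fun i _ => alphaInt_natCast hn _ _

theorem toNat_alphaSum_le (hmn : m ≤ n) (δ : Equiv.Perm (Fin m)) :
    (alphaSum p n m δ).toNat ≤ n * (n - 1) := by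
  rcases Nat.eq_zero_or_pos n with rfl | hn
  · obtain rfl := Nat.le_zero.1 hmn
    simp [alphaSum]
  rw [alphaSum_eq_natCast hn, Int.toNat_natCast]
  refine (Finset.sum_le_card_nsmul _ _ (n - 1) fun i _ => ?_).trans ?_
  · exact Nat.le_sub_one_of_lt (Nat.mod_lt _ hn)
  · rw [Finset.card_fin, smul_eq_mul]
    gcongr

theorem negMul_mod_injective (hpn : Nat.Coprime p n) (hmn : m ≤ n) :
    Function.Injective fun j : Fin m => negMul p n j % n := by
  intro i j (hij : negMul p n i ≡ negMul p n j [MOD n])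
  have hn : 1 ≤ n := i.pos.trans_le hmn
  have hi : (negMul p n i : ℤ) + p * i = n * (p * i) := by exact_mod_cast negMul_add hn i
  have hj : (negMul p n j : ℤ) + p * j = n * (p * j) := by exact_mod_cast negMul_add hn j
  have hdvd : (n : ℤ) ∣ p * (j - i) := by
    rw [show (p : ℤ) * (j - i) = n * (p * j - p * i) - (negMul p n j - negMul p n i) by linarith]
    exact (dvd_mul_right _ _).sub (Nat.modEq_iff_dvd.1 hij)
  have hzero := Int.eq_zero_of_abs_lt_dvd
    ((Nat.isCoprime_iff_coprime.2 hpn.symm).dvd_of_dvd_mul_left hdvd)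
    (abs_lt.2 ⟨by omega, by omega⟩)
  omega

theorem mul_sub_div_negMul {i : ℕ} (hi : i < n) (j : ℕ) :
    (n : ℤ) * (p * j - (negMul p n j + i) / n : ℕ) = p * j - i + ((negMul p n j + i) % n : ℕ) := by
  have hadd := negMul_add (p := p) (by omega : 1 ≤ n) j
  have hle : (negMul p n j + i) / n ≤ p * j := by
    rw [← Nat.lt_succ_iff, Nat.div_lt_iff_lt_mul (by omega), Nat.succ_mul, mul_comm (p * j)]
    omega
  have hmod : (((negMul p n j + i) % n : ℕ) : ℤ) + n * ((negMul p n j + i) / n : ℕ) =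
      negMul p n j + i := by exact_mod_cast Nat.mod_add_div _ _
  have hadd' : (negMul p n j : ℤ) + p * j = n * (p * j) := by exact_mod_cast hadd
  rw [Nat.cast_sub hle, Nat.cast_mul]
  linear_combination -hmod - hadd'

theorem sub_div_negMul_lt {i j : ℕ} (hi : i < n) (hj : j + 2 ≤ n) (hnp : n ≤ p) :
    p * j - (negMul p n j + i) / n < p := by
  have hmul := mul_sub_div_negMul (p := p) hi j
  have hmod : (negMul p n j + i) % n < n := Nat.mod_lt _ (by omega)
  have hle : (p : ℤ) * (j + 2) ≤ p * n := by gcongr; omega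
  zify at *
  exact lt_of_mul_lt_mul_left (by linarith : (n : ℤ) * _ < n * p) (by omega)

theorem mem_minPerms_iff (hn : 1 ≤ n)
    (hex : ∃ δ, CarriesMaximally n (fun j : Fin m => negMul p n j) δ)
    {δ : Equiv.Perm (Fin m)} :
    δ ∈ minPerms p n m ↔ CarriesMaximally n (fun j : Fin m => negMul p n j) δ := by
  rw [← sum_mod_minimal_iff hn hex, minPerms, Set.mem_ofPred_eq]
  simp only [alphaSum_eq_natCast hn, Nat.cast_le]

/-- The exponent of `γ̃` in the leading term of the entry `(i, j)` of the Frobenius matrix. -/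
def leadExp (p n i j : ℕ) : ℕ := (p - 1) * j + (2 * n + 1) * ((negMul p n j + i) % n)

theorem sum_leadExp (hn : 1 ≤ n) (δ : Equiv.Perm (Fin m)) :
    ∑ i : Fin m, leadExp p n i (δ i) =
      (p - 1) * ∑ i : Fin m, (i : ℕ) + (2 * n + 1) * (alphaSum p n m δ).toNat := by
  simp only [leadExp]
  rw [Finset.sum_add_distrib, ← Finset.mul_sum, ← Finset.mul_sum, alphaSum_eq_natCast hn,
    Int.toNat_natCast, Equiv.sum_comp δ fun j : Fin m => (j : ℕ)]

theorem sum_leadExp_le_iff (hn : 1 ≤ n) {δ δ' : Equiv.Perm (Fin m)} :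
    ∑ i : Fin m, leadExp p n i (δ i) ≤ ∑ i : Fin m, leadExp p n i (δ' i) ↔
      alphaSum p n m δ ≤ alphaSum p n m δ' := by
  rw [sum_leadExp hn, sum_leadExp hn, alphaSum_eq_natCast hn, alphaSum_eq_natCast hn,
    Int.toNat_natCast, Int.toNat_natCast, Nat.cast_le, Nat.add_le_add_iff_left,
    Nat.mul_le_mul_left_iff (Nat.succ_pos _)]

theorem sum_leadExp_eq_iff (hn : 1 ≤ n)
    (hex : ∃ δ, CarriesMaximally n (fun j : Fin m => negMul p n j) δ)
    {δ δ' : Equiv.Perm (Fin m)} (hδ : δ ∈ minPerms p n m) :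
    ∑ i : Fin m, leadExp p n i (δ' i) = ∑ i : Fin m, leadExp p n i (δ i) ↔
      CarriesMaximally n (fun j : Fin m => negMul p n j) δ' := by
  rw [← mem_minPerms_iff hn hex]
  constructor
  · intro h δ''
    exact ((sum_leadExp_le_iff hn).1 h.le).trans (hδ δ'')
  · intro hδ'
    exact ((sum_leadExp_le_iff hn).2 (hδ' δ)).antisymm ((sum_leadExp_le_iff hn).2 (hδ δ'))

theorem natAbs_det_le_maxDet {x : Fin m → ℕ} (hx : Function.Injective x) (hxn : ∀ i, x i < n) :
    (vandermondeLike m fun i => (x i : ℤ)).det.natAbs ≤ maxDet n m := by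
  let y : Fin m ↪ Fin n := ⟨fun i => ⟨x i, hxn i⟩, fun i j hij => hx (Fin.ext_iff.1 hij)⟩
  have := Finset.le_sup (f := fun x : Fin m ↪ Fin n =>
    (vandermondeLike m fun i => ((x i : ℕ) : ℤ)).det.natAbs) (Finset.mem_univ y)
  exact this

variable [Fact p.Prime] {K : Type*} [NormedField K] [NormedAlgebra ℚ_[p] K]

theorem charZero_of_normedAlgebra (p : ℕ) [Fact p.Prime] (K : Type*) [NormedField K]
    [NormedAlgebra ℚ_[p] K] : CharZero K :=
  charZero_of_injective_algebraMap (algebraMap ℚ_[p] K).injective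

theorem norm_natCast_eq_one {N : ℕ} (hN : ¬ p ∣ N) : ‖(N : K)‖ = 1 := by
  rw [← map_natCast (algebraMap ℚ_[p] K), norm_algebraMap', Padic.norm_natCast_eq_one_iff]
  exact (Nat.Prime.coprime_iff_not_dvd Fact.out).2 hN

theorem norm_intCast_eq_one {z : ℤ} (h0 : z ≠ 0) (hz : z.natAbs < p) : ‖(z : K)‖ = 1 := by
  have hN := norm_natCast_eq_one (K := K) (Nat.not_dvd_of_pos_of_lt (Int.natAbs_pos.2 h0) hz)
  rcases Int.natAbs_eq z with h | h <;> rw [h] <;> simpa using hN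

theorem norm_factorial_eq_one {k : ℕ} (hk : k < p) : ‖(k.factorial : K)‖ = 1 :=
  norm_natCast_eq_one fun h => hk.not_ge ((Nat.Prime.dvd_factorial Fact.out).1 h)

theorem norm_leadCoeff {i j : ℕ} (hi : i < n) (hj : j + 2 ≤ n) (hnp : n < p) :
    ‖(leadCoeff n (negMul p n j) (p * j) i : K)‖ = 1 := by
  have := charZero_of_normedAlgebra p K
  rw [leadCoeff]
  push_cast
  rw [norm_div, norm_mul, norm_pow, norm_factorial_eq_one (sub_div_negMul_lt hi hj hnp.le),
    norm_factorial_eq_one ((Nat.mod_lt _ (by omega)).trans hnp)]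
  simp

theorem norm_det_leadVandermonde (hmn : m ≤ n) (hnp : n < p) (hV : VandermondeAssumption n m)
    (hmax : maxDet n m < p) :
    ‖((leadVandermonde n fun j : Fin m => negMul p n j).det : K)‖ = 1 := by
  have hlt (j : Fin m) : (negMul p n j + (m - 1)) % n < n := Nat.mod_lt _ (j.pos.trans_le hmn)
  rcases Nat.eq_zero_or_pos m with rfl | hm
  · simp
  have hpn : Nat.Coprime p n :=
    (Nat.Prime.coprime_iff_not_dvd Fact.out).2 (Nat.not_dvd_of_pos_of_lt (hm.trans_le hmn) hnp)
  have hinj := mod_add_injective (negMul_mod_injective hpn hmn) (m - 1)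
  refine norm_intCast_eq_one ?_ ((natAbs_det_le_maxDet hinj hlt).trans_lt hmax)
  exact hV _ (fun i j hij => hinj (by exact_mod_cast hij))
    fun i => ⟨by positivity, Int.le_sub_one_of_lt (by exact_mod_cast hlt i)⟩

open Classical in
theorem norm_sum_leadCoeff (hmn : m + 1 ≤ n) (hnp : n < p) (hV : VandermondeAssumption n m)
    (hmax : maxDet n m < p) :
    ‖∑ δ : Equiv.Perm (Fin m) with CarriesMaximally n (fun j : Fin m => negMul p n j) δ,
      (Equiv.Perm.sign δ : K) *
        ∏ i : Fin m, (leadCoeff n (negMul p n (δ i)) (p * (δ i)) i : K)‖ = 1 := by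
  have := charZero_of_normedAlgebra p K
  have hsum := congrArg (Rat.cast : ℚ → K) (sum_sign_mul_prod_leadCoeff (by omega : 0 < n)
    (fun j : Fin m => negMul p n j) fun j => p * j)
  simp only [Rat.cast_sum, Rat.cast_mul, Rat.cast_intCast, Rat.cast_prod] at hsum
  rw [hsum, norm_mul, norm_mul, norm_units_intCast, norm_prod,
    norm_det_leadVandermonde (by omega) hnp hV hmax,
    Finset.prod_eq_one fun j _ => norm_leadCoeff (by omega) (by omega) hnp, one_mul, one_mul]

theorem exists_carriesMaximally (hmn : m + 1 ≤ n) (hnp : n < p) (hV : VandermondeAssumption n m)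
    (hmax : maxDet n m < p) :
    ∃ δ, CarriesMaximally n (fun j : Fin m => negMul p n j) δ := by
  classical
  by_contra! hnone
  have hsum := norm_sum_leadCoeff (K := ℚ_[p]) hmn hnp hV hmax
  rw [Finset.filter_false_of_mem fun δ _ => hnone δ] at hsum
  simp at hsum

open Classical in
theorem norm_sum_pow_mul_leadCoeff (hmn : m + 1 ≤ n) (hnp : n < p) (hV : VandermondeAssumption n m)
    (hmax : maxDet n m < p) {τ : K} (hτ : ‖τ‖ = 1) :
    ‖∑ δ : Equiv.Perm (Fin m) with CarriesMaximally n (fun j : Fin m => negMul p n j) δ,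
      (Equiv.Perm.sign δ : K) * ∏ i : Fin m, (τ ^ ((negMul p n (δ i) + i) % n) *
        (leadCoeff n (negMul p n (δ i)) (p * (δ i)) i : K))‖ = 1 := by
  have hex := exists_carriesMaximally hmn hnp hV hmax
  have hmin := sum_mod_minimal_iff (by omega : 0 < n) hex
  obtain ⟨δ₀, h₀⟩ := hex
  have hterm : ∀ δ ∈ Finset.univ.filter (CarriesMaximally n fun j : Fin m => negMul p n j),
      (Equiv.Perm.sign δ : K) * ∏ i : Fin m, (τ ^ ((negMul p n (δ i) + i) % n) *
          (leadCoeff n (negMul p n (δ i)) (p * (δ i)) i : K)) =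
        τ ^ (∑ i : Fin m, (negMul p n (δ₀ i) + i) % n) * ((Equiv.Perm.sign δ : K) *
          ∏ i : Fin m, (leadCoeff n (negMul p n (δ i)) (p * (δ i)) i : K)) := fun δ hδ => by
    rw [Finset.prod_mul_distrib, Finset.prod_pow_eq_pow_sum, mul_left_comm,
      ((hmin δ).2 (Finset.mem_filter.1 hδ).2 δ₀).antisymm ((hmin δ₀).2 h₀ δ)]
  rw [Finset.sum_congr rfl hterm, ← Finset.mul_sum, norm_mul, norm_pow, hτ, one_pow, one_mul,
    norm_sum_leadCoeff hmn hnp hV hmax]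

variable [IsUltrametricDist K] [CompleteSpace K] {π t : K} {σ : K ≃+* K}
  {A : Matrix (Fin (2 * n + 1)) (Fin (2 * n + 1)) K}

theorem norm_entry_sub_leadExp_le (h : IsFrobeniusDatum p n σ π t)
    (hp : (2 * n + 1) * (n - 1) + 1 < p) (hA : IsFrobeniusMatrix p n σ π t A)
    {i j : Fin (2 * n + 1)} (hi : (i : ℕ) < n) (hj : (j : ℕ) < n) :
    ‖A i j - π ^ leadExp p n i j *
      (σ.symm t ^ ((negMul p n j + i) % n) * (leadCoeff n (negMul p n j) (p * j) i : K))‖ ≤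
        ‖π‖ ^ (leadExp p n i j + 1) := by
  have := charZero_of_normedAlgebra p K
  have hentry := norm_frobenius_entry_sub_le h hp hA hi hj (Nat.mod_lt _ (i.1.zero_le.trans_lt hi))
    (mul_sub_div_negMul hi j)
  rw [div_eq_mul_one_div] at hentry
  rw [leadExp, leadCoeff]
  push_cast
  exact hentry

theorem norm_leading_minor (h : IsFrobeniusDatum p n σ π t) (hp : (2 * n + 1) * (n - 1) + 1 < p)
    (hmn : m + 1 ≤ n) (hV : VandermondeAssumption n m) (hmax : maxDet n m < p)
    (hA : IsFrobeniusMatrix p n σ π t A) {δ : Equiv.Perm (Fin m)} (hδ : δ ∈ minPerms p n m)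
    (hle : m ≤ 2 * n + 1) :
    ‖(A.submatrix (Fin.castLE hle) (Fin.castLE hle)).det‖ =
      ‖π‖ ^ ∑ i : Fin m, leadExp p n i (δ i) := by
  classical
  have hn : 1 ≤ n := by omega
  have hnp : n < p := by
    have : 1 * (n - 1) ≤ (2 * n + 1) * (n - 1) := by gcongr; omega
    omega
  have hτ : ‖σ.symm t‖ = 1 := by rw [h.norm_symm, h.norm_t]
  have hex := exists_carriesMaximally hmn hnp hV hmax
  have hlead : (Finset.univ.filter fun δ' : Equiv.Perm (Fin m) =>
      ∑ i : Fin m, leadExp p n i (δ' i) = ∑ i : Fin m, leadExp p n i (δ i)) =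
        Finset.univ.filter (CarriesMaximally n fun j : Fin m => negMul p n j) :=
    Finset.filter_congr fun δ' _ => sum_leadExp_eq_iff hn hex hδ
  refine norm_det_eq_of_leading_terms (e := fun i j : Fin m => leadExp p n i j)
    (U := fun i j : Fin m => σ.symm t ^ ((negMul p n j + i) % n) *
      (leadCoeff n (negMul p n j) (p * j) i : K))
    h.ne_zero h.norm_lt_one (fun i j => ?_) (fun i j => ?_)
    (fun δ' => (sum_leadExp_le_iff hn).2 (hδ δ')) ?_
  · rw [norm_mul, norm_pow, hτ, one_pow, one_mul, norm_leadCoeff (by omega) (by omega) hnp]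
  · exact norm_entry_sub_leadExp_le h hp hA (i := Fin.castLE hle i) (j := Fin.castLE hle j)
      (i.isLt.trans hmn) (j.isLt.trans hmn)
  · rw [hlead]
    exact norm_sum_pow_mul_leadCoeff hmn hnp hV hmax hτ

end LeadingMinor

section CharacteristicSeries

variable {p n m : ℕ} {K : Type*} [NormedField K] [IsUltrametricDist K] [CompleteSpace K]
  {π t : K} {σ : K ≃+* K} {A : Matrix (Fin (2 * n + 1)) (Fin (2 * n + 1)) K}

theorem norm_other_minor_le (h : IsFrobeniusDatum p n σ π t)
    (hp : (2 * n + 1) * (n * (n - 1)) + 1 < p) (hmn : m ≤ n)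
    (hA : IsFrobeniusMatrix p n σ π t A) (δ : Equiv.Perm (Fin m))
    {S S₀ : Finset (Fin (2 * n + 1))} (hS : S.card = S₀.card) (h₀ : ∀ j, j ∈ S₀ ↔ (j : ℕ) < m)
    (hsum : ∑ j ∈ S₀, (j : ℕ) = ∑ i : Fin m, (i : ℕ)) (hne : S ≠ S₀) :
    ‖(A.submatrix (Subtype.val : S → Fin (2 * n + 1)) Subtype.val).det‖ ≤
      ‖π‖ ^ (∑ i : Fin m, leadExp p n i (δ i) + 1) := by
  have hα : (2 * n + 1) * (alphaSum p n m δ).toNat ≤ (2 * n + 1) * (n * (n - 1)) := by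
    gcongr
    exact toNat_alphaSum_le hmn δ
  have hlt := sum_min_lt hmn S S₀ hS h₀ hne
  refine (norm_det_le_of_columns _ (norm_nonneg π) (fun j : S => (p - 1) * min (j.1 : ℕ) n)
    fun i j => norm_frobenius_entry_le h hA _ _).trans
      (pow_le_pow_of_le_one (norm_nonneg π) h.norm_lt_one.le ?_)
  rw [← Finset.mul_sum, Finset.sum_coe_sort S fun j : Fin (2 * n + 1) => min (j : ℕ) n,
    sum_leadExp h.isTwistFor.one_le_n, ← hsum]
  calc (p - 1) * ∑ j ∈ S₀, (j : ℕ) + (2 * n + 1) * (alphaSum p n m δ).toNat + 1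
      ≤ (p - 1) * (∑ j ∈ S₀, (j : ℕ) + 1) := by rw [mul_add]; omega
    _ ≤ _ := by gcongr; exact hlt

open Polynomial in
theorem norm_coeff_det [Fact p.Prime] [NormedAlgebra ℚ_[p] K] (h : IsFrobeniusDatum p n σ π t)
    (hp : (2 * n + 1) * (n * (n - 1)) + 1 < p) (hmn : m + 1 ≤ n)
    (hV : VandermondeAssumption n m) (hmax : maxDet n m < p)
    (hA : IsFrobeniusMatrix p n σ π t A) {δ : Equiv.Perm (Fin m)} (hδ : δ ∈ minPerms p n m) :
    ‖(1 - (X : K[X]) • A.map C).det.coeff m‖ = ‖π‖ ^ ∑ i : Fin m, leadExp p n i (δ i) := by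
  have hle : m ≤ 2 * n + 1 := by omega
  let S₀ : Finset (Fin (2 * n + 1)) := Finset.univ.map (Fin.castLEEmb hle)
  have hS₀ (j : Fin (2 * n + 1)) : j ∈ S₀ ↔ (j : ℕ) < m := by
    simp only [S₀, Finset.mem_map, Finset.mem_univ, true_and]
    exact ⟨fun ⟨i, hi⟩ => hi ▸ i.isLt, fun hj => ⟨⟨j, hj⟩, rfl⟩⟩
  have hcard : S₀.card = m := by simp [S₀]
  have hminor : ‖(A.submatrix (Subtype.val : S₀ → Fin (2 * n + 1)) Subtype.val).det‖ =
      ‖π‖ ^ ∑ i : Fin m, leadExp p n i (δ i) := by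
    let e : Fin m ≃ S₀ := Equiv.ofBijective (fun i => ⟨Fin.castLE hle i, (hS₀ _).2 i.isLt⟩)
      ⟨fun i j hij => Fin.castLE_injective hle (Subtype.ext_iff.1 hij),
        fun j => ⟨⟨j.1, (hS₀ _).1 j.2⟩, rfl⟩⟩
    have hp' : (2 * n + 1) * (n - 1) ≤ (2 * n + 1) * (n * (n - 1)) := by
      gcongr
      exact Nat.le_mul_of_pos_left _ (by omega)
    rw [← Matrix.det_submatrix_equiv_self e, Matrix.submatrix_submatrix]
    exact norm_leading_minor h (by omega) hmn hV hmax hA hδ hle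
  have hdet := norm_coeff_det_eq_of_dominant_minor A hminor (by positivity)
    (pow_lt_pow_right_of_lt_one₀ h.norm_pos h.norm_lt_one (Nat.lt_succ_self _))
    fun S hS => norm_other_minor_le h hp (by omega) hA δ hS hS₀ (by simp [S₀])
  rwa [hcard] at hdet

end CharacteristicSeries

section SplittingRoot

variable {p n m : ℕ} {K : Type*} [NormedField K] {π t : K} {σ : K ≃+* K}

theorem gammaSum_exponent_le (hp : 2 ≤ p) (hn : 1 ≤ n) (i d : ℕ) :
    n * p ^ i + i + n * (p - 1) * (d + (i + 1)) ≤ n * p ^ (d + (i + 1)) + n * (p - 1) * i := by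
  obtain ⟨q, rfl⟩ : ∃ q, p = q + 1 := ⟨p - 1, by omega⟩
  rw [Nat.add_sub_cancel]
  have hi : i + 1 ≤ (q + 1) ^ i := Nat.lt_pow_self (by omega)
  have hq : 1 * i ≤ n * q * i := by
    gcongr
    exact Nat.mul_pos (by omega) (by omega)
  induction d with
  | zero =>
    rw [zero_add, pow_succ]
    linarith [Nat.mul_le_mul_left (n * q) hi]
  | succ d ih =>
    have hpow : 1 ≤ (q + 1) ^ (d + (i + 1)) := Nat.one_le_pow _ _ (by omega)
    rw [show d + 1 + (i + 1) = d + (i + 1) + 1 by ring, pow_succ]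
    linarith [Nat.mul_le_mul_left (n * q) hpow]

/- Since the full series vanishes at `γ`, the partial sum `γ_i` is minus the tail, whose terms are
small. -/
theorem norm_gammaSum_mul_le [IsUltrametricDist K] (hp : 2 ≤ p) (hn : 1 ≤ n) (h0 : π ≠ 0)
    (h1 : ‖π‖ ≤ 1) (hpπ : ‖(p : K)‖ = ‖π‖ ^ (n * (p - 1)))
    (hsum : HasSum (fun k : ℕ => (π ^ n) ^ p ^ k / (p : K) ^ k) 0) (i : ℕ) :
    ‖gammaSum p (π ^ n) i * (p : K) ^ i‖ ≤ ‖π‖ ^ (n * p ^ i + i) := by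
  have hpos : 0 < ‖π‖ := norm_pos_iff.2 h0
  have htail := hsum.summable.sum_add_tsum_nat_add (i + 1)
  rw [hsum.tsum_eq] at htail
  rw [gammaSum, eq_neg_of_add_eq_zero_left htail, norm_mul, norm_neg, norm_pow, hpπ, ← pow_mul,
    ← le_div_iff₀ (by positivity)]
  refine IsUltrametricDist.norm_tsum_le_of_forall_le_of_nonneg (by positivity) fun d => ?_
  rw [norm_div, norm_pow, norm_pow, norm_pow, hpπ, ← pow_mul, ← pow_mul,
    div_le_div_iff₀ (by positivity) (by positivity), ← pow_add, ← pow_add]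
  exact pow_le_pow_of_le_one hpos.le h1 (gammaSum_exponent_le hp hn i d)

variable [Fact p.Prime]

theorem one_lt_prime (p : ℕ) [Fact p.Prime] : (1 : ℝ) < p :=
  Nat.one_lt_cast.2 (Nat.Prime.one_lt Fact.out)

theorem isFrobeniusDatum_of_hasSum [NormedAlgebra ℚ_[p] K] [IsUltrametricDist K] (hn : 1 ≤ n)
    (hpn : ¬p ∣ n) (hπ : ‖π‖ ^ (n * (p - 1)) = (p : ℝ)⁻¹)
    (hsum : HasSum (fun k : ℕ => (π ^ n) ^ p ^ k / (p : K) ^ k) 0)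
    (hσ : ∀ x, ‖σ x‖ = ‖x‖) (hσπ : σ π = π) (ht : ‖t‖ = 1) : IsFrobeniusDatum p n σ π t := by
  have hp2 : 2 ≤ p := Nat.Prime.two_le Fact.out
  have hlt : ‖π‖ ^ (n * (p - 1)) < 1 := hπ ▸ inv_lt_one_of_one_lt₀ (one_lt_prime p)
  have hπ1 : ‖π‖ < 1 := lt_of_not_ge fun h => hlt.not_ge (one_le_pow₀ h)
  have hπ0 : π ≠ 0 := by
    rintro rfl
    rw [norm_zero, zero_pow (Nat.mul_pos hn (by omega)).ne'] at hπ
    exact inv_ne_zero (by positivity) hπ.symm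
  have hpπ : ‖(p : K)‖ = ‖π‖ ^ (n * (p - 1)) := by
    rw [hπ, ← map_natCast (algebraMap ℚ_[p] K), norm_algebraMap', Padic.norm_p]
  refine ⟨⟨hn, hπ0, hπ1, by simp [gammaSum], norm_gammaSum_mul_le hp2 hn hπ0 hπ1.le hpπ hsum,
    fun i => ?_⟩, hp2, norm_natCast_eq_one hpn, fun k => ?_, hσ, hσπ⟩
  · induction i with
    | zero => exact ht
    | succ i ih => rw [Function.iterate_succ_apply', hσ, ih]
  · rw [← map_ratCast (algebraMap ℚ_[p] K), norm_algebraMap']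
    exact norm_coeff_artinHasse_le p k

theorem ordp_eq_of_norm_eq_pow (hπ : ‖π‖ ^ (n * (p - 1)) = (p : ℝ)⁻¹) {b : K} {N : ℕ}
    (hb : ‖b‖ = ‖π‖ ^ N) : ordp p b = ((N / (n * ((p : ℝ) - 1)) : ℝ) : WithTop ℝ) := by
  have hp1 := one_lt_prime p
  have hlog := congrArg (Real.logb p) hπ
  rw [Real.logb_pow, Real.logb_inv, Real.logb_self_eq_one hp1, Nat.cast_mul,
    Nat.cast_sub (Nat.Prime.one_le Fact.out), Nat.cast_one] at hlog
  have hden : (n : ℝ) * (p - 1) ≠ 0 := fun h => by simp [h] at hlog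
  have hπ0 : ‖π‖ ≠ 0 := fun h => by simp [h] at hlog
  have hb0 : b ≠ 0 := norm_ne_zero_iff.1 (hb ▸ pow_ne_zero N hπ0)
  rw [ordp, if_neg hb0, hb, Real.logb_pow, eq_div_of_mul_eq hden ((mul_comm _ _).trans hlog)]
  congr 1
  ring

theorem sum_leadExp_div (hn : 1 ≤ n) (δ : Equiv.Perm (Fin m)) :
    ((∑ i : Fin m, leadExp p n i (δ i) : ℕ) : ℝ) / (n * ((p : ℝ) - 1)) =
      (m : ℝ) * (m - 1) / (2 * n) +
        (2 * n + 1) / (n * ((p : ℝ) - 1)) * (alphaSum p n m δ : ℝ) := by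
  have hp1 : (p : ℝ) - 1 ≠ 0 := (sub_pos.2 (one_lt_prime p)).ne'
  have hn0 : (n : ℝ) ≠ 0 := by positivity
  have hα : ((alphaSum p n m δ).toNat : ℝ) = alphaSum p n m δ := by
    rw [alphaSum_eq_natCast hn, Int.toNat_natCast, Int.cast_natCast]
  have hgauss : ((∑ i : Fin m, (i : ℕ) : ℕ) : ℝ) * 2 = m * (m - 1) := by
    rw [Fin.sum_univ_eq_sum_range (fun i => i), ← Nat.cast_ofNat, ← Nat.cast_mul,
      Finset.sum_range_id_mul_two]
    cases m <;> simp
  rw [sum_leadExp hn, Nat.cast_add, Nat.cast_mul, Nat.cast_mul, hα,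
    Nat.cast_sub (Nat.Prime.one_le Fact.out), eq_div_of_mul_eq two_ne_zero hgauss]
  push_cast
  field_simp

end SplittingRoot

section LocalField

variable {p : ℕ} [Fact p.Prime] {a n : ℕ} {γ γt : ℂ_[p]}

theorem finiteDimensional_adjoin_of_root {F E : Type*} [Field F] [Field E] [Algebra F E]
    {P : Polynomial F} (hP : P ≠ 0) {S : Set E} (hS : ∀ z ∈ S, Polynomial.aeval z P = 0) :
    FiniteDimensional F (IntermediateField.adjoin F S) := by
  have : Finite S := (Polynomial.rootSet_finite P E).subset fun z hz =>
    Polynomial.mem_rootSet.2 ⟨hP, hS z hz⟩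
  exact IntermediateField.finiteDimensional_adjoin fun z hz =>
    IsAlgebraic.isIntegral ⟨P, hP, hS z hz⟩

theorem finiteDimensional_Qq (ha : 1 ≤ a) : FiniteDimensional ℚ_[p] (Qq p a) :=
  finiteDimensional_adjoin_of_root
    (FiniteField.X_pow_card_pow_sub_X_ne_zero ℚ_[p] (Nat.one_le_iff_ne_zero.1 ha)
      (Nat.Prime.one_lt Fact.out))
    fun z (hz : z ^ p ^ a = z) => by simpa [sub_eq_zero] using hz

theorem finiteDimensional_Omega1 : FiniteDimensional ℚ_[p] (Omega1 p) :=
  finiteDimensional_adjoin_of_root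
    (Polynomial.X_pow_sub_C_ne_zero (Nat.Prime.pos Fact.out) (1 : ℚ_[p]))
    fun z (hz : z ^ p = 1) => by simpa [sub_eq_zero] using hz

theorem finiteDimensional_Omega0 (ha : 1 ≤ a) (hn : 1 ≤ n) (hγ : γ ∈ Omega1 p) (h : γt ^ n = γ) :
    FiniteDimensional ℚ_[p] (Omega0 p a γt) := by
  have := finiteDimensional_Qq (p := p) ha
  have := finiteDimensional_Omega1 (p := p)
  have hγ_int : IsIntegral ℚ_[p] γ :=
    IntermediateField.isIntegral_iff.1 (IsIntegral.of_finite ℚ_[p] (⟨γ, hγ⟩ : Omega1 p))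
  have := IntermediateField.adjoin.finiteDimensional (IsIntegral.of_pow hn (h ▸ hγ_int))
  rw [Omega0]
  infer_instance

theorem norm_algEquiv_eq {L : Type*} [NormedField L] [NormedAlgebra ℚ_[p] L]
    [FiniteDimensional ℚ_[p] L] (σ : L ≃ₐ[ℚ_[p]] L) (x : L) : ‖σ x‖ = ‖x‖ := by
  have : IsUltrametricDist L := .of_normedAlgebra ℚ_[p]
  rw [NormedAlgebra.norm_eq_spectralNorm ℚ_[p], NormedAlgebra.norm_eq_spectralNorm ℚ_[p] x]
  exact (spectralNorm_eq_of_equiv σ x).symm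

theorem IsSplittingRoot.norm_pow (hγ : IsSplittingRoot p γ) : ‖γ‖ ^ (p - 1) = (p : ℝ)⁻¹ := by
  have hord := hγ.2.2
  have hp1 := one_lt_prime p
  have h0 : γ ≠ 0 := fun h0 => by simp [ordp, h0] at hord
  have hpos : 0 < ‖γ‖ := norm_pos_iff.2 h0
  rw [ordp, if_neg h0, WithTop.coe_inj, neg_eq_iff_eq_neg] at hord
  refine Real.logb_injOn_pos hp1 (pow_pos hpos _) (inv_pos.2 (zero_lt_one.trans hp1)) ?_
  rw [Real.logb_pow, Real.logb_inv, Real.logb_self_eq_one hp1, hord,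
    Nat.cast_sub (Nat.Prime.one_le Fact.out), Nat.cast_one, mul_neg,
    mul_one_div_cancel (sub_ne_zero.2 hp1.ne')]

theorem norm_eq_one_of_pow_eq_self {L : Type*} [NormedField L] {t : L} {N : ℕ} (hN : 1 < N)
    (ht : t ^ N = t) (h0 : t ≠ 0) : ‖t‖ = 1 := by
  have hpow : ‖t‖ ^ (N - 1) = 1 := by
    refine mul_right_cancel₀ (norm_ne_zero_iff.2 h0) ?_
    rw [← pow_succ, Nat.sub_add_cancel hN.le, ← norm_pow, ht, one_mul]
  exact (pow_eq_one_iff_of_nonneg (norm_nonneg t) (by omega)).1 hpow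

theorem hasSum_gen (hγ : IsSplittingRoot p γ) (h : γt ^ n = γ) :
    HasSum (fun k : ℕ => (gen p a γt ^ n) ^ p ^ k / (p : Omega0 p a γt) ^ k) 0 := by
  have hind : IsInducing (algebraMap (Omega0 p a γt) ℂ_[p]) := .subtypeVal
  rw [← hind.hasSum_iff, map_zero]
  convert hγ.2.1 using 2 with k
  simp [← h, gen]

end LocalField

end ToricNP

open ToricNP in
theorem theorem3p5_general (p : ℕ) [Fact p.Prime] (n m : ℕ) (hmn : m + 1 ≤ n)
    (hV : VandermondeAssumption n m)
    (hp : max (maxDet n m : ℤ) (2 * (n : ℤ) ^ 3 - (n : ℤ) ^ 2 - n + 1) < p)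
    {K : Type*} [NormedField K] [NormedAlgebra ℚ_[p] K] [CompleteSpace K] (π : K)
    (hπ : ‖π‖ ^ (n * (p - 1)) = (p : ℝ)⁻¹)
    (hsum : HasSum (fun k : ℕ => (π ^ n) ^ p ^ k / (p : K) ^ k) 0)
    (σ : K ≃+* K) (hσ : ∀ x, ‖σ x‖ = ‖x‖) (hσπ : σ π = π) (t : K) (ht : ‖t‖ = 1) :
    EpsIsBasis p n σ π t ∧ (∃! A, IsFrobeniusMatrix p n σ π t A) ∧
    ∀ A, IsFrobeniusMatrix p n σ π t A → ∀ δ ∈ minPerms p n m,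
      ordp p ((1 - (Polynomial.X : Polynomial K) • A.map Polynomial.C).det.coeff m) =
        (((m : ℝ) * (m - 1) / (2 * n) +
          (2 * n + 1) / (n * ((p : ℝ) - 1)) * (alphaSum p n m δ : ℝ) : ℝ) : WithTop ℝ) := by
  have : IsUltrametricDist K := .of_normedAlgebra ℚ_[p]
  have hn : 1 ≤ n := by omega
  obtain ⟨hmax, hpn⟩ := max_lt_iff.1 hp
  have hpn' : (2 * n + 1) * (n * (n - 1)) + 1 < p := by
    zify [hn]
    linarith
  have hnp : 1 * (1 * (n - 1)) ≤ (2 * n + 1) * (n * (n - 1)) := by gcongr; omega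
  have h := isFrobeniusDatum_of_hasSum hn (Nat.not_dvd_of_pos_of_lt hn (by omega)) hπ hsum hσ hσπ ht
  refine ⟨epsIsBasis h.isTwistFor h.norm_n, existsUnique_frobeniusMatrix h, fun A hA δ hδ => ?_⟩
  have hdet := norm_coeff_det h hpn' hmn hV (by exact_mod_cast hmax) hA hδ
  rw [ordp_eq_of_norm_eq_pow hπ hdet, sum_leadExp_div hn]

theorem theorem3p5
    (p : ℕ) [Fact p.Prime] (a n m : ℕ) (ha : 1 ≤ a) (hn : 1 < n) (hm : 2 ≤ m) (hmn : m + 1 ≤ n)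
    (hV : ToricNP.VandermondeAssumption n m)
    (hp : max (ToricNP.maxDet n m : ℤ) (2 * (n : ℤ) ^ 3 - (n : ℤ) ^ 2 - n + 1) < p)
    (γ γt : ℂ_[p]) (hγ : ToricNP.IsSplittingRoot p γ) (hγt : γt ^ n = γ)
    (σ : ToricNP.Omega0 p a γt ≃ₐ[ℚ_[p]] ToricNP.Omega0 p a γt)
    (hσ : ToricNP.IsFrobenius p a γt σ)
    (tbar : ToricNP.Omega0 p a γt) (htbar : tbar ^ p ^ a = tbar) (htbar0 : tbar ≠ 0) :
    ToricNP.EpsIsBasis p n σ.toRingEquiv (ToricNP.gen p a γt) tbar ∧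
    (∃! A, ToricNP.IsFrobeniusMatrix p n σ.toRingEquiv (ToricNP.gen p a γt) tbar A) ∧
    ∀ A, ToricNP.IsFrobeniusMatrix p n σ.toRingEquiv (ToricNP.gen p a γt) tbar A →
      ∀ δ ∈ ToricNP.minPerms p n m,
        ToricNP.ordp p
            ((1 - (Polynomial.X : Polynomial (ToricNP.Omega0 p a γt)) •
              A.map Polynomial.C).det.coeff m) =
          (((m : ℝ) * (m - 1) / (2 * n) +
            (2 * n + 1) / (n * ((p : ℝ) - 1)) * (ToricNP.alphaSum p n m δ : ℝ) : ℝ) :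
              WithTop ℝ) := by
  have := ToricNP.finiteDimensional_Omega0 (a := a) ha hn.le hγ.1 hγt
  have : CompleteSpace (ToricNP.Omega0 p a γt) := FiniteDimensional.complete ℚ_[p] _
  have hnorm : ‖γt‖ ^ (n * (p - 1)) = (p : ℝ)⁻¹ := by rw [pow_mul, ← norm_pow, hγt, hγ.norm_pow]
  exact theorem3p5_general p n m hmn hV hp (ToricNP.gen p a γt) hnorm
    (ToricNP.hasSum_gen hγ hγt) σ.toRingEquiv (ToricNP.norm_algEquiv_eq σ) hσ.2.2 tbar
    (ToricNP.norm_eq_one_of_pow_eq_self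
      (Nat.one_lt_pow (by omega) (Nat.Prime.one_lt Fact.out)) htbar htbar0)
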